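/- Let $d\in\{2,3\}$ and let $\Omega\subset\mathbb R^d$ be a bounded domain with Lipschitz boundary. Let $\sigma\in L^\infty(\Omega)$ satisfy $\sigma\ge\lambda$ a.e. in $\Omega$ for some constant $\lambda>0$ (for instance, $\sigma$ piecewise constant on a polytopal partition of $\Omega$). Let $U\in W^{1,\infty}(\mathbb R^d;\mathbb R^d)$ (continuous representative) vanish in a neighbourhood of $\partial\Omega$, let $DU$ be its weak Jacobian, and put $$\Phi_t(x)=x+tU(x),\qquad \sigma_t=\sigma\circ\Phi_t^{-1},\qquad \mathcal A=\operatorname{div}(U)\,I-(DU+DU^T),$$ where $\Phi_t$ is bijective for small $|t|$. Let $g\in H_0^{-1/2}(\partial\Omega)$, i.e. a bounded linear functional on the space $H^{1/2}(\partial\Omega)$ of traces of $H^1(\Omega)$ functions with $\langle g,1\rangle=0$, and let $f\in H^{1/2}(\partial\Omega)$. Let $u\in H^1(\Omega)$ be the solution of $$\int_\Omega\sigma\nabla u\cdot\nabla w\,dx=\langle g,w|_{\partial\Omega}\rangle\quad\forall w\in H^1(\Omega),\qquad \int_{\partial\Omega}u\,ds=\int_{\partial\Omega}f\,ds,$$ which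 is the weak form of $-\nabla\cdot(\sigma\nabla u)=0$ in $\Omega$, $\sigma\,\partial u/\partial\nu=g$ on $\partial\Omega$; and for small $t\ne0$ let $u_t\in H^1(\Omega)$ be the solution of the same problem with $\sigma_t$ in place of $\sigma$. Then $u$ has a material derivative: there is $\dot u\in H^1(\Omega)$ with $$\int_\Omega\sigma\nabla\dot u\cdot\nabla w\,dx=-\int_\Omega\sigma\mathcal A\nabla u\cdot\nabla w\,dx\quad\forall w\in H^1(\Omega),\qquad \int_{\partial\Omega}\dot u\,ds=0,$$ such that $u_t\circ\Phi_t\in H^1(\Omega)$ for all sufficiently small $t\neq0$ and $$\frac{u_t\circ\Phi_t-u}{t}\longrightarrow\dot u\quad\text{strongly in }H^1(\Omega)\text{ as }t\to0.$$ -/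

import Mathlib

open MeasureTheory Filter Topology Set
open scoped ENNReal NNReal ContDiff RealInnerProductSpace

noncomputable section

namespace EIT

/-- `ℝ^d` with its Euclidean norm. -/
abbrev E (d : ℕ) : Type := EuclideanSpace ℝ (Fin d)

variable {d : ℕ}

/-- `Ω` has a Lipschitz boundary: near each boundary point, `Ω` is the set of points lying strictly
on one side of the graph of a Lipschitz function over a hyperplane with unit normal `ν`
(`y - ⟪ν, y⟫ • ν` is the orthogonal projection of `y` to that hyperplane). -/
def HasLipschitzBoundary (Ω : Set (E d)) : Prop :=
  ∀ x ∈ frontier Ω, ∃ r : ℝ, 0 < r ∧ ∃ ν : E d, ‖ν‖ = 1 ∧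
    ∃ (K : ℝ≥0) (ψ : E d → ℝ), LipschitzWith K ψ ∧
      ∀ y ∈ Metric.ball x r, (y ∈ Ω ↔ ψ (y - ⟪ν, y⟫ • ν) < ⟪ν, y⟫)

/-- A bounded domain (nonempty, open, connected) with Lipschitz boundary. -/
structure IsBoundedLipschitzDomain (Ω : Set (E d)) : Prop where
  isOpen : IsOpen Ω
  isConnected : IsConnected Ω
  isBounded : Bornology.IsBounded Ω
  lipschitz : HasLipschitzBoundary Ω

/-- `f'` satisfies the integration by parts identity of the weak derivative of `f` in `Ω`, tested
with all `φ ∈ C_c^∞(Ω)` in all directions `v`. (It is only used for functions `f`, `f'` that are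
locally integrable in `Ω`.) -/
def HasWeakFDeriv {F : Type*} [NormedAddCommGroup F] [NormedSpace ℝ F]
    (Ω : Set (E d)) (f : E d → F) (f' : E d → E d →L[ℝ] F) : Prop :=
  ∀ φ : E d → ℝ, ContDiff ℝ ∞ φ → HasCompactSupport φ → tsupport φ ⊆ Ω → ∀ v : E d,
    ∫ x in Ω, fderiv ℝ φ x v • f x = - ∫ x in Ω, φ x • f' x v

theorem memLp_test {Ω : Set (E d)} {φ : E d → ℝ} (h : Continuous φ) (hc : HasCompactSupport φ) :
    MemLp φ 2 (volume.restrict Ω) :=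
  (h.memLp_of_hasCompactSupport hc).restrict Ω

theorem memLp_test_fderiv {Ω : Set (E d)} {φ : E d → ℝ} (h : ContDiff ℝ ∞ φ)
    (hc : HasCompactSupport φ) (v : E d) :
    MemLp (fun x => fderiv ℝ φ x v) 2 (volume.restrict Ω) :=
  memLp_test ((h.continuous_fderiv (by simp)).clm_apply continuous_const) (hc.fderiv_apply ℝ v)

/-- The Sobolev space `H^1(Ω)`, as the space of pairs `(u, ∇u) ∈ L²(Ω) × L²(Ω; ℝ^d)` where `∇u` is
the weak gradient of `u`. The inherited norm is
`‖u‖_{H^1} = (‖u‖_{L²}² + ‖∇u‖_{L²}²)^{1/2}`. -/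
def H1 (Ω : Set (E d)) : Submodule ℝ
    (WithLp 2 (Lp ℝ 2 (volume.restrict Ω) × Lp (E d) 2 (volume.restrict Ω))) where
  carrier := {p | HasWeakFDeriv Ω p.fst (fun x => innerSL ℝ (p.snd x))}
  zero_mem' := by
    intro φ _ _ _ v
    have h1 := Lp.coeFn_zero ℝ 2 (volume.restrict Ω)
    have h2 := Lp.coeFn_zero (E d) 2 (volume.restrict Ω)
    rw [integral_eq_zero_of_ae, integral_eq_zero_of_ae, neg_zero]
    · filter_upwards [h2] with x hx
      rw [WithLp.zero_snd, hx, Pi.zero_apply, map_zero, zero_apply, smul_zero, Pi.zero_apply]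
    · filter_upwards [h1] with x hx
      rw [WithLp.zero_fst, hx, Pi.zero_apply, smul_zero]
  add_mem' := by
    intro p q hp hq φ h hc hs v
    have i1 : ∀ p : WithLp 2 (Lp ℝ 2 (volume.restrict Ω) × Lp (E d) 2 (volume.restrict Ω)),
        Integrable (fun x => fderiv ℝ φ x v • p.fst x) (volume.restrict Ω) := fun p =>
      (memLp_test_fderiv h hc v).integrable_mul (Lp.memLp p.fst)
    have i2 : ∀ p : WithLp 2 (Lp ℝ 2 (volume.restrict Ω) × Lp (E d) 2 (volume.restrict Ω)),
        Integrable (fun x => φ x • innerSL ℝ (p.snd x) v) (volume.restrict Ω) := fun p =>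
      (memLp_test h.continuous hc).integrable_mul ((Lp.memLp p.snd).inner_const v)
    have e1 : ∫ x in Ω, fderiv ℝ φ x v • (p + q).fst x
        = ∫ x in Ω, (fderiv ℝ φ x v • p.fst x + fderiv ℝ φ x v • q.fst x) := by
      refine integral_congr_ae ?_
      filter_upwards [Lp.coeFn_add p.fst q.fst] with x hx
      rw [WithLp.add_fst, hx, Pi.add_apply, smul_add]
    have e2 : ∫ x in Ω, φ x • innerSL ℝ ((p + q).snd x) v
        = ∫ x in Ω, (φ x • innerSL ℝ (p.snd x) v + φ x • innerSL ℝ (q.snd x) v) := by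
      refine integral_congr_ae ?_
      filter_upwards [Lp.coeFn_add p.snd q.snd] with x hx
      rw [WithLp.add_snd, hx, Pi.add_apply, map_add, add_apply, smul_add]
    rw [e1, e2, integral_add (i1 p) (i1 q), integral_add (i2 p) (i2 q), hp φ h hc hs v,
      hq φ h hc hs v, neg_add]
  smul_mem' := by
    intro c p hp φ h hc hs v
    have e1 : ∫ x in Ω, fderiv ℝ φ x v • (c • p).fst x
        = ∫ x in Ω, c • (fderiv ℝ φ x v • p.fst x) := by
      refine integral_congr_ae ?_
      filter_upwards [Lp.coeFn_smul c p.fst] with x hx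
      rw [WithLp.smul_fst, hx, Pi.smul_apply, smul_comm]
    have e2 : ∫ x in Ω, φ x • innerSL ℝ ((c • p).snd x) v
        = ∫ x in Ω, c • (φ x • innerSL ℝ (p.snd x) v) := by
      refine integral_congr_ae ?_
      filter_upwards [Lp.coeFn_smul c p.snd] with x hx
      rw [WithLp.smul_snd, hx, Pi.smul_apply, map_smul, smul_apply, smul_comm]
    rw [e1, e2, integral_smul, integral_smul, hp φ h hc hs v, smul_neg]

/-- The underlying `L²` function of an element of `H^1(Ω)`. -/
def fn {Ω : Set (E d)} (u : H1 Ω) : Lp ℝ 2 (volume.restrict Ω) :=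
  (u : WithLp 2 (Lp ℝ 2 (volume.restrict Ω) × Lp (E d) 2 (volume.restrict Ω))).fst

/-- The weak gradient of an element of `H^1(Ω)`. -/
def grad {Ω : Set (E d)} (u : H1 Ω) : Lp (E d) 2 (volume.restrict Ω) :=
  (u : WithLp 2 (Lp ℝ 2 (volume.restrict Ω) × Lp (E d) 2 (volume.restrict Ω))).snd

/-- The surface measure `ds` on `∂Ω`: the `(d-1)`-dimensional Hausdorff measure, in the Euclidean
normalization. -/
def surface (Ω : Set (E d)) : Measure (E d) := (μHE[d - 1]).restrict (frontier Ω)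

/-- The pairs `(φ|_Ω, φ|_{∂Ω})` for smooth `φ` on `ℝ^d`. -/
def smoothTraceGraph (Ω : Set (E d)) : Submodule ℝ (H1 Ω × Lp ℝ 2 (surface Ω)) where
  carrier := {p | ∃ φ : E d → ℝ, ContDiff ℝ ∞ φ ∧ fn p.1 =ᵐ[volume.restrict Ω] φ ∧
    p.2 =ᵐ[surface Ω] φ}
  zero_mem' := ⟨0, contDiff_const, Lp.coeFn_zero .., Lp.coeFn_zero ..⟩
  add_mem' := by
    rintro p q ⟨φ, h, h1, h2⟩ ⟨φ', h', h1', h2'⟩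
    exact ⟨φ + φ', h.add h', (Lp.coeFn_add (fn p.1) (fn q.1)).trans (h1.add h1'),
      (Lp.coeFn_add p.2 q.2).trans (h2.add h2')⟩
  smul_mem' := by
    rintro c p ⟨φ, h, h1, h2⟩
    exact ⟨c • φ, h.const_smul c, (Lp.coeFn_smul c (fn p.1)).trans (h1.const_smul c),
      (Lp.coeFn_smul c p.2).trans (h2.const_smul c)⟩

/-- The graph of the trace operator `H^1(Ω) → L²(∂Ω)`, which is the extension by continuity of the
restriction `φ ↦ φ|_{∂Ω}` of smooth functions: the closure of the graph of the latter. -/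
def traceGraph (Ω : Set (E d)) : Submodule ℝ (H1 Ω × Lp ℝ 2 (surface Ω)) :=
  (smoothTraceGraph Ω).topologicalClosure

/-- The space `H^{1/2}(∂Ω)` of the traces of the functions in `H^1(Ω)`. -/
def Hhalf (Ω : Set (E d)) : Submodule ℝ (Lp ℝ 2 (surface Ω)) :=
  (traceGraph Ω).map (LinearMap.snd ℝ (H1 Ω) (Lp ℝ 2 (surface Ω)))

/-- `γ` is the trace `u|_{∂Ω}` of `u`. -/
def IsTrace {Ω : Set (E d)} (u : H1 Ω) (γ : Hhalf Ω) : Prop :=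
  (u, (γ : Lp ℝ 2 (surface Ω))) ∈ traceGraph Ω

/-- The boundary integral `∫_{∂Ω} γ ds`. -/
def boundaryIntegral {Ω : Set (E d)} (γ : Hhalf Ω) : ℝ :=
  ∫ x, (γ : Lp ℝ 2 (surface Ω)) x ∂(surface Ω)

/-- `g ∈ H_0^{-1/2}(∂Ω)`: `g` is a linear functional on `H^{1/2}(∂Ω)` that is bounded for the norm
`‖γ‖_{H^{1/2}} = inf {‖w‖_{H^1} | w|_{∂Ω} = γ}` and vanishes on the constants. -/
structure IsNeumannDatum {Ω : Set (E d)} (g : Hhalf Ω →ₗ[ℝ] ℝ) : Prop where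
  bounded : ∃ C : ℝ, ∀ (w : H1 Ω) (γ : Hhalf Ω), IsTrace w γ → |g γ| ≤ C * ‖w‖
  zero_mean : ∀ γ : Hhalf Ω, (γ : Lp ℝ 2 (surface Ω)) =ᵐ[surface Ω] (fun _ => (1 : ℝ)) → g γ = 0

/-- `u ∈ H^1(Ω)` is a weak solution of `-∇·(s∇u) = 0` in `Ω`, `s ∂u/∂ν = g` on `∂Ω`, with the
normalization `∫_{∂Ω} u ds = ∫_{∂Ω} f ds`. -/
structure IsNeumannSolution {Ω : Set (E d)} (s : E d → ℝ) (g : Hhalf Ω →ₗ[ℝ] ℝ) (f : Hhalf Ω)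
    (u : H1 Ω) : Prop where
  weak_eq : ∀ (w : H1 Ω) (γ : Hhalf Ω), IsTrace w γ →
    ∫ x in Ω, s x * ⟪grad u x, grad w x⟫ = g γ
  normalization : ∃ γ : Hhalf Ω, IsTrace u γ ∧ boundaryIntegral γ = boundaryIntegral f

/-- `U ∈ W^{1,∞}(ℝ^d; ℝ^d)` with weak Jacobian `DU`; `U` is the continuous representative of its
class. -/
structure IsW1Infty (U : E d → E d) (DU : E d → E d →L[ℝ] E d) : Prop where
  continuous : Continuous U
  memLp : MemLp U ∞ volume
  memLp_deriv : MemLp DU ∞ volume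
  weak_deriv : HasWeakFDeriv univ U DU

/-- The transformation `Φ_t(x) = x + t U(x)`. -/
def Phi (U : E d → E d) (t : ℝ) (x : E d) : E d := x + t • U x

/-- The transported conductivity `σ_t = σ ∘ Φ_t⁻¹` (`Φ_t` is bijective for small `|t|`). -/
def transported (U : E d → E d) (σ : E d → ℝ) (t : ℝ) : E d → ℝ :=
  σ ∘ Function.invFun (Phi U t)

/-- The matrix field `𝒜 = div(U) I - (DU + DUᵀ)`. -/
def calA (DU : E d → E d →L[ℝ] E d) (x : E d) : E d →L[ℝ] E d :=
  LinearMap.trace ℝ (E d) (DU x : E d →ₗ[ℝ] E d) • ContinuousLinearMap.id ℝ (E d)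
    - (DU x + ContinuousLinearMap.adjoint (DU x))

/-- `udot` is the material derivative at `t = 0` of the family `ut`, with `u` its value at `t = 0`:
for small `t ≠ 0` the function `ut t ∘ Φ_t` lies in `H^1(Ω)`, and `(ut t ∘ Φ_t - u) / t` converges
to `udot` strongly in `H^1(Ω)` as `t → 0`. -/
def HasMaterialDerivative {Ω : Set (E d)} (U : E d → E d) (u : H1 Ω) (ut : ℝ → H1 Ω)
    (udot : H1 Ω) : Prop :=
  ∃ v : ℝ → H1 Ω,
    (∀ᶠ t in 𝓝[≠] (0 : ℝ), fn (v t) =ᵐ[volume.restrict Ω] fn (ut t) ∘ Phi U t) ∧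
    Tendsto (fun t => t⁻¹ • (v t - u)) (𝓝[≠] 0) (𝓝 udot)

end EIT

end

open EIT

/-! Pulled back to the reference configuration by `Φ_t`, the problem for `u_t` becomes a Neumann
problem on the fixed domain `Ω` with the coefficient `σ |det (1 + t DU)| (1 + t DU)⁻¹ (1 + t DU)⁻ᵀ`
and the same data, because `Φ_t` fixes a neighbourhood of `∂Ω`. As a curve in `L^∞` this coefficient
is differentiable at `t = 0` with derivative `σ 𝒜`. By the Poincaré inequality the normalized weak
problem is governed by a coercive operator on `H^1(Ω)`, and inversion of operators is
differentiable, so the pulled back solution `u_t ∘ Φ_t` is differentiable in `H^1(Ω)` as well. -/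

open MeasureTheory Filter Topology Set
open scoped ENNReal NNReal ContDiff RealInnerProductSpace Convolution

noncomputable section

namespace EIT

variable {d : ℕ}

section Mollification

variable {G F : Type*} [NormedAddCommGroup G] [NormedSpace ℝ G] [FiniteDimensional ℝ G]
  [MeasurableSpace G] [BorelSpace G] {μ : Measure G} [NormedAddCommGroup F]

theorem normed_convolution_eq_integral [NormedSpace ℝ F] {c : G} (b : ContDiffBump c) (f : G → F)
    (y : G) : (b.normed μ ⋆[.lsmul ℝ ℝ, μ] f) y =
      ∫ t, f (y - t) ∂μ.withDensity fun t => .ofReal (b.normed μ t) := by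
  rw [integral_withDensity_eq_integral_toReal_smul
    b.continuous_normed.measurable.ennreal_ofReal (ae_of_all _ fun _ => ENNReal.ofReal_lt_top)]
  simp only [convolution_def, ContinuousLinearMap.lsmul_apply,
    ENNReal.toReal_ofReal (b.nonneg_normed _)]

variable [μ.IsAddHaarMeasure]

theorem tendsto_eLpNorm_translate_sub {p : ℝ≥0∞} [Fact (1 ≤ p)] (hp : p ≠ ⊤) {f : G → F}
    (hf : MemLp f p μ) : Tendsto (fun t => eLpNorm (fun y => f (y - t) - f y) p μ) (𝓝 0) (𝓝 0) := by
  let τ : G → C(G, G) := fun t => ⟨fun y => y - t, by fun_prop⟩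
  have hτ : ∀ t, MeasurePreserving (τ t) μ μ := fun t => measurePreserving_sub_right μ t
  have hτc : Continuous τ :=
    ContinuousMap.continuous_of_continuous_uncurry _ (continuous_snd.sub continuous_fst)
  have hcont : Continuous fun t => Lp.compMeasurePreserving (τ t) (hτ t) (hf.toLp f) :=
    continuous_const.compMeasurePreservingLp hτc hτ hp
  have hτf : ∀ t, Lp.compMeasurePreserving (τ t) (hτ t) (hf.toLp f)
      =ᵐ[μ] fun y => f (y - t) := fun t =>
    (Lp.coeFn_compMeasurePreserving _ (hτ t)).trans
      ((hτ t).quasiMeasurePreserving.ae_eq_comp hf.coeFn_toLp)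
  have h0 : Lp.compMeasurePreserving (τ 0) (hτ 0) (hf.toLp f) = hf.toLp f :=
    Lp.ext (by simpa using (hτf 0).trans (by simpa using hf.coeFn_toLp.symm))
  refine (h0 ▸ tendsto_iff_edist_tendsto_0.1 (hcont.tendsto 0)).congr fun t => ?_
  rw [Lp.edist_def]
  exact eLpNorm_congr_ae ((hτf t).sub hf.coeFn_toLp)

variable [NormedSpace ℝ F] {c : G} (b : ContDiffBump c)

theorem contDiff_normed_convolution {f : G → F} (hf : LocallyIntegrable f μ) :
    ContDiff ℝ ∞ (b.normed μ ⋆[.lsmul ℝ ℝ, μ] f) :=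
  b.hasCompactSupport_normed.contDiff_convolution_left (n := ⊤) _ b.contDiff_normed hf

theorem isProbabilityMeasure_withDensity_normed :
    IsProbabilityMeasure (μ.withDensity fun t => .ofReal (b.normed μ t)) := by
  refine ⟨?_⟩
  rw [withDensity_apply _ .univ, Measure.restrict_univ,
    ← ofReal_integral_eq_lintegral_ofReal b.integrable_normed (ae_of_all _ b.nonneg_normed),
    b.integral_normed, ENNReal.ofReal_one]

theorem integrable_comp_sub_withDensity_normed {f : G → F} (hf : LocallyIntegrable f μ) (y : G) :
    Integrable (fun t => f (y - t)) (μ.withDensity fun t => .ofReal (b.normed μ t)) := by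
  rw [integrable_withDensity_iff_integrable_smul'
    b.continuous_normed.measurable.ennreal_ofReal (ae_of_all _ fun _ => ENNReal.ofReal_lt_top)]
  simp only [ENNReal.toReal_ofReal (b.nonneg_normed _)]
  exact b.hasCompactSupport_normed.convolutionExists_left (.lsmul ℝ ℝ) b.continuous_normed hf y

theorem enorm_normed_convolution_sub_rpow_le [CompleteSpace F] {p : ℝ≥0∞} (hp1 : 1 ≤ p)
    (hp : p ≠ ⊤) {f : G → F} (hf : LocallyIntegrable f μ) (y : G) :
    ‖(b.normed μ ⋆[.lsmul ℝ ℝ, μ] f) y - f y‖ₑ ^ p.toReal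
      ≤ ∫⁻ t, ‖f (y - t) - f y‖ₑ ^ p.toReal ∂μ.withDensity fun t => .ofReal (b.normed μ t) := by
  set ν := μ.withDensity fun t => .ofReal (b.normed μ t)
  have : IsProbabilityMeasure ν := isProbabilityMeasure_withDensity_normed b
  have hp0 : p ≠ 0 := (zero_lt_one.trans_le hp1).ne'
  have hi : Integrable (fun t => f (y - t)) ν := integrable_comp_sub_withDensity_normed b hf y
  have hsub : (b.normed μ ⋆[.lsmul ℝ ℝ, μ] f) y - f y = ∫ t, (f (y - t) - f y) ∂ν := by
    rw [integral_sub hi (integrable_const _), normed_convolution_eq_integral, integral_const,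
      probReal_univ, one_smul]
  have hJ : ‖∫ t, (f (y - t) - f y) ∂ν‖ₑ ≤ eLpNorm (fun t => f (y - t) - f y) p ν := by
    refine (enorm_integral_le_lintegral_enorm _).trans ?_
    rw [← eLpNorm_one_eq_lintegral_enorm]
    exact eLpNorm_le_eLpNorm_of_exponent_le hp1
      (hi.sub (integrable_const _)).aestronglyMeasurable
  rw [hsub, ← ENNReal.le_rpow_inv_iff (ENNReal.toReal_pos hp0 hp)]
  refine hJ.trans_eq ?_
  rw [eLpNorm_eq_lintegral_rpow_enorm_toReal hp0 hp, one_div]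

theorem eLpNorm_normed_convolution_sub_le [CompleteSpace F] {p : ℝ≥0∞} (hp1 : 1 ≤ p) (hp : p ≠ ⊤)
    {f : G → F} (hf : LocallyIntegrable f μ) {ε : ℝ≥0∞}
    (h : ∀ t ∈ Metric.ball c b.rOut, eLpNorm (fun y => f (y - t) - f y) p μ ≤ ε) :
    eLpNorm (b.normed μ ⋆[.lsmul ℝ ℝ, μ] f - f) p μ ≤ ε := by
  set ν := μ.withDensity fun t => .ofReal (b.normed μ t)
  have : IsProbabilityMeasure ν := isProbabilityMeasure_withDensity_normed b
  have hp0 : p ≠ 0 := (zero_lt_one.trans_le hp1).ne'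
  have hpos : 0 < p.toReal := ENNReal.toReal_pos hp0 hp
  have hjoint : AEStronglyMeasurable (fun q : G × G => f (q.1 - q.2) - f q.1) (μ.prod ν) := by
    have hfm := hf.aestronglyMeasurable
    exact ((hfm.comp_quasiMeasurePreserving (quasiMeasurePreserving_sub_of_right_invariant _ _)).sub
      hfm.comp_fst).mono_ac (Measure.AbsolutelyContinuous.rfl.prod
        (withDensity_absolutelyContinuous _ _))
  have hν : ∀ᵐ t ∂ν, eLpNorm (fun y => f (y - t) - f y) p μ ≤ ε := by
    rw [ae_withDensity_iff b.continuous_normed.measurable.ennreal_ofReal]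
    refine ae_of_all _ fun t ht => h t ?_
    rw [← b.support_normed_eq (μ := μ)]
    exact fun h0 => ht (by rw [h0, ENNReal.ofReal_zero])
  rw [eLpNorm_eq_lintegral_rpow_enorm_toReal hp0 hp, one_div, ENNReal.rpow_inv_le_iff hpos]
  calc ∫⁻ y, ‖(b.normed μ ⋆[.lsmul ℝ ℝ, μ] f) y - f y‖ₑ ^ p.toReal ∂μ
      ≤ ∫⁻ y, ∫⁻ t, ‖f (y - t) - f y‖ₑ ^ p.toReal ∂ν ∂μ :=
        lintegral_mono fun y => enorm_normed_convolution_sub_rpow_le b hp1 hp hf y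
    _ = ∫⁻ t, ∫⁻ y, ‖f (y - t) - f y‖ₑ ^ p.toReal ∂μ ∂ν :=
        lintegral_lintegral_swap (hjoint.enorm.pow_const _)
    _ ≤ ∫⁻ _, ε ^ p.toReal ∂ν := by
        refine lintegral_mono_ae ?_
        filter_upwards [hν] with t ht
        rwa [← ENNReal.rpow_inv_le_iff hpos, ← one_div,
          ← eLpNorm_eq_lintegral_rpow_enorm_toReal (f := fun y => f (y - t) - f y) hp0 hp]
    _ = ε ^ p.toReal := by rw [lintegral_const, measure_univ, mul_one]

end Mollification

section WeakDerivative

variable {F : Type*} [NormedAddCommGroup F] [NormedSpace ℝ F]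

theorem setIntegral_smul_of_tsupport_subset {α : Type*} [TopologicalSpace α] [MeasurableSpace α]
    {μ : Measure α} {s : Set α} {φ : α → ℝ} (hs : tsupport φ ⊆ s) (f : α → F) :
    ∫ x in s, φ x • f x ∂μ = ∫ x, φ x • f x ∂μ :=
  setIntegral_eq_integral_of_forall_compl_eq_zero fun x hx => by
    rw [image_eq_zero_of_notMem_tsupport fun h => hx (hs h), zero_smul]

theorem hasWeakFDeriv_iff {Ω : Set (E d)} {f : E d → F} {f' : E d → E d →L[ℝ] F} :
    HasWeakFDeriv Ω f f' ↔
      ∀ φ : E d → ℝ, ContDiff ℝ ∞ φ → HasCompactSupport φ → tsupport φ ⊆ Ω → ∀ v : E d,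
        ∫ x, fderiv ℝ φ x v • f x = - ∫ x, φ x • f' x v := by
  refine forall₄_congr fun φ _ _ hs => forall_congr' fun v => ?_
  rw [setIntegral_smul_of_tsupport_subset ((tsupport_fderiv_apply_subset ℝ v).trans hs),
    setIntegral_smul_of_tsupport_subset hs]

theorem HasWeakFDeriv.congr {Ω : Set (E d)} {f g : E d → F} {f' g' : E d → E d →L[ℝ] F}
    (h : HasWeakFDeriv Ω f f') (hf : f =ᵐ[volume.restrict Ω] g)
    (hf' : f' =ᵐ[volume.restrict Ω] g') : HasWeakFDeriv Ω g g' := fun φ hφ hc hs v => by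
  rw [← integral_congr_ae ((ae_eq_refl fun x => fderiv ℝ φ x v).smul hf), h φ hφ hc hs v]
  exact congrArg Neg.neg (integral_congr_ae (hf'.mono fun x hx => by simp only [hx]))

theorem locallyIntegrableOn_clm_apply {Ω : Set (E d)} {f' : E d → E d →L[ℝ] F}
    (h : LocallyIntegrableOn f' Ω) (v : E d) : LocallyIntegrableOn (fun x => f' x v) Ω :=
  fun x hx =>
    let ⟨s, hs, hi⟩ := h x hx
    ⟨s, hs, hi.apply_continuousLinearMap v⟩

theorem integrable_smul_of_tsupport_subset {Ω : Set (E d)} {f : E d → F}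
    (hf : LocallyIntegrableOn f Ω) {φ : E d → ℝ} (hφ : Continuous φ) (hc : HasCompactSupport φ)
    (hs : tsupport φ ⊆ Ω) : Integrable fun x => φ x • f x :=
  (integrableOn_iff_integrable_of_support_subset
      ((Function.support_smul_subset_left _ _).trans (subset_tsupport φ))).1
    ((hf.integrableOn_compact_subset hs hc).continuousOn_smul hφ.continuousOn hc)

theorem HasWeakFDeriv.ae_eq [CompleteSpace F] {Ω : Set (E d)} (hΩ : IsOpen Ω) {f : E d → F}
    {g h : E d → E d →L[ℝ] F} (hg : HasWeakFDeriv Ω f g) (hh : HasWeakFDeriv Ω f h)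
    (hgi : LocallyIntegrableOn g Ω) (hhi : LocallyIntegrableOn h Ω) :
    g =ᵐ[volume.restrict Ω] h := by
  have key : ∀ v : E d, ∀ᵐ x, x ∈ Ω → g x v - h x v = 0 := fun v => by
    have hgv := locallyIntegrableOn_clm_apply hgi v
    have hhv := locallyIntegrableOn_clm_apply hhi v
    refine hΩ.ae_eq_zero_of_integral_contDiff_smul_eq_zero (hgv.sub hhv) fun φ hφ hc hs => ?_
    simp only [smul_sub]
    rw [integral_sub (integrable_smul_of_tsupport_subset hgv hφ.continuous hc hs)
      (integrable_smul_of_tsupport_subset hhv hφ.continuous hc hs), sub_eq_zero, ← neg_inj,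
      ← hasWeakFDeriv_iff.1 hg φ hφ hc hs v, hasWeakFDeriv_iff.1 hh φ hφ hc hs v]
  let e := (EuclideanSpace.basisFun (Fin d) ℝ).toBasis
  filter_upwards [ae_restrict_of_ae (ae_all_iff.2 fun i => key (e i)),
    ae_restrict_mem hΩ.measurableSet] with x hx hxΩ
  exact ContinuousLinearMap.coe_injective (e.ext fun i => sub_eq_zero.1 (hx i hxΩ))

theorem hasWeakFDeriv_of_contDiff {f : E d → F} (hf : ContDiff ℝ 1 f) (Ω : Set (E d)) :
    HasWeakFDeriv Ω f (fderiv ℝ f) := by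
  refine hasWeakFDeriv_iff.2 fun φ hφ hc _ v => ?_
  have hφ' : Continuous fun x => fderiv ℝ φ x v :=
    (hφ.continuous_fderiv (by simp)).clm_apply continuous_const
  have hf' : Continuous fun x => fderiv ℝ f x v :=
    (hf.continuous_fderiv one_ne_zero).clm_apply continuous_const
  rw [integral_smul_fderiv_eq_neg_fderiv_smul_of_integrable
    ((hφ'.smul hf.continuous).integrable_of_hasCompactSupport (hc.fderiv_apply ℝ v).smul_right)
    ((hφ.continuous.smul hf').integrable_of_hasCompactSupport hc.smul_right)
    ((hφ.continuous.smul hf.continuous).integrable_of_hasCompactSupport hc.smul_right)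
    (fun x _ => hφ.differentiable (by simp) x) (fun x _ => hf.differentiable one_ne_zero x),
    neg_neg]

theorem HasWeakFDeriv.smul {Ω : Set (E d)} {f : E d → F} {f' : E d → E d →L[ℝ] F}
    (h : HasWeakFDeriv Ω f f') (hf : LocallyIntegrableOn f Ω) (hf' : LocallyIntegrableOn f' Ω)
    {χ : E d → ℝ} (hχ : ContDiff ℝ ∞ χ) :
    HasWeakFDeriv Ω (fun x => χ x • f x)
      fun x => χ x • f' x + (fderiv ℝ χ x).smulRight (f x) := by
  refine hasWeakFDeriv_iff.2 fun φ hφ hc hs v => ?_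
  have hs' : tsupport (fun x => fderiv ℝ φ x v) ⊆ Ω := (tsupport_fderiv_apply_subset ℝ v).trans hs
  have hprod : ∀ x, fderiv ℝ (fun x => φ x * χ x) x v
      = φ x * fderiv ℝ χ x v + fderiv ℝ φ x v * χ x := fun x => by
    rw [fderiv_fun_mul (hφ.differentiable (by simp) x) (hχ.differentiable (by simp) x)]
    simp only [add_apply, smul_apply, smul_eq_mul, mul_comm (χ x)]
  have i1 : Integrable fun x => (φ x * fderiv ℝ χ x v) • f x :=
    integrable_smul_of_tsupport_subset hf
      (hφ.continuous.mul ((hχ.continuous_fderiv (by simp)).clm_apply continuous_const))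
      hc.mul_right (tsupport_mul_subset_left.trans hs)
  have i2 : Integrable fun x => (fderiv ℝ φ x v * χ x) • f x :=
    integrable_smul_of_tsupport_subset hf
      (((hφ.continuous_fderiv (by simp)).clm_apply continuous_const).mul hχ.continuous)
      (hc.fderiv_apply ℝ v).mul_right (tsupport_mul_subset_left.trans hs')
  have i3 : Integrable fun x => (φ x * χ x) • f' x v :=
    integrable_smul_of_tsupport_subset (locallyIntegrableOn_clm_apply hf' v)
      (hφ.continuous.mul hχ.continuous) hc.mul_right (tsupport_mul_subset_left.trans hs)
  have key := hasWeakFDeriv_iff.1 h (fun x => φ x * χ x) (hφ.mul hχ) hc.mul_right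
    (tsupport_mul_subset_left.trans hs) v
  simp only [hprod, add_smul] at key
  rw [integral_add i1 i2] at key
  simp only [add_apply, smul_apply, ContinuousLinearMap.smulRight_apply, smul_add, smul_smul]
  rw [integral_add i3 i1, ← sub_eq_iff_eq_add'.2 key.symm]
  abel

theorem hasFDerivAt_convolution_of_hasWeakFDeriv {Ω : Set (E d)} {k : E d → ℝ}
    (hk : ContDiff ℝ ∞ k) (hc : HasCompactSupport k) {f : E d → F} {f' : E d → E d →L[ℝ] F}
    (hf : LocallyIntegrable f) (hf' : LocallyIntegrable f') (hw : HasWeakFDeriv Ω f f') {y : E d}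
    (hy : ∀ t ∈ tsupport k, y - t ∈ Ω) :
    HasFDerivAt (k ⋆[.lsmul ℝ ℝ, volume] f) ((k ⋆[.lsmul ℝ ℝ, volume] f') y) y := by
  suffices h : (k ⋆[.lsmul ℝ ℝ, volume] f') y
      = (fderiv ℝ k ⋆[(ContinuousLinearMap.lsmul ℝ ℝ).precompL (E d), volume] f) y from
    h ▸ hc.hasFDerivAt_convolution_left _ (hk.of_le (by simp)) hf y
  refine ContinuousLinearMap.ext fun v => ?_
  have hφs : tsupport (fun z => k (y - z)) ⊆ Ω := fun z hz => by
    have hsub := tsupport_comp_subset_preimage k (f := fun z : E d => y - z) (by fun_prop)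
    simpa using hy _ (hsub hz)
  have hD : ∀ z, fderiv ℝ (fun z => k (y - z)) z v = - fderiv ℝ k (y - z) v := fun z => by
    have h := ((hk.differentiable (by simp) (y - z)).hasFDerivAt.comp z
      ((hasFDerivAt_id z).const_sub y)).fderiv
    rw [Function.comp_def] at h
    simpa using congrArg (· v) h
  have hw' := hasWeakFDeriv_iff.1 hw (fun z => k (y - z)) (hk.comp (by fun_prop))
    (hc.comp_homeomorph (Homeomorph.subLeft y)) hφs v
  have hint := hc.convolutionExists_left (.lsmul ℝ ℝ) hk.continuous hf' y
  have hint' := (hc.fderiv ℝ).convolutionExists_left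
    ((ContinuousLinearMap.lsmul ℝ ℝ).precompL (E d)) (hk.continuous_fderiv (by simp)) hf y
  rw [convolution_eq_swap, convolution_eq_swap,
    ContinuousLinearMap.integral_apply hint.integrable_swap,
    ContinuousLinearMap.integral_apply hint'.integrable_swap]
  simp only [hD, neg_smul, integral_neg, neg_inj] at hw'
  exact hw'.symm

theorem hasWeakFDeriv_of_lipschitzWith_real {C : ℝ≥0} {f : E d → ℝ} (hf : LipschitzWith C f)
    (Ω : Set (E d)) : HasWeakFDeriv Ω f (fderiv ℝ f) := by
  refine hasWeakFDeriv_iff.2 fun φ hφ hc _ v => ?_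
  obtain ⟨D, hD⟩ := (hφ.of_le (by simp)).lipschitzWith_of_hasCompactSupport hc
    (𝕂 := ℝ) (n := 1) one_ne_zero
  have hφ' : ∀ x, lineDeriv ℝ φ x (-v) = - fderiv ℝ φ x v := fun x => by
    rw [(hφ.differentiable (by simp) x).lineDeriv_eq_fderiv, map_neg]
  calc ∫ x, fderiv ℝ φ x v • f x = - ∫ x, lineDeriv ℝ φ x (-v) * f x := by
        simp only [hφ', neg_mul, integral_neg, neg_neg, smul_eq_mul]
    _ = - ∫ x, lineDeriv ℝ f x v * φ x := by rw [hf.integral_lineDeriv_mul_eq hD hc v]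
    _ = - ∫ x, φ x • fderiv ℝ f x v := by
        congr 1
        refine integral_congr_ae ?_
        filter_upwards [hf.ae_differentiableAt (μ := volume)] with x hx
        rw [hx.lineDeriv_eq_fderiv, mul_comm, smul_eq_mul]

variable [FiniteDimensional ℝ F]

theorem locallyIntegrable_fderiv_of_lipschitzWith {C : ℝ≥0} {f : E d → F} (hf : LipschitzWith C f) :
    LocallyIntegrable (fderiv ℝ f) := by
  have := FiniteDimensional.complete ℝ F
  borelize F
  have hb : MemLp (fderiv ℝ f) ⊤ volume :=
    memLp_top_of_bound (measurable_fderiv ℝ f).aestronglyMeasurable C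
      (ae_of_all _ fun x => norm_fderiv_le_of_lipschitz ℝ hf)
  exact hb.locallyIntegrable le_top

theorem hasWeakFDeriv_of_lipschitzWith {C : ℝ≥0} {f : E d → F} (hf : LipschitzWith C f)
    (Ω : Set (E d)) : HasWeakFDeriv Ω f (fderiv ℝ f) := by
  have := FiniteDimensional.complete ℝ F
  refine hasWeakFDeriv_iff.2 fun φ hφ hc hs v =>
    (SeparatingDual.eq_iff_forall_dual_eq (R := ℝ)).2 fun a => ?_
  have h := hasWeakFDeriv_iff.1 (hasWeakFDeriv_of_lipschitzWith_real (a.lipschitz.comp hf) Ω)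
    φ hφ hc hs v
  have i1 : Integrable fun x => fderiv ℝ φ x v • f x :=
    hf.continuous.locallyIntegrable.integrable_smul_left_of_hasCompactSupport
      ((hφ.continuous_fderiv (by simp)).clm_apply continuous_const) (hc.fderiv_apply ℝ v)
  have i2 : Integrable fun x => φ x • fderiv ℝ f x v :=
    integrable_smul_of_tsupport_subset (locallyIntegrableOn_clm_apply
      ((locallyIntegrable_fderiv_of_lipschitzWith hf).locallyIntegrableOn Ω) v) hφ.continuous hc hs
  rw [map_neg, ← a.integral_comp_comm i1, ← a.integral_comp_comm i2]
  simp only [map_smul]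
  refine h.trans (congrArg Neg.neg (integral_congr_ae ?_))
  filter_upwards [hf.ae_differentiableAt (μ := volume)] with x hx
  rw [(a.hasFDerivAt.comp x hx.hasFDerivAt).fderiv, ContinuousLinearMap.comp_apply]

end WeakDerivative

section W1Infty

variable {U : E d → E d} {DU : E d → E d →L[ℝ] E d}

theorem norm_normed_convolution_le {F : Type*} [NormedAddCommGroup F] [NormedSpace ℝ F] {c : E d}
    (b : ContDiffBump c) {f : E d → F} {M : ℝ} (hf : ∀ᵐ x, ‖f x‖ ≤ M) (y : E d) :
    ‖(b.normed volume ⋆[.lsmul ℝ ℝ, volume] f) y‖ ≤ M := by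
  have := isProbabilityMeasure_withDensity_normed (μ := volume) b
  rw [normed_convolution_eq_integral]
  refine (norm_integral_le_of_norm_le_const (C := M) ?_).trans_eq (by simp)
  exact (withDensity_absolutelyContinuous _ _).ae_le
    ((quasiMeasurePreserving_sub_left_of_right_invariant volume y).ae hf)

theorem exists_tendsto_rOut_zero (c : E d) : ∃ b : ℕ → ContDiffBump c,
    Tendsto (fun n => (b n).rOut) atTop (𝓝 0) :=
  ⟨fun n => ⟨1 / ((n : ℝ) + 1) / 2, 1 / ((n : ℝ) + 1), by positivity, half_lt_self (by positivity)⟩,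
    tendsto_one_div_add_atTop_nhds_zero_nat⟩

theorem IsW1Infty.exists_lipschitzWith (hU : IsW1Infty U DU) : ∃ K, LipschitzWith K U := by
  obtain ⟨M, hM⟩ : ∃ M : ℝ≥0, ∀ᵐ x, ‖DU x‖ ≤ M :=
    ⟨⟨_, lpNorm_nonneg⟩, ae_le_lpNorm_exponent_top hU.memLp_deriv⟩
  obtain ⟨b, hb⟩ := exists_tendsto_rOut_zero (0 : E d)
  have hd : ∀ n y, HasFDerivAt ((b n).normed volume ⋆[.lsmul ℝ ℝ, volume] U)
      (((b n).normed volume ⋆[.lsmul ℝ ℝ, volume] DU) y) y := fun n y =>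
    hasFDerivAt_convolution_of_hasWeakFDeriv (b n).contDiff_normed (b n).hasCompactSupport_normed
      hU.continuous.locallyIntegrable (hU.memLp_deriv.locallyIntegrable le_top) hU.weak_deriv
      fun _ _ => mem_univ _
  have hlip : ∀ n, LipschitzWith M ((b n).normed volume ⋆[.lsmul ℝ ℝ, volume] U) := fun n =>
    lipschitzWith_of_nnnorm_fderiv_le (𝕜 := ℝ) (fun y => (hd n y).differentiableAt) fun y => by
      rw [(hd n y).fderiv]
      exact norm_normed_convolution_le (b n) hM y
  have hlim := ContDiffBump.convolution_tendsto_right_of_continuous (μ := volume) hb hU.continuous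
  exact ⟨M, LipschitzWith.of_dist_le_mul fun x y =>
    le_of_tendsto' ((hlim x).dist (hlim y)) fun n => (hlip n).dist_le_mul x y⟩

theorem IsW1Infty.ae_hasFDerivAt (hU : IsW1Infty U DU) : ∀ᵐ x, HasFDerivAt U (DU x) x := by
  obtain ⟨K, hK⟩ := hU.exists_lipschitzWith
  have h := hU.weak_deriv.ae_eq isOpen_univ (hasWeakFDeriv_of_lipschitzWith hK univ)
    (locallyIntegrableOn_univ.2 (hU.memLp_deriv.locallyIntegrable le_top))
    (locallyIntegrableOn_univ.2 (locallyIntegrable_fderiv_of_lipschitzWith hK))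
  rw [Measure.restrict_univ] at h
  filter_upwards [h, hK.ae_differentiableAt (μ := volume)] with x hx hdx
  exact hx ▸ hdx.hasFDerivAt

end W1Infty

section LpOperators

variable {α F F' : Type*} [MeasurableSpace α] {μ : Measure α} [NormedAddCommGroup F]

/-- Multiplication by an `L^∞` field of operators, as an operator on `L²` depending continuously on
the field. -/
def lpMul [NormedSpace ℝ F] [NormedAddCommGroup F'] [NormedSpace ℝ F'] :
    Lp (F →L[ℝ] F') ⊤ μ →L[ℝ] Lp F 2 μ →L[ℝ] Lp F' 2 μ :=
  (ContinuousLinearMap.id ℝ (F →L[ℝ] F')).holderL μ ⊤ 2 2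

theorem coeFn_lpMul [NormedSpace ℝ F] [NormedAddCommGroup F'] [NormedSpace ℝ F']
    (A : Lp (F →L[ℝ] F') ⊤ μ) (f : Lp F 2 μ) : lpMul A f =ᵐ[μ] fun x => A x (f x) :=
  ContinuousLinearMap.coeFn_holder (ContinuousLinearMap.id ℝ (F →L[ℝ] F')) A f

/-- Composition with a map that distorts the measure at most by a constant factor, on `L²`. -/
def lpComp [NormedSpace ℝ F] {T : α → α} (hT : Measurable T) {c : ℝ≥0} (hc : μ.map T ≤ c • μ) :
    Lp F 2 μ →L[ℝ] Lp F 2 μ :=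
  (Lp.compMeasurePreservingₗᵢ ℝ T (hT.measurePreserving μ)).toContinuousLinearMap ∘L
    Lp.LpToLpOfMeasureLeSMul (c := c) ENNReal.coe_ne_top hc

theorem coeFn_lpComp [NormedSpace ℝ F] {T : α → α} (hT : Measurable T) {c : ℝ≥0}
    (hc : μ.map T ≤ c • μ) (f : Lp F 2 μ) : lpComp hT hc f =ᵐ[μ] f ∘ T :=
  (Lp.coeFn_compMeasurePreserving _ (hT.measurePreserving μ)).trans
    (ae_eq_comp hT.aemeasurable (Lp.coeFn_LpToLpOfMeasureLeSMul (c := c) ENNReal.coe_ne_top hc f))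

theorem continuous_integral_inner [InnerProductSpace ℝ F] {ψ : α → F} (hψ : MemLp ψ 2 μ) :
    Continuous fun f : Lp F 2 μ => ∫ x, ⟪ψ x, f x⟫ ∂μ := by
  refine (continuous_const.inner continuous_id :
    Continuous fun f : Lp F 2 μ => ⟪hψ.toLp ψ, f⟫).congr fun f => ?_
  rw [L2.inner_def]
  exact integral_congr_ae (hψ.coeFn_toLp.mono fun x hx => by simp only [hx])

end LpOperators

section Gradient

variable {V : Type*} [NormedAddCommGroup V] [InnerProductSpace ℝ V] [CompleteSpace V]

theorem innerSL_gradient (f : V → ℝ) (x : V) : innerSL ℝ (gradient f x) = fderiv ℝ f x :=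
  (InnerProductSpace.toDual ℝ V).apply_symm_apply (fderiv ℝ f x)

theorem gradient_eq_of_hasFDerivAt {f : V → ℝ} {x v : V} (h : HasFDerivAt f (innerSL ℝ v) x) :
    gradient f x = v :=
  (hasGradientAt_iff_hasFDerivAt.2 h).gradient

theorem continuous_gradient {f : V → ℝ} (hf : ContDiff ℝ 1 f) : Continuous (gradient f) :=
  (InnerProductSpace.toDual ℝ V).symm.continuous.comp (hf.continuous_fderiv one_ne_zero)

end Gradient

theorem memLp_of_continuous {F : Type*} [NormedAddCommGroup F] {Ω : Set (E d)}
    (hb : Bornology.IsBounded Ω) {f : E d → F} (hf : Continuous f) (p : ℝ≥0∞) :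
    MemLp f p (volume.restrict Ω) := by
  have : IsFiniteMeasure (volume.restrict Ω) := ⟨by simpa using hb.measure_lt_top⟩
  obtain ⟨C, hC⟩ := hb.isCompact_closure.exists_bound_of_continuousOn hf.continuousOn
  refine MemLp.of_bound hf.aestronglyMeasurable C
    (ae_restrict_of_ae_restrict_of_subset subset_closure ?_)
  exact (ae_restrict_mem isClosed_closure.measurableSet).mono hC

namespace H1

variable {Ω : Set (E d)}

/-- The embedding `H^1(Ω) → L²(Ω)`. -/
def fnL (Ω : Set (E d)) : H1 Ω →L[ℝ] Lp ℝ 2 (volume.restrict Ω) :=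
  (WithLp.fstL 2 ℝ _ _).comp (H1 Ω).subtypeL

/-- The gradient `H^1(Ω) → L²(Ω; ℝ^d)`. -/
def gradL (Ω : Set (E d)) : H1 Ω →L[ℝ] Lp (E d) 2 (volume.restrict Ω) :=
  (WithLp.sndL 2 ℝ _ _).comp (H1 Ω).subtypeL

theorem norm_sq (u : H1 Ω) : ‖u‖ ^ 2 = ‖fn u‖ ^ 2 + ‖grad u‖ ^ 2 :=
  WithLp.prod_norm_sq_eq_of_L2 (u : WithLp 2 (Lp ℝ 2 (volume.restrict Ω) ×
    Lp (E d) 2 (volume.restrict Ω)))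

theorem hasWeakFDeriv (u : H1 Ω) : HasWeakFDeriv Ω (fn u) (fun x => innerSL ℝ (grad u x)) :=
  u.2

theorem isClosed (Ω : Set (E d)) : IsClosed (H1 Ω : Set (WithLp 2
    (Lp ℝ 2 (volume.restrict Ω) × Lp (E d) 2 (volume.restrict Ω)))) := by
  have h : (H1 Ω : Set (WithLp 2 (Lp ℝ 2 (volume.restrict Ω) × Lp (E d) 2 (volume.restrict Ω)))) =
      {p | ∀ φ : E d → ℝ, ContDiff ℝ ∞ φ → HasCompactSupport φ → tsupport φ ⊆ Ω → ∀ v : E d,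
        ∫ x in Ω, ⟪fderiv ℝ φ x v, p.fst x⟫ = - ∫ x in Ω, ⟪φ x • v, p.snd x⟫} := by
    refine Set.ext fun p => forall₄_congr fun φ _ _ _ => forall_congr' fun v => ?_
    simp only [real_inner_smul_left, real_inner_comm, innerSL_apply_apply, smul_eq_mul,
      RCLike.inner_apply, conj_trivial, mul_comm]
  rw [h]
  simp only [ofPred_forall]
  refine isClosed_iInter fun φ => isClosed_iInter fun hφ => isClosed_iInter fun hc =>
    isClosed_iInter fun _ => isClosed_iInter fun v => ?_
  have hm : MemLp (fun x => φ x • v) 2 (volume.restrict Ω) :=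
    ((hφ.continuous.smul continuous_const).memLp_of_hasCompactSupport hc.smul_right).restrict Ω
  exact isClosed_eq
    ((continuous_integral_inner (memLp_test_fderiv hφ hc v)).comp (WithLp.fstL 2 ℝ _ _).continuous)
    ((continuous_integral_inner hm).comp (WithLp.sndL 2 ℝ _ _).continuous).neg

instance : CompleteSpace (H1 Ω) := (isClosed Ω).completeSpace_coe

/-- The element of `H^1(Ω)` given by a function `f` with weak gradient `G`. -/
def mk {f : E d → ℝ} {G : E d → E d} (hf : MemLp f 2 (volume.restrict Ω))
    (hG : MemLp G 2 (volume.restrict Ω)) (hw : HasWeakFDeriv Ω f fun x => innerSL ℝ (G x)) : H1 Ω :=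
  ⟨WithLp.toLp 2 (hf.toLp f, hG.toLp G),
    hw.congr hf.coeFn_toLp.symm (hG.coeFn_toLp.symm.fun_comp (innerSL ℝ))⟩

section mk

variable {f : E d → ℝ} {G : E d → E d} (hf : MemLp f 2 (volume.restrict Ω))
  (hG : MemLp G 2 (volume.restrict Ω)) (hw : HasWeakFDeriv Ω f fun x => innerSL ℝ (G x))

theorem fn_mk : fn (mk hf hG hw) =ᵐ[volume.restrict Ω] f := hf.coeFn_toLp

theorem grad_mk : grad (mk hf hG hw) =ᵐ[volume.restrict Ω] G := hG.coeFn_toLp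

end mk

theorem locallyIntegrableOn_fn (u : H1 Ω) : LocallyIntegrableOn (fn u) Ω :=
  locallyIntegrableOn_of_locallyIntegrable_restrict
    ((Lp.memLp (fn u)).locallyIntegrable one_le_two)

theorem locallyIntegrableOn_innerSL_grad (u : H1 Ω) :
    LocallyIntegrableOn (fun x => innerSL ℝ (grad u x)) Ω :=
  locallyIntegrableOn_of_locallyIntegrable_restrict
    (((innerSL ℝ).comp_memLp' (Lp.memLp (grad u))).locallyIntegrable one_le_two)

theorem ext_fn (hΩ : IsOpen Ω) {u w : H1 Ω} (h : fn u =ᵐ[volume.restrict Ω] fn w) : u = w := by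
  have hgrad := ((hasWeakFDeriv u).congr h EventuallyEq.rfl).ae_eq hΩ (hasWeakFDeriv w)
    (locallyIntegrableOn_innerSL_grad u) (locallyIntegrableOn_innerSL_grad w)
  refine Subtype.ext (WithLp.ofLp_injective 2 (Prod.ext (Lp.ext h) (Lp.ext ?_)))
  exact hgrad.mono fun x hx => (InnerProductSpace.toDual ℝ (E d)).injective hx

/-- The restriction to `Ω` of a `C^1` function. -/
def ofContDiff (hb : Bornology.IsBounded Ω) {f : E d → ℝ} (hf : ContDiff ℝ 1 f) : H1 Ω :=
  mk (memLp_of_continuous hb hf.continuous 2) (memLp_of_continuous hb (continuous_gradient hf) 2)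
    (by simpa only [innerSL_gradient] using hasWeakFDeriv_of_contDiff hf Ω)

theorem fn_ofContDiff (hb : Bornology.IsBounded Ω) {f : E d → ℝ} (hf : ContDiff ℝ 1 f) :
    fn (ofContDiff hb hf) =ᵐ[volume.restrict Ω] f :=
  fn_mk ..

theorem grad_ofContDiff (hb : Bornology.IsBounded Ω) {f : E d → ℝ} (hf : ContDiff ℝ 1 f) :
    grad (ofContDiff hb hf) =ᵐ[volume.restrict Ω] gradient f :=
  grad_mk ..

theorem memLp_gradient_of_hasCompactSupport {χ : E d → ℝ} (hχ : ContDiff ℝ ∞ χ)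
    (hc : HasCompactSupport χ) (p : ℝ≥0∞) :
    MemLp (gradient χ) p (volume.restrict Ω) :=
  ((continuous_gradient (hχ.of_le (by simp))).memLp_of_hasCompactSupport
    ((hc.fderiv ℝ).comp_left (g := (InnerProductSpace.toDual ℝ (E d)).symm) (map_zero _))).restrict
      Ω

theorem hasWeakFDeriv_smul {χ : E d → ℝ} (hχ : ContDiff ℝ ∞ χ) (u : H1 Ω) :
    HasWeakFDeriv Ω (fun x => χ x • fn u x)
      fun x => innerSL ℝ (χ x • grad u x + fn u x • gradient χ x) := by
  refine ((hasWeakFDeriv u).smul (locallyIntegrableOn_fn u) (locallyIntegrableOn_innerSL_grad u)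
    hχ).congr EventuallyEq.rfl (ae_of_all _ fun x => ?_)
  ext v
  simp [inner_gradient_left, mul_comm]

section smul

variable {χ : E d → ℝ} (hχ : ContDiff ℝ ∞ χ) (hc : HasCompactSupport χ)

/-- The product of a test function and an element of `H^1(Ω)`. -/
def testSMul (u : H1 Ω) : H1 Ω :=
  have hχm : MemLp χ ⊤ (volume.restrict Ω) :=
    (hχ.continuous.memLp_of_hasCompactSupport hc).restrict Ω
  mk ((Lp.memLp (fn u)).smul hχm) (((Lp.memLp (grad u)).smul hχm).add
    ((memLp_gradient_of_hasCompactSupport hχ hc ⊤).smul (Lp.memLp (fn u))))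
    (hasWeakFDeriv_smul hχ u)

theorem fn_testSMul (u : H1 Ω) :
    fn (testSMul hχ hc u) =ᵐ[volume.restrict Ω] fun x => χ x • fn u x :=
  fn_mk _ _ (hasWeakFDeriv_smul hχ u)

theorem grad_testSMul (u : H1 Ω) : grad (testSMul hχ hc u) =ᵐ[volume.restrict Ω]
    fun x => χ x • grad u x + fn u x • gradient χ x :=
  grad_mk _ _ (hasWeakFDeriv_smul hχ u)

end smul

end H1

section Cone

/-- Translating the points of `Ω` near `x` in a fixed direction moves them away from the boundary
at a linear rate. -/
def ConeAt (Ω : Set (E d)) (x : E d) : Prop :=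
  ∃ r > 0, ∃ ρ > 0, ∃ e : E d, ∀ z ∈ Metric.ball x r, z ∈ Ω → ∀ s ∈ Ioc (0 : ℝ) 1,
    Metric.ball (z + s • e) (ρ * s) ⊆ Ω

theorem coneAt_of_mem_interior {Ω : Set (E d)} {x : E d} (hx : x ∈ interior Ω) : ConeAt Ω x := by
  obtain ⟨r, hr, h⟩ := Metric.mem_nhds_iff.1 (mem_interior_iff_mem_nhds.1 hx)
  refine ⟨r / 2, by positivity, r / 2, by positivity, 0, fun z hz _ s hs y hy => h ?_⟩
  rw [smul_zero, add_zero] at hy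
  rw [Metric.mem_ball] at *
  have := dist_triangle y z x
  nlinarith [hs.2]

theorem lt_inner_add_smul_add {V : Type*} [NormedAddCommGroup V] [InnerProductSpace ℝ V] {ν : V}
    (hν : ‖ν‖ = 1) {K : ℝ≥0} {ψ : V → ℝ} (hψ : LipschitzWith K ψ) {z b : V} {a : ℝ}
    (hz : ψ (z - ⟪ν, z⟫ • ν) < ⟪ν, z⟫) (hb : ‖b‖ * (1 + 2 * K) ≤ a) :
    ψ (z + a • ν + b - ⟪ν, z + a • ν + b⟫ • ν) < ⟪ν, z + a • ν + b⟫ := by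
  have hinner : |⟪ν, b⟫| ≤ ‖b‖ := by simpa [hν] using abs_real_inner_le_norm ν b
  have hνν : ⟪ν, ν⟫ = 1 := by rw [real_inner_self_eq_norm_sq, hν, one_pow]
  have hy : ⟪ν, z + a • ν + b⟫ = ⟪ν, z⟫ + a + ⟪ν, b⟫ := by
    rw [inner_add_right, inner_add_right, real_inner_smul_right, hνν, mul_one]
  have hproj : z + a • ν + b - (⟪ν, z⟫ + a + ⟪ν, b⟫) • ν - (z - ⟪ν, z⟫ • ν) = b - ⟪ν, b⟫ • ν := by
    module
  have hbb : ‖b - ⟪ν, b⟫ • ν‖ ≤ 2 * ‖b‖ := by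
    have := norm_sub_le b (⟪ν, b⟫ • ν)
    rw [norm_smul, hν, mul_one, Real.norm_eq_abs] at this
    linarith
  have hlip := hψ.dist_le_mul (z + a • ν + b - (⟪ν, z⟫ + a + ⟪ν, b⟫) • ν) (z - ⟪ν, z⟫ • ν)
  rw [dist_eq_norm (_ - _), hproj, Real.dist_eq] at hlip
  rw [hy]
  nlinarith [(abs_le.1 hlip).2, (abs_le.1 hinner).1,
    mul_le_mul_of_nonneg_left hbb K.coe_nonneg]

theorem HasLipschitzBoundary.coneAt {Ω : Set (E d)} (hΩ : HasLipschitzBoundary Ω) {x : E d}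
    (hx : x ∈ frontier Ω) : ConeAt Ω x := by
  obtain ⟨r, hr, ν, hν, K, ψ, hψ, h⟩ := hΩ x hx
  obtain ⟨ρ, hρ0, hρK⟩ : ∃ ρ : ℝ, 0 < ρ ∧ ρ * (1 + 2 * K) = r / 4 :=
    ⟨r / 4 / (1 + 2 * K), by positivity, by field_simp⟩
  refine ⟨r / 2, by positivity, ρ, hρ0, (r / 4) • ν, fun z hz hzΩ s hs y hy => ?_⟩
  rw [Metric.mem_ball] at hz hy
  obtain ⟨b, rfl⟩ : ∃ b, y = z + (s * (r / 4)) • ν + b := ⟨y - (z + (s * (r / 4)) • ν), by abel⟩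
  rw [smul_smul, dist_eq_norm, add_sub_cancel_left] at hy
  have hzr : z ∈ Metric.ball x r := by rw [Metric.mem_ball]; linarith
  have hyr : z + (s * (r / 4)) • ν + b ∈ Metric.ball x r := by
    have hyz : dist (z + (s * (r / 4)) • ν + b) z ≤ s * (r / 4) + ‖b‖ := by
      rw [dist_eq_norm, add_assoc, add_sub_cancel_left]
      refine (norm_add_le _ _).trans_eq ?_
      rw [norm_smul, hν, mul_one, Real.norm_of_nonneg (by nlinarith [hs.1])]
    have := dist_triangle (z + (s * (r / 4)) • ν + b) z x
    rw [Metric.mem_ball]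
    nlinarith [hs.1, hs.2]
  refine (h _ hyr).2 (lt_inner_add_smul_add hν hψ ((h z hzr).1 hzΩ) ?_)
  calc ‖b‖ * (1 + 2 * K) ≤ ρ * s * (1 + 2 * K) := by gcongr
    _ = s * (r / 4) := by rw [← hρK]; ring

theorem IsBoundedLipschitzDomain.coneAt {Ω : Set (E d)} (hΩ : IsBoundedLipschitzDomain Ω)
    {x : E d} (hx : x ∈ closure Ω) : ConeAt Ω x := by
  rw [closure_eq_interior_union_frontier] at hx
  exact hx.elim coneAt_of_mem_interior hΩ.lipschitz.coneAt

end Cone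

section Density

theorem HasWeakFDeriv.union_compl {F : Type*} [NormedAddCommGroup F] [NormedSpace ℝ F]
    {Ω K : Set (E d)} (hΩ : IsOpen Ω) (hK : IsClosed K) {f : E d → F} {f' : E d → E d →L[ℝ] F}
    (h : HasWeakFDeriv Ω f f') (hf : ∀ y ∉ K, f y = 0) (hf' : ∀ y ∉ K, f' y = 0) :
    HasWeakFDeriv (Ω ∪ Kᶜ) f f' := by
  rw [hasWeakFDeriv_iff] at h ⊢
  intro φ hφ hc hs v
  have hcK : IsCompact (K ∩ tsupport φ) := hc.isCompact.inter_left hK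
  obtain ⟨L, hL, hKL, hLΩ⟩ := exists_compact_between hcK hΩ fun y hy => (hs hy.2).resolve_right
    (not_not.2 hy.1)
  obtain ⟨χ, hχ1, hχ0, -⟩ := exists_contMDiffMap_one_nhds_of_subset_interior (n := (⊤ : ℕ∞))
    (modelWithCornersSelf ℝ (E d)) hcK.isClosed hKL
  have hχ : ContDiff ℝ ∞ χ := χ.contMDiff.contDiff
  have hχL : tsupport χ ⊆ L :=
    closure_minimal (fun y hy => by_contra fun hyL => hy (hχ0 y hyL)) hL.isClosed
  have key := h (fun x => φ x * χ x) (hφ.mul hχ) hc.mul_right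
    ((tsupport_mul_subset_right.trans hχL).trans hLΩ) v
  have heq : ∀ y ∈ K, (fun x => φ x * χ x) =ᶠ[𝓝 y] φ := by
    intro y hy
    by_cases hyφ : y ∈ tsupport φ
    · filter_upwards [hχ1.filter_mono (nhds_le_nhdsSet (mem_inter hy hyφ))] with x hx
      rw [hx, mul_one]
    · filter_upwards [(isClosed_tsupport φ).isOpen_compl.mem_nhds hyφ] with x hx
      rw [image_eq_zero_of_notMem_tsupport hx, zero_mul]
  have hleft : ∀ x, fderiv ℝ (fun y => φ y * χ y) x v • f x = fderiv ℝ φ x v • f x := fun x => by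
    by_cases hx : x ∈ K
    · rw [(heq x hx).fderiv_eq]
    · rw [hf x hx, smul_zero, smul_zero]
  have hright : ∀ x, (φ x * χ x) • f' x v = φ x • f' x v := fun x => by
    by_cases hx : x ∈ K
    · rw [(heq x hx).eq_of_nhds]
    · rw [hf' x hx, zero_apply, smul_zero, smul_zero]
  simpa only [hleft, hright] using key

theorem hasFDerivAt_convolution_of_cone {F : Type*} [NormedAddCommGroup F] [NormedSpace ℝ F]
    {Ω K : Set (E d)} (hΩ : IsOpen Ω) (hK : IsClosed K) {f : E d → F} {f' : E d → E d →L[ℝ] F}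
    (hf : LocallyIntegrable f) (hf' : LocallyIntegrable f') (hw : HasWeakFDeriv Ω f f')
    (hfK : ∀ y ∉ K, f y = 0) (hfK' : ∀ y ∉ K, f' y = 0) {x e : E d} {r δ : ℝ}
    (b : ContDiffBump (-e)) (hcone : ∀ z ∈ Metric.ball x r, z ∈ Ω →
      Metric.closedBall (z + e) b.rOut ⊆ Ω)
    (hKδ : Metric.thickening δ K ⊆ Metric.ball x r) (hδ : ‖e‖ + b.rOut < δ) {y : E d} (hy : y ∈ Ω) :
    HasFDerivAt (b.normed volume ⋆[.lsmul ℝ ℝ, volume] f)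
      ((b.normed volume ⋆[.lsmul ℝ ℝ, volume] f') y) y := by
  refine hasFDerivAt_convolution_of_hasWeakFDeriv b.contDiff_normed b.hasCompactSupport_normed
    hf hf' (hw.union_compl hΩ hK hfK hfK') fun t ht => ?_
  rw [b.tsupport_normed_eq, mem_closedBall_iff_norm, sub_neg_eq_add] at ht
  by_cases hyr : y ∈ Metric.ball x r
  · refine .inl (hcone y hyr hy ?_)
    rwa [mem_closedBall_iff_norm', add_sub_sub_cancel, add_comm]
  · refine .inr fun hytK => hyr (hKδ (Metric.mem_thickening_iff.2 ⟨y - t, hytK, ?_⟩))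
    have := norm_sub_le (t + e) e
    rw [add_sub_cancel_right] at this
    rw [dist_eq_norm, sub_sub_cancel]
    linarith

theorem innerSL_normed_convolution {c : E d} (b : ContDiffBump c) {G : E d → E d}
    (hG : LocallyIntegrable G) (y : E d) :
    (b.normed volume ⋆[.lsmul ℝ ℝ, volume] fun x => innerSL ℝ (G x)) y =
      innerSL ℝ ((b.normed volume ⋆[.lsmul ℝ ℝ, volume] G) y) := by
  rw [normed_convolution_eq_integral, normed_convolution_eq_integral]
  exact (innerSL ℝ : E d →L[ℝ] _).integral_comp_comm
    (integrable_comp_sub_withDensity_normed b hG y)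

theorem gradient_normed_convolution_of_cone {Ω K : Set (E d)} (hΩ : IsOpen Ω) (hK : IsClosed K)
    {f : E d → ℝ} {G : E d → E d} (hf : LocallyIntegrable f) (hG : LocallyIntegrable G)
    (hw : HasWeakFDeriv Ω f fun x => innerSL ℝ (G x)) (hfK : ∀ y ∉ K, f y = 0)
    (hGK : ∀ y ∉ K, G y = 0) {x e : E d} {r δ : ℝ} (b : ContDiffBump (-e))
    (hcone : ∀ z ∈ Metric.ball x r, z ∈ Ω → Metric.closedBall (z + e) b.rOut ⊆ Ω)
    (hKδ : Metric.thickening δ K ⊆ Metric.ball x r) (hδ : ‖e‖ + b.rOut < δ) {y : E d} (hy : y ∈ Ω) :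
    gradient (b.normed volume ⋆[.lsmul ℝ ℝ, volume] f) y =
      (b.normed volume ⋆[.lsmul ℝ ℝ, volume] G) y := by
  refine gradient_eq_of_hasFDerivAt ?_
  rw [← innerSL_normed_convolution b hG]
  exact hasFDerivAt_convolution_of_cone hΩ hK hf
    (fun y => (hG y).imp fun _ h => ⟨h.1, (innerSL ℝ).integrable_comp h.2⟩) hw hfK
    (fun y hy => by rw [hGK y hy, map_zero]) b hcone hKδ hδ hy

theorem exists_norm_smul_add_lt {V : Type*} [NormedAddCommGroup V] [NormedSpace ℝ V] (e : V)
    (ρ : ℝ) {δ : ℝ} (hδ : 0 < δ) : ∃ s ∈ Ioc (0 : ℝ) 1, ‖s • e‖ + ρ * s < δ := by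
  have hcont : Continuous fun s : ℝ => ‖s • e‖ + ρ * s := by fun_prop
  have hlim := hcont.tendsto' 0 0 (by simp) |>.mono_left (nhdsWithin_le_nhds (s := Ioi 0))
  exact ((eventually_mem_set.2 (Ioc_mem_nhdsGT one_pos)).and
    (hlim.eventually (Iio_mem_nhds hδ))).exists

/-- The kernels are shifted into the cone, so that near `∂Ω` the mollification only sees values
inside `Ω`. -/
theorem exists_contDiff_approx_of_cone {Ω K : Set (E d)} (hΩ : IsOpen Ω) (hK : IsCompact K)
    {x e : E d} {r ρ : ℝ} (hρ : 0 < ρ) (hcone : ∀ z ∈ Metric.ball x r, z ∈ Ω →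
      ∀ s ∈ Ioc (0 : ℝ) 1, Metric.ball (z + s • e) (ρ * s) ⊆ Ω) (hKr : K ⊆ Metric.ball x r)
    {f : E d → ℝ} {G : E d → E d} (hf : MemLp f 2) (hG : MemLp G 2)
    (hfK : ∀ y ∉ K, f y = 0) (hGK : ∀ y ∉ K, G y = 0)
    (hw : HasWeakFDeriv Ω f fun x => innerSL ℝ (G x)) {ε : ℝ≥0∞} (hε : 0 < ε) :
    ∃ φ : E d → ℝ, ContDiff ℝ ∞ φ ∧ eLpNorm (φ - f) 2 (volume.restrict Ω) ≤ ε ∧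
      eLpNorm (gradient φ - G) 2 (volume.restrict Ω) ≤ ε := by
  have htrans : ∀ᶠ t : E d in 𝓝 0, eLpNorm (fun y => f (y - t) - f y) 2 volume ≤ ε ∧
      eLpNorm (fun y => G (y - t) - G y) 2 volume ≤ ε :=
    ((tendsto_eLpNorm_translate_sub (by simp) hf).eventually (Iic_mem_nhds hε)).and
      ((tendsto_eLpNorm_translate_sub (by simp) hG).eventually (Iic_mem_nhds hε))
  obtain ⟨δ₁, hδ₁, h₁⟩ := Metric.eventually_nhds_iff_ball.1 htrans
  obtain ⟨δ₂, hδ₂, h₂⟩ := hK.exists_thickening_subset_open Metric.isOpen_ball hKr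
  obtain ⟨s, hs, hsδ⟩ := exists_norm_smul_add_lt e (ρ / 2) (lt_min hδ₁ hδ₂)
  have hs0 : 0 < ρ * s := mul_pos hρ hs.1
  let b : ContDiffBump (-(s • e)) := ⟨ρ / 2 * s / 2, ρ / 2 * s, by linarith, by linarith⟩
  have hsupp : Metric.ball (-(s • e)) b.rOut ⊆ Metric.ball 0 δ₁ :=
    Metric.ball_subset_ball' <| by
      rw [dist_zero_right, norm_neg, add_comm]
      exact hsδ.le.trans (min_le_left _ _)
  have hcone' : ∀ z ∈ Metric.ball x r, z ∈ Ω → Metric.closedBall (z + s • e) b.rOut ⊆ Ω :=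
    fun z hz hzΩ => (Metric.closedBall_subset_ball
      (by linarith : ρ / 2 * s < ρ * s)).trans (hcone z hz hzΩ s hs)
  have hfl : LocallyIntegrable f := hf.locallyIntegrable one_le_two
  have hGl : LocallyIntegrable G := hG.locallyIntegrable one_le_two
  have hgrad : gradient (b.normed volume ⋆[.lsmul ℝ ℝ, volume] f) - G =ᵐ[volume.restrict Ω]
      b.normed volume ⋆[.lsmul ℝ ℝ, volume] G - G := by
    filter_upwards [ae_restrict_mem hΩ.measurableSet] with y hy
    rw [Pi.sub_apply, Pi.sub_apply, gradient_normed_convolution_of_cone hΩ hK.isClosed hfl hGl hw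
      hfK hGK b hcone' h₂ (hsδ.trans_le (min_le_right _ _)) hy]
  refine ⟨b.normed volume ⋆[.lsmul ℝ ℝ, volume] f, contDiff_normed_convolution b hfl, ?_, ?_⟩
  · exact (eLpNorm_mono_measure _ Measure.restrict_le_self).trans
      (eLpNorm_normed_convolution_sub_le b one_le_two (by simp) hfl
        fun t ht => (h₁ t (hsupp ht)).1)
  · rw [eLpNorm_congr_ae hgrad]
    exact (eLpNorm_mono_measure _ Measure.restrict_le_self).trans
      (eLpNorm_normed_convolution_sub_le b one_le_two (by simp) hGl
        fun t ht => (h₁ t (hsupp ht)).2)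

namespace H1

variable {Ω : Set (E d)}

/-- The restrictions of smooth functions on `ℝ^d` to `Ω`. -/
def smoothFns (Ω : Set (E d)) : Submodule ℝ (H1 Ω) where
  carrier := {w | ∃ φ : E d → ℝ, ContDiff ℝ ∞ φ ∧ fn w =ᵐ[volume.restrict Ω] φ}
  zero_mem' := ⟨0, contDiff_const, Lp.coeFn_zero ..⟩
  add_mem' := by
    rintro p q ⟨φ, h, h1⟩ ⟨φ', h', h1'⟩
    exact ⟨φ + φ', h.add h', (Lp.coeFn_add (fn p) (fn q)).trans (h1.add h1')⟩
  smul_mem' := by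
    rintro c p ⟨φ, h, h1⟩
    exact ⟨c • φ, h.const_smul c, (Lp.coeFn_smul c (fn p)).trans (h1.const_smul c)⟩

theorem enorm_sub_le {u w : H1 Ω} {f g : E d → ℝ} {F G : E d → E d}
    (hu : fn u =ᵐ[volume.restrict Ω] f) (hu' : grad u =ᵐ[volume.restrict Ω] F)
    (hw : fn w =ᵐ[volume.restrict Ω] g) (hw' : grad w =ᵐ[volume.restrict Ω] G) :
    ‖u - w‖ₑ ≤ eLpNorm (f - g) 2 (volume.restrict Ω) + eLpNorm (F - G) 2 (volume.restrict Ω) := by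
  have hle : ∀ v : H1 Ω, ‖v‖ₑ ≤ ‖fn v‖ₑ + ‖grad v‖ₑ := fun v => by
    rw [← ofReal_norm, ← ofReal_norm, ← ofReal_norm, ← ENNReal.ofReal_add (by simp) (by simp)]
    exact ENNReal.ofReal_le_ofReal (abs_le_of_sq_le_sq' (by
      nlinarith [norm_sq v, norm_nonneg (fn v), norm_nonneg (grad v)]) (by positivity)).2
  refine (hle _).trans_eq ?_
  have hfn : fn (u - w) = fn u - fn w := rfl
  have hgrad : grad (u - w) = grad u - grad w := rfl
  rw [hfn, hgrad, Lp.enorm_def, Lp.enorm_def,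
    eLpNorm_congr_ae ((Lp.coeFn_sub (fn u) (fn w)).trans (hu.sub hw)),
    eLpNorm_congr_ae ((Lp.coeFn_sub (grad u) (grad w)).trans (hu'.sub hw'))]

theorem mem_closure_smoothFns_of_cone (hΩ : IsOpen Ω) (hb : Bornology.IsBounded Ω)
    {x e : E d} {r ρ : ℝ} (hρ : 0 < ρ) (hcone : ∀ z ∈ Metric.ball x r, z ∈ Ω →
      ∀ s ∈ Ioc (0 : ℝ) 1, Metric.ball (z + s • e) (ρ * s) ⊆ Ω)
    {K : Set (E d)} (hK : IsCompact K) (hKr : K ⊆ Metric.ball x r) {w : H1 Ω}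
    (h0 : ∀ᵐ x ∂(volume.restrict Ω), x ∉ K → fn w x = 0 ∧ grad w x = 0) :
    w ∈ (smoothFns Ω).topologicalClosure := by
  have hΩK : MeasurableSet (Ω ∩ K) := hΩ.measurableSet.inter hK.measurableSet
  have hmem : ∀ {F : Type} [NormedAddCommGroup F] (f : Lp F 2 (volume.restrict Ω)),
      MemLp ((Ω ∩ K).indicator f) 2 := fun f => (memLp_indicator_iff_restrict hΩK).2
    ((Lp.memLp f).mono_measure (Measure.restrict_mono inter_subset_left le_rfl))
  have hfw : fn w =ᵐ[volume.restrict Ω] (Ω ∩ K).indicator (fn w) := by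
    filter_upwards [h0, ae_restrict_mem hΩ.measurableSet] with y hy hyΩ
    by_cases hyK : y ∈ K <;> simp [hyΩ, hyK, hy]
  have hGw : grad w =ᵐ[volume.restrict Ω] (Ω ∩ K).indicator (grad w) := by
    filter_upwards [h0, ae_restrict_mem hΩ.measurableSet] with y hy hyΩ
    by_cases hyK : y ∈ K <;> simp [hyΩ, hyK, hy]
  refine (mem_closure_iff_nhds_basis Metric.nhds_basis_closedEBall).2 fun ε hε => ?_
  obtain ⟨φ, hφ, hφf, hφG⟩ := exists_contDiff_approx_of_cone hΩ hK hρ hcone hKr (hmem (fn w))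
    (hmem (grad w)) (fun y hy => by simp [hy]) (fun y hy => by simp [hy])
    ((hasWeakFDeriv w).congr hfw (hGw.mono fun y hy => congrArg (innerSL ℝ) hy))
    (ENNReal.half_pos hε.ne')
  have hφ1 : ContDiff ℝ 1 φ := hφ.of_le (by simp)
  refine ⟨ofContDiff hb hφ1, ⟨φ, hφ, fn_ofContDiff hb hφ1⟩, ?_⟩
  rw [Metric.mem_closedEBall, edist_eq_enorm_sub, ← ENNReal.add_halves ε]
  exact (enorm_sub_le (fn_ofContDiff hb hφ1) (grad_ofContDiff hb hφ1) hfw hGw).trans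
    (add_le_add hφf hφG)

theorem eq_sum_testSMul (hΩ : IsOpen Ω) {ι : Type*} [Fintype ι] {χ : ι → E d → ℝ}
    (hχ : ∀ i, ContDiff ℝ ∞ (χ i)) (hc : ∀ i, HasCompactSupport (χ i))
    (hsum : ∀ x ∈ Ω, ∑ i, χ i x = 1) (w : H1 Ω) : ∑ i, testSMul (hχ i) (hc i) w = w := by
  refine ext_fn hΩ ?_
  have hfn : fn (∑ i, testSMul (hχ i) (hc i) w) = ∑ i, fn (testSMul (hχ i) (hc i) w) :=
    map_sum (fnL Ω) _ Finset.univ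
  rw [hfn]
  filter_upwards [Lp.coeFn_finsetSum Finset.univ fun i => fn (testSMul (hχ i) (hc i) w),
    ae_all_iff.2 fun i => fn_testSMul (hχ i) (hc i) w, ae_restrict_mem hΩ.measurableSet]
    with x hx hxi hxΩ
  rw [hx, Finset.sum_apply, Finset.sum_congr rfl fun i _ => hxi i, ← Finset.sum_smul, hsum x hxΩ,
    one_smul]

theorem testSMul_mem_closure_smoothFns (hΩ : IsOpen Ω) (hb : Bornology.IsBounded Ω) {x : E d}
    {r ρ : ℝ} {e : E d} (hρ : 0 < ρ) (hcone : ∀ z ∈ Metric.ball x r, z ∈ Ω →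
      ∀ s ∈ Ioc (0 : ℝ) 1, Metric.ball (z + s • e) (ρ * s) ⊆ Ω) {χ : E d → ℝ}
    (hχ : ContDiff ℝ ∞ χ) (hc : HasCompactSupport χ) (hs : tsupport χ ⊆ Metric.ball x r)
    (w : H1 Ω) : testSMul hχ hc w ∈ (smoothFns Ω).topologicalClosure := by
  refine mem_closure_smoothFns_of_cone hΩ hb hρ hcone hc hs ?_
  filter_upwards [fn_testSMul hχ hc w, grad_testSMul hχ hc w] with x hx hx' hxs
  have hgrad : gradient χ x = 0 := by
    rw [gradient, fderiv_of_notMem_tsupport ℝ hxs, map_zero]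
  rw [hx, hx', image_eq_zero_of_notMem_tsupport hxs, hgrad, zero_smul, zero_smul, smul_zero,
    add_zero]
  exact ⟨rfl, rfl⟩

theorem mem_closure_smoothFns (hΩ : IsOpen Ω) (hb : Bornology.IsBounded Ω)
    (hcone : ∀ x ∈ closure Ω, ConeAt Ω x) (w : H1 Ω) :
    w ∈ closure (smoothFns Ω : Set (H1 Ω)) := by
  choose! r hr ρ hρ e he using hcone
  obtain ⟨t, htc, ht⟩ := hb.isCompact_closure.elim_nhds_subcover (fun x => Metric.ball x (r x))
    fun x hx => Metric.ball_mem_nhds x (hr x hx)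
  obtain ⟨χ, hχ⟩ := SmoothPartitionOfUnity.exists_isSubordinate (modelWithCornersSelf ℝ (E d))
    (isClosed_closure (s := Ω)) (fun i : t => Metric.ball (i : E d) (r i))
    (fun i => Metric.isOpen_ball) fun y hy => by
      obtain ⟨i, hi, hyi⟩ := mem_iUnion₂.1 (ht hy)
      exact mem_iUnion.2 ⟨⟨i, hi⟩, hyi⟩
  have hsm : ∀ i, ContDiff ℝ ∞ (χ i) := fun i => (χ i).contMDiff.contDiff
  have hcs : ∀ i : t, HasCompactSupport (χ i) := fun i =>
    (isCompact_closedBall (i : E d) (r i)).of_isClosed_subset (isClosed_tsupport _)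
      ((hχ i).trans Metric.ball_subset_closedBall)
  have hone : ∀ x ∈ Ω, ∑ i, χ i x = 1 := fun x hx => by
    rw [← finsum_eq_sum_of_fintype, χ.sum_eq_one (subset_closure hx)]
  rw [← eq_sum_testSMul hΩ hsm hcs hone w, ← Submodule.topologicalClosure_coe]
  refine Submodule.sum_mem _ fun i _ => ?_
  have hi : (i : E d) ∈ closure Ω := htc i i.2
  exact testSMul_mem_closure_smoothFns hΩ hb (hρ i hi) (he i hi) (hsm i) (hcs i) (hχ i) w

end H1

theorem IsBoundedLipschitzDomain.dense_smoothFns {Ω : Set (E d)}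
    (hΩ : IsBoundedLipschitzDomain Ω) : Dense (H1.smoothFns Ω : Set (H1 Ω)) :=
  H1.mem_closure_smoothFns hΩ.isOpen hΩ.isBounded fun _ => hΩ.coneAt

end Density

section Poincare

/-- The Dirichlet energy on `Ω` of a differentiable function. -/
def energy (Ω : Set (E d)) (u : E d → ℝ) : ℝ≥0∞ := ∫⁻ x in Ω, ‖fderiv ℝ u x‖ₑ ^ 2

theorem eLpNorm_two_sq {α F : Type*} [MeasurableSpace α] {μ : Measure α} [NormedAddCommGroup F]
    (f : α → F) : eLpNorm f 2 μ ^ 2 = ∫⁻ x, ‖f x‖ₑ ^ 2 ∂μ := by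
  simpa using eLpNorm_nnreal_pow_eq_lintegral (f := f) (μ := μ) (p := 2) two_ne_zero

theorem sq_lintegral_enorm_le {α F : Type*} [MeasurableSpace α] {μ : Measure α}
    [IsProbabilityMeasure μ] [NormedAddCommGroup F] {f : α → F} (hf : AEStronglyMeasurable f μ) :
    (∫⁻ x, ‖f x‖ₑ ∂μ) ^ 2 ≤ ∫⁻ x, ‖f x‖ₑ ^ 2 ∂μ := by
  rw [← eLpNorm_one_eq_lintegral_enorm, ← eLpNorm_two_sq]
  gcongr
  exact eLpNorm_le_eLpNorm_of_exponent_le one_le_two hf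

theorem enorm_sub_sq_le {F : Type*} [NormedAddCommGroup F] (a b c : F) :
    ‖a - c‖ₑ ^ 2 ≤ 2 * ‖a - b‖ₑ ^ 2 + 2 * ‖b - c‖ₑ ^ 2 := by
  have htri : ‖a - c‖ ≤ ‖a - b‖ + ‖b - c‖ := norm_sub_le_norm_sub_add_norm_sub a b c
  have h : ‖a - c‖ ^ 2 ≤ 2 * ‖a - b‖ ^ 2 + 2 * ‖b - c‖ ^ 2 := by
    nlinarith [norm_nonneg (a - c), sq_nonneg (‖a - b‖ - ‖b - c‖)]
  have h' := ENNReal.ofReal_le_ofReal h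
  rw [ENNReal.ofReal_add (by positivity) (by positivity), ENNReal.ofReal_mul zero_le_two,
    ENNReal.ofReal_mul zero_le_two, ENNReal.ofReal_pow (norm_nonneg _),
    ENNReal.ofReal_pow (norm_nonneg _), ENNReal.ofReal_pow (norm_nonneg _)] at h'
  simpa only [ofReal_norm, ENNReal.ofReal_ofNat] using h'

theorem continuous_fderiv_add_smul {u : E d → ℝ} (hu : ContDiff ℝ 1 u) (h : E d) :
    Continuous fun p : E d × ℝ => fderiv ℝ u (p.1 + p.2 • h) :=
  (hu.continuous_fderiv one_ne_zero).comp (by fun_prop)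

theorem enorm_sub_sq_le_lintegral {u : E d → ℝ} (hu : ContDiff ℝ 1 u) (y h : E d) {t : ℝ}
    (ht : t ∈ Icc (0 : ℝ) 1) : ‖u (y + t • h) - u y‖ₑ ^ 2 ≤
      ‖h‖ₑ ^ 2 * ∫⁻ s in Ioc (0 : ℝ) 1, ‖fderiv ℝ u (y + s • h)‖ₑ ^ 2 := by
  have hd : ∀ s : ℝ, HasDerivAt (fun s : ℝ => u (y + s • h)) (fderiv ℝ u (y + s • h) h) s :=
    fun s => (hu.differentiable one_ne_zero _).hasFDerivAt.comp_hasDerivAt s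
      (by simpa using ((hasDerivAt_id s).smul_const h).const_add y)
  have hc : Continuous fun s : ℝ => fderiv ℝ u (y + s • h) :=
    (continuous_fderiv_add_smul hu h).comp (Continuous.prodMk_right y)
  have hftc := intervalIntegral.integral_eq_sub_of_hasDerivAt (a := 0) (b := t)
    (fun s _ => hd s) ((hc.clm_apply continuous_const).intervalIntegrable 0 t)
  rw [zero_smul, add_zero, intervalIntegral.integral_of_le ht.1] at hftc
  have : IsProbabilityMeasure (volume.restrict (Ioc (0 : ℝ) 1)) := ⟨by simp⟩
  calc ‖u (y + t • h) - u y‖ₑ ^ 2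
      ≤ (∫⁻ s in Ioc (0 : ℝ) 1, ‖h‖ₑ * ‖fderiv ℝ u (y + s • h)‖ₑ) ^ 2 := by
        rw [← hftc]
        gcongr
        refine (enorm_integral_le_lintegral_enorm _).trans ?_
        refine (lintegral_mono_set (Ioc_subset_Ioc_right ht.2)).trans (lintegral_mono fun s => ?_)
        rw [mul_comm]
        exact (fderiv ℝ u (y + s • h)).le_opENorm h
    _ = ‖h‖ₑ ^ 2 * (∫⁻ s in Ioc (0 : ℝ) 1, ‖fderiv ℝ u (y + s • h)‖ₑ) ^ 2 := by
        rw [lintegral_const_mul _ hc.enorm.measurable, mul_pow]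
    _ ≤ _ := by
        gcongr
        exact sq_lintegral_enorm_le hc.aestronglyMeasurable

theorem lintegral_enorm_translate_sub_sq_le {Ω : Set (E d)} (hΩ : MeasurableSet Ω) {u : E d → ℝ}
    (hu : ContDiff ℝ 1 u) {V : Set (E d)} (hV : MeasurableSet V) {h : E d}
    (hseg : ∀ y ∈ V, ∀ s ∈ Ioc (0 : ℝ) 1, y + s • h ∈ Ω) :
    ∫⁻ y in V, ‖u (y + h) - u y‖ₑ ^ 2 ≤ ‖h‖ₑ ^ 2 * energy Ω u := by
  have hslice : ∀ s ∈ Ioc (0 : ℝ) 1, ∫⁻ y in V, ‖fderiv ℝ u (y + s • h)‖ₑ ^ 2 ≤ energy Ω u := by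
    intro s hs
    rw [energy, ← lintegral_indicator hΩ, ← lintegral_indicator hV,
      ← lintegral_add_right_eq_self (Ω.indicator _) (s • h)]
    refine lintegral_mono fun y => indicator_apply_le' (fun hy => ?_) fun _ => zero_le
    rw [indicator_of_mem (hseg y hy s hs)]
  calc ∫⁻ y in V, ‖u (y + h) - u y‖ₑ ^ 2
      ≤ ∫⁻ y in V, ‖h‖ₑ ^ 2 * ∫⁻ s in Ioc (0 : ℝ) 1, ‖fderiv ℝ u (y + s • h)‖ₑ ^ 2 :=
        lintegral_mono fun y => by
          simpa using enorm_sub_sq_le_lintegral hu y h (right_mem_Icc.2 zero_le_one)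
    _ = ‖h‖ₑ ^ 2 * ∫⁻ s in Ioc (0 : ℝ) 1, ∫⁻ y in V, ‖fderiv ℝ u (y + s • h)‖ₑ ^ 2 := by
        rw [lintegral_const_mul' _ _ (by finiteness), lintegral_lintegral_swap]
        exact ((continuous_fderiv_add_smul hu h).enorm.measurable.pow_const 2).aemeasurable
    _ ≤ ‖h‖ₑ ^ 2 * ∫⁻ _ in Ioc (0 : ℝ) 1, energy Ω u := by
        gcongr ‖h‖ₑ ^ 2 * ?_
        exact setLIntegral_mono measurable_const hslice
    _ = ‖h‖ₑ ^ 2 * energy Ω u := by simp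

theorem lintegral_lintegral_eq_translate {B : Set (E d)} (hB : MeasurableSet B)
    {f : E d → E d → ℝ≥0∞} (hf : Measurable (Function.uncurry f)) :
    ∫⁻ x in B, ∫⁻ y in B, f x y = ∫⁻ h, ∫⁻ x in B ∩ (· + h) ⁻¹' B, f x (x + h) := by
  let F : E d → E d → ℝ≥0∞ := fun x h => (B ∩ (· + h) ⁻¹' B).indicator (fun x => f x (x + h)) x
  have hF : Measurable (Function.uncurry F) :=
    (hf.comp (measurable_fst.prodMk (measurable_fst.add measurable_snd))).indicator
      ((measurable_fst hB).inter ((measurable_fst.add measurable_snd) hB))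
  have hshift : ∀ x, B.indicator (fun x => ∫⁻ y in B, f x y) x = ∫⁻ h, F x h := by
    intro x
    by_cases hx : x ∈ B
    · rw [indicator_of_mem hx, ← lintegral_indicator hB, ← lintegral_add_left_eq_self _ x]
      refine lintegral_congr fun h => ?_
      by_cases hh : x + h ∈ B <;> simp [F, hx, hh]
    · simp [F, hx]
  simp_rw [← lintegral_indicator hB (fun x => ∫⁻ y in B, f x y), hshift,
    ← lintegral_indicator (hB.inter (measurable_add_const _ hB))]
  exact lintegral_lintegral_swap hF.aemeasurable

theorem lintegral_lintegral_enorm_sub_sq_le {B : Set (E d)} (hB : Convex ℝ B)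
    (hBm : MeasurableSet B) {D : ℝ} (hD : ∀ x ∈ B, ∀ y ∈ B, dist x y ≤ D) {u : E d → ℝ}
    (hu : ContDiff ℝ 1 u) : ∫⁻ x in B, ∫⁻ y in B, ‖u y - u x‖ₑ ^ 2 ≤
      volume (Metric.closedBall (0 : E d) D) * (ENNReal.ofReal D ^ 2 * energy B u) := by
  have hm : Measurable fun p : E d × E d => ‖u p.2 - u p.1‖ₑ ^ 2 := by
    have hcont := hu.continuous
    exact (by fun_prop : Continuous fun p : E d × E d => u p.2 - u p.1).enorm.measurable.pow_const 2
  calc ∫⁻ x in B, ∫⁻ y in B, ‖u y - u x‖ₑ ^ 2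
      = ∫⁻ h, ∫⁻ x in B ∩ (· + h) ⁻¹' B, ‖u (x + h) - u x‖ₑ ^ 2 :=
        lintegral_lintegral_eq_translate hBm hm
    _ ≤ ∫⁻ h, (Metric.closedBall (0 : E d) D).indicator
          (fun _ => ENNReal.ofReal D ^ 2 * energy B u) h := by
        refine lintegral_mono fun h => ?_
        by_cases hh : h ∈ Metric.closedBall (0 : E d) D
        · rw [indicator_of_mem hh]
          refine (lintegral_enorm_translate_sub_sq_le hBm hu
            (hBm.inter (measurable_add_const h hBm)) fun y hy s hs =>
              hB.add_smul_mem hy.1 hy.2 ⟨hs.1.le, hs.2⟩).trans ?_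
          gcongr
          rw [← ofReal_norm]
          exact ENNReal.ofReal_le_ofReal (mem_closedBall_zero_iff.1 hh)
        · have hempty : B ∩ (· + h) ⁻¹' B = ∅ := eq_empty_of_forall_notMem fun x hx => hh <| by
            simpa [dist_eq_norm] using hD x hx.1 (x + h) hx.2
          simp [hempty]
    _ = _ := by
        rw [lintegral_indicator Metric.isClosed_closedBall.measurableSet, setLIntegral_const,
          mul_comm]

/-- The Poincaré inequality on `V` in terms of the energy on `Ω`, where `c u` plays the role of the
mean value of `u`. -/
def PoincareOn (Ω : Set (E d)) (c : (E d → ℝ) → ℝ) (V : Set (E d)) : Prop :=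
  ∃ C : ℝ≥0∞, C ≠ ⊤ ∧ ∀ u : E d → ℝ, ContDiff ℝ 1 u →
    ∫⁻ x in V, ‖u x - c u‖ₑ ^ 2 ≤ C * energy Ω u

namespace PoincareOn

variable {Ω V W : Set (E d)} {c : (E d → ℝ) → ℝ}

theorem empty (Ω : Set (E d)) (c : (E d → ℝ) → ℝ) : PoincareOn Ω c ∅ :=
  ⟨0, ENNReal.zero_ne_top, fun u _ => by simp⟩

theorem mono (h : PoincareOn Ω c W) (hVW : V ⊆ W) : PoincareOn Ω c V := by
  obtain ⟨C, hC, H⟩ := h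
  exact ⟨C, hC, fun u hu => (lintegral_mono_set hVW).trans (H u hu)⟩

theorem union (hV : PoincareOn Ω c V) (hW : PoincareOn Ω c W) : PoincareOn Ω c (V ∪ W) := by
  obtain ⟨C, hC, H⟩ := hV
  obtain ⟨C', hC', H'⟩ := hW
  refine ⟨C + C', by finiteness, fun u hu => ?_⟩
  rw [add_mul]
  exact (lintegral_union_le _ _ _).trans (add_le_add (H u hu) (H' u hu))

theorem of_translate (hΩ : MeasurableSet Ω) (hV : MeasurableSet V) {e : E d}
    (hseg : ∀ y ∈ V, ∀ s ∈ Ioc (0 : ℝ) 1, y + s • e ∈ Ω) (hW : MeasurableSet W)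
    (hVW : ∀ y ∈ V, y + e ∈ W) (h : PoincareOn Ω c W) : PoincareOn Ω c V := by
  obtain ⟨C, hC, H⟩ := h
  refine ⟨2 * ‖e‖ₑ ^ 2 + 2 * C, by finiteness, fun u hu => ?_⟩
  have hm : Measurable fun x => ‖u (x + e) - u x‖ₑ ^ 2 :=
    ((hu.continuous.comp (continuous_add_const e)).sub hu.continuous).enorm.measurable.pow_const 2
  calc ∫⁻ x in V, ‖u x - c u‖ₑ ^ 2
      ≤ ∫⁻ x in V, (2 * ‖u (x + e) - u x‖ₑ ^ 2 + 2 * ‖u (x + e) - c u‖ₑ ^ 2) :=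
        lintegral_mono fun x => by
          simpa only [enorm_sub_rev (u x)] using enorm_sub_sq_le (u x) (u (x + e)) (c u)
    _ = 2 * (∫⁻ x in V, ‖u (x + e) - u x‖ₑ ^ 2) + 2 * ∫⁻ x in V, ‖u (x + e) - c u‖ₑ ^ 2 := by
        rw [lintegral_add_left (hm.const_mul 2), lintegral_const_mul _ hm,
          lintegral_const_mul' _ _ ENNReal.ofNat_ne_top]
    _ ≤ 2 * (‖e‖ₑ ^ 2 * energy Ω u) + 2 * (C * energy Ω u) := by
        gcongr
        · exact lintegral_enorm_translate_sub_sq_le hΩ hu hV hseg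
        · refine le_trans ?_ (H u hu)
          rw [← lintegral_indicator hW, ← lintegral_indicator hV,
            ← lintegral_add_right_eq_self (W.indicator _) e]
          refine lintegral_mono fun x => indicator_apply_le' (fun hx => ?_) fun _ => zero_le
          rw [indicator_of_mem (hVW x hx)]
    _ = _ := by ring

theorem exists_ball {x : E d} {r : ℝ} (hr : 0 < r) (h : Metric.ball x r ⊆ Ω) :
    ∃ c, PoincareOn Ω c (Metric.ball x r) := by
  set B := Metric.ball x r
  have hB0 : volume B ≠ 0 := (Metric.measure_ball_pos volume x hr).ne'
  have hBt : volume B ≠ ⊤ := measure_ball_lt_top.ne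
  have hmean : ∀ u : E d → ℝ, ∃ c : ℝ, ContDiff ℝ 1 u →
      ∫⁻ y in B, ‖u y - c‖ₑ ^ 2 ≤ ⨍⁻ x in B, (∫⁻ y in B, ‖u y - u x‖ₑ ^ 2) ∂volume := by
    intro u
    by_cases hu : ContDiff ℝ 1 u
    · have hcont : Continuous fun p : E d × E d => u p.2 - u p.1 := by
        have := hu.continuous
        fun_prop
      obtain ⟨y, -, hy⟩ := exists_le_setLAverage hB0 hBt
        ((hcont.enorm.measurable.pow_const 2).lintegral_prod_right' (ν := volume.restrict B)
          |>.aemeasurable)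
      exact ⟨u y, fun _ => hy⟩
    · exact ⟨0, fun h => absurd h hu⟩
  choose c hc using hmean
  refine ⟨c, (volume B)⁻¹ * (volume (Metric.closedBall (0 : E d) (2 * r)) *
    ENNReal.ofReal (2 * r) ^ 2), ?_, fun u hu => (hc u hu).trans ?_⟩
  · have : volume (Metric.closedBall (0 : E d) (2 * r)) ≠ ⊤ := measure_closedBall_lt_top.ne
    finiteness
  · rw [setLAverage_eq, ENNReal.div_eq_inv_mul, mul_assoc, mul_assoc]
    gcongr
    refine (lintegral_lintegral_enorm_sub_sq_le (D := 2 * r) (convex_ball x r)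
      measurableSet_ball (fun y hy z hz => ?_) hu).trans ?_
    · linarith [dist_triangle_right y z x, Metric.mem_ball.1 hy, Metric.mem_ball.1 hz]
    · gcongr
      exact lintegral_mono_set h

theorem of_isCompact {L : Set (E d)} (hL : IsCompact L)
    (h : ∀ x ∈ L, ∃ V ∈ 𝓝 x, PoincareOn Ω c (V ∩ Ω)) : PoincareOn Ω c (L ∩ Ω) := by
  refine hL.induction_on (p := fun s => PoincareOn Ω c (s ∩ Ω)) ?_ ?_ ?_ ?_
  · rw [empty_inter]
    exact .empty Ω c
  · exact fun s t hst ht => ht.mono (inter_subset_inter_left _ hst)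
  · intro s t hs ht
    rw [union_inter_distrib_right]
    exact hs.union ht
  · exact fun x hx => (h x hx).imp fun V hV => ⟨mem_nhdsWithin_of_mem_nhds hV.1, hV.2⟩

theorem exists_mem_nhds_of_mem_ball {x y z : E d} {r : ℝ} (hr : Metric.ball x r ⊆ Ω)
    (hΩ : IsOpen Ω) (hy : y ∈ Metric.ball x r) (hz : z ∈ Metric.ball x r)
    (h : ∃ V ∈ 𝓝 y, PoincareOn Ω c (V ∩ Ω)) : ∃ V ∈ 𝓝 z, PoincareOn Ω c (V ∩ Ω) := by
  obtain ⟨V, hV, hVc⟩ := h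
  obtain ⟨W, hWV, hWo, hyW⟩ := mem_nhds_iff.1 (inter_mem hV (Metric.isOpen_ball.mem_nhds hy))
  have hZ : IsOpen (Metric.ball x r ∩ (· + (y - z)) ⁻¹' W) :=
    Metric.isOpen_ball.inter (hWo.preimage (continuous_add_const _))
  refine ⟨_, hZ.mem_nhds ⟨hz, ?_⟩, of_translate hΩ.measurableSet (hZ.inter hΩ).measurableSet
    (e := y - z) (fun p hp s hs => hr ?_) hWo.measurableSet (fun p hp => hp.1.2) ?_⟩
  · rwa [mem_preimage, add_sub_cancel]
  · exact (convex_ball x r).add_smul_mem hp.1.1 (hWV hp.1.2).2 ⟨hs.1.le, hs.2⟩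
  · exact hVc.mono fun p hp => ⟨(hWV hp).1, hr (hWV hp).2⟩

theorem exists_mem_nhds_of_isPreconnected (hΩ : IsOpen Ω) (hconn : IsPreconnected Ω) {x y : E d}
    (hx : x ∈ Ω) (hy : y ∈ Ω) (h : ∃ V ∈ 𝓝 x, PoincareOn Ω c (V ∩ Ω)) :
    ∃ V ∈ 𝓝 y, PoincareOn Ω c (V ∩ Ω) := by
  refine (hconn.induction₂ (fun y z => (∃ V ∈ 𝓝 y, PoincareOn Ω c (V ∩ Ω)) ↔
    ∃ V ∈ 𝓝 z, PoincareOn Ω c (V ∩ Ω)) (fun z hz => ?_) (fun _ _ _ _ _ _ => Iff.trans)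
    (fun _ _ _ _ => Iff.symm) hx hy).1 h
  obtain ⟨r, hr, hrΩ⟩ := Metric.isOpen_iff.1 hΩ z hz
  filter_upwards [mem_nhdsWithin_of_mem_nhds (Metric.ball_mem_nhds z hr)] with w hw
  exact ⟨exists_mem_nhds_of_mem_ball hrΩ hΩ (Metric.mem_ball_self hr) hw,
    exists_mem_nhds_of_mem_ball hrΩ hΩ hw (Metric.mem_ball_self hr)⟩

theorem exists_mem_nhds_of_coneAt (hΩ : IsOpen Ω) (hb : Bornology.IsBounded Ω) {x : E d}
    (hx : ConeAt Ω x) (h : ∀ y ∈ Ω, ∃ V ∈ 𝓝 y, PoincareOn Ω c (V ∩ Ω)) :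
    ∃ V ∈ 𝓝 x, PoincareOn Ω c (V ∩ Ω) := by
  obtain ⟨r, hr, ρ, hρ, e, he⟩ := hx
  set L := closure ((· + e) '' (Metric.ball x r ∩ Ω))
  have hLc : IsCompact L := ((LipschitzWith.id.add (LipschitzWith.const e)).isBounded_image
    (hb.subset inter_subset_right)).isCompact_closure
  have hLΩ : L ⊆ Ω := fun y hy => by
    obtain ⟨_, ⟨z, hz, rfl⟩, hyz⟩ := Metric.mem_closure_iff.1 hy ρ hρ
    refine he z hz.1 hz.2 1 ⟨one_pos, le_rfl⟩ ?_
    rwa [one_smul, mul_one, Metric.mem_ball]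
  have hPL : PoincareOn Ω c L :=
    (of_isCompact hLc fun y hy => h y (hLΩ hy)).mono (subset_inter subset_rfl hLΩ)
  refine ⟨_, Metric.ball_mem_nhds x hr, of_translate hΩ.measurableSet
    (measurableSet_ball.inter hΩ.measurableSet) (fun y hy s hs => ?_) hLc.measurableSet
    (fun y hy => subset_closure (mem_image_of_mem _ hy)) hPL⟩
  exact he y hy.1 hy.2 s hs (Metric.mem_ball_self (mul_pos hρ hs.1))

end PoincareOn

/-- Starting from a ball, the inequality is propagated along `Ω` by translations: inside balls by
connectedness, and up to the boundary by the cone condition. -/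
theorem IsBoundedLipschitzDomain.exists_poincareOn {Ω : Set (E d)}
    (hΩ : IsBoundedLipschitzDomain Ω) : ∃ c, PoincareOn Ω c Ω := by
  obtain ⟨x, hx⟩ := hΩ.isConnected.nonempty
  obtain ⟨r, hr, hrΩ⟩ := Metric.isOpen_iff.1 hΩ.isOpen x hx
  obtain ⟨c, hc⟩ := PoincareOn.exists_ball hr hrΩ
  have hinterior : ∀ y ∈ Ω, ∃ V ∈ 𝓝 y, PoincareOn Ω c (V ∩ Ω) := fun y hy =>
    PoincareOn.exists_mem_nhds_of_isPreconnected hΩ.isOpen hΩ.isConnected.isPreconnected hx hy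
      ⟨_, Metric.ball_mem_nhds x hr, hc.mono inter_subset_left⟩
  refine ⟨c, (PoincareOn.of_isCompact hΩ.isBounded.isCompact_closure fun y hy =>
    PoincareOn.exists_mem_nhds_of_coneAt hΩ.isOpen hΩ.isBounded (hΩ.coneAt hy) hinterior).mono ?_⟩
  exact subset_inter subset_closure subset_rfl

theorem H1.enorm_fn_sq {Ω : Set (E d)} {w : H1 Ω} {φ : E d → ℝ}
    (hw : fn w =ᵐ[volume.restrict Ω] φ) : ‖fn w‖ₑ ^ 2 = ∫⁻ x in Ω, ‖φ x‖ₑ ^ 2 := by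
  rw [Lp.enorm_def, eLpNorm_congr_ae hw, eLpNorm_two_sq]

theorem H1.enorm_grad_sq {Ω : Set (E d)} (hΩ : IsOpen Ω) (hb : Bornology.IsBounded Ω) {w : H1 Ω}
    {φ : E d → ℝ} (hφ : ContDiff ℝ 1 φ) (hw : fn w =ᵐ[volume.restrict Ω] φ) :
    ‖grad w‖ₑ ^ 2 = energy Ω φ := by
  obtain rfl : w = ofContDiff hb hφ := ext_fn hΩ (hw.trans (fn_ofContDiff hb hφ).symm)
  rw [Lp.enorm_def, eLpNorm_congr_ae (grad_ofContDiff hb hφ), eLpNorm_two_sq, energy]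
  refine lintegral_congr fun x => ?_
  rw [← innerSL_gradient, ← ofReal_norm, ← ofReal_norm, innerSL_apply_norm]

theorem H1.enorm_sq {Ω : Set (E d)} (w : H1 Ω) : ‖w‖ₑ ^ 2 = ‖fn w‖ₑ ^ 2 + ‖grad w‖ₑ ^ 2 := by
  simp_rw [← ofReal_norm, ← ENNReal.ofReal_pow (norm_nonneg _)]
  rw [← ENNReal.ofReal_add (by positivity) (by positivity), norm_sq]

/-- The constant function `1` as an element of `H^1(Ω)`. -/
def H1.one {Ω : Set (E d)} (hb : Bornology.IsBounded Ω) : H1 Ω :=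
  ofContDiff hb (f := fun _ => 1) contDiff_const

theorem H1.grad_one {Ω : Set (E d)} (hb : Bornology.IsBounded Ω) : grad (one hb) = 0 := by
  refine Lp.ext ((grad_ofContDiff hb contDiff_const).trans ?_)
  filter_upwards [Lp.coeFn_zero (E d) 2 (volume.restrict Ω)] with x hx
  rw [gradient_fun_const, hx, Pi.zero_apply]

theorem norm_le_of_enorm_sq_le {X Y : Type*} [NormedAddCommGroup X] [NormedAddCommGroup Y]
    {x : X} {y : Y} {C : ℝ≥0∞} (hC : C ≠ ⊤) (h : ‖y‖ₑ ^ 2 ≤ C * ‖x‖ₑ ^ 2) :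
    ‖y‖ ≤ √C.toReal * ‖x‖ := by
  rw [← ofReal_norm, ← ofReal_norm, ← ENNReal.ofReal_pow (norm_nonneg _),
    ← ENNReal.ofReal_pow (norm_nonneg _), ← ENNReal.ofReal_toReal hC,
    ← ENNReal.ofReal_mul ENNReal.toReal_nonneg, ENNReal.ofReal_le_ofReal_iff (by positivity)] at h
  refine le_of_sq_le_sq ?_ (by positivity)
  rwa [mul_pow, Real.sq_sqrt ENNReal.toReal_nonneg]

theorem exists_norm_le_of_dense {V L : Type*} [NormedAddCommGroup V] [NormedSpace ℝ V]
    [NormedAddCommGroup L] [NormedSpace ℝ L] (D : V →L[ℝ] L) (m : V →L[ℝ] ℝ) {S : Set V}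
    (hS : Dense S) {e : V} (hm : m e ≠ 0) {C : ℝ}
    (hC : ∀ w ∈ S, ∃ c : ℝ, ‖w - c • e‖ ≤ C * ‖D w‖) :
    ∃ C : ℝ, ∀ w, ‖w‖ ≤ C * (‖D w‖ + |m w|) := by
  have : 0 < |m e| := abs_pos.2 hm
  set k := ‖e‖ / |m e| with hk
  have : 0 ≤ k := by positivity
  have hbound : ∀ w ∈ S, ‖w‖ ≤ (|C| * (1 + k * ‖m‖) + k) * (‖D w‖ + |m w|) := fun w hw => by
    obtain ⟨c, hc⟩ := hC w hw
    have hmc : |c| * |m e| ≤ |m w| + ‖m‖ * ‖w - c • e‖ := by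
      have hsub : c * m e = m w - m (w - c • e) := by simp
      rw [← abs_mul, hsub]
      exact (abs_sub _ _).trans (by gcongr; exact m.le_opNorm _)
    calc ‖w‖ ≤ ‖w - c • e‖ + |c| * ‖e‖ := by
          simpa [norm_smul] using norm_add_le (w - c • e) (c • e)
      _ = ‖w - c • e‖ + k * (|c| * |m e|) := by rw [hk]; field_simp
      _ ≤ ‖w - c • e‖ + k * (|m w| + ‖m‖ * ‖w - c • e‖) := by gcongr
      _ = (1 + k * ‖m‖) * ‖w - c • e‖ + k * |m w| := by ring
      _ ≤ (1 + k * ‖m‖) * (|C| * ‖D w‖) + k * |m w| := by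
        gcongr
        exact hc.trans (by gcongr; exact le_abs_self C)
      _ ≤ _ := by
        have : 0 ≤ |C| * (1 + k * ‖m‖) * |m w| + k * ‖D w‖ := by positivity
        linarith
  exact ⟨_, fun w => closure_minimal hbound (isClosed_le continuous_norm
    (continuous_const.mul (D.continuous.norm.add m.continuous.abs))) (hS w)⟩

namespace IsBoundedLipschitzDomain

variable {Ω : Set (E d)}

theorem exists_norm_sub_smul_one_le (hΩ : IsBoundedLipschitzDomain Ω) :
    ∃ C : ℝ, ∀ w ∈ H1.smoothFns Ω, ∃ c : ℝ, ‖w - c • H1.one hΩ.isBounded‖ ≤ C * ‖grad w‖ := by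
  obtain ⟨c, C, hC, hP⟩ := hΩ.exists_poincareOn
  refine ⟨√(C + 1).toReal, fun w ⟨φ, hφ, hw⟩ => ⟨c φ, norm_le_of_enorm_sq_le (by finiteness) ?_⟩⟩
  have hφ1 : ContDiff ℝ 1 φ := hφ.of_le (by simp)
  have hfn : fn (w - c φ • H1.one hΩ.isBounded) =ᵐ[volume.restrict Ω] fun x => φ x - c φ := by
    filter_upwards [hw, Lp.coeFn_sub (fn w) (c φ • fn (H1.one hΩ.isBounded)),
      Lp.coeFn_smul (c φ) (fn (H1.one hΩ.isBounded)),
      H1.fn_ofContDiff hΩ.isBounded (f := fun _ => (1 : ℝ)) contDiff_const] with x hx hsub hsmul h1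
    refine hsub.trans ?_
    rw [Pi.sub_apply, hsmul, Pi.smul_apply, H1.one, h1, hx, smul_eq_mul, mul_one]
  have hgrad : grad (w - c φ • H1.one hΩ.isBounded) = grad w := by
    change grad w - c φ • grad (H1.one hΩ.isBounded) = grad w
    rw [H1.grad_one, smul_zero, sub_zero]
  rw [H1.enorm_sq, H1.enorm_fn_sq hfn, hgrad, add_mul, one_mul,
    H1.enorm_grad_sq hΩ.isOpen hΩ.isBounded hφ1 hw]
  gcongr
  exact hP φ hφ1

theorem exists_norm_le (hΩ : IsBoundedLipschitzDomain Ω) {m : H1 Ω →L[ℝ] ℝ}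
    (hm : m (H1.one hΩ.isBounded) ≠ 0) : ∃ C : ℝ, ∀ w : H1 Ω, ‖w‖ ≤ C * (‖grad w‖ + |m w|) :=
  hΩ.exists_norm_sub_smul_one_le.elim fun _ hC =>
    exists_norm_le_of_dense (V := H1 Ω) (H1.gradL Ω) m hΩ.dense_smoothFns hm hC

end IsBoundedLipschitzDomain

end Poincare

section GraphExtension

variable {X Y : Type*} [NormedAddCommGroup X] [NormedSpace ℝ X] [NormedAddCommGroup Y]
  [NormedSpace ℝ Y] [CompleteSpace Y] {G : Submodule ℝ (X × Y)}

/-- The continuous extension of the operator with graph `G`, meaningful if that operator is bounded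
and densely defined. -/
def graphExtension (G : Submodule ℝ (X × Y)) : X →L[ℝ] Y :=
  (LinearMap.snd ℝ X Y ∘ₗ G.subtype).extendOfNorm (LinearMap.fst ℝ X Y ∘ₗ G.subtype)

theorem mem_topologicalClosure_iff_graphExtension_eq
    (hd : Dense (Prod.fst '' (G : Set (X × Y)))) (hC : ∃ C : ℝ, ∀ p ∈ G, ‖p.2‖ ≤ C * ‖p.1‖)
    {x : X} {y : Y} : (x, y) ∈ G.topologicalClosure ↔ graphExtension G x = y := by
  have hrange : DenseRange (LinearMap.fst ℝ X Y ∘ₗ G.subtype) :=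
    hd.mono (by
      rintro _ ⟨p, hp, rfl⟩
      exact ⟨⟨p, hp⟩, rfl⟩)
  have heq : ∀ p ∈ G, graphExtension G p.1 = p.2 := fun p hp =>
    LinearMap.extendOfNorm_eq hrange (hC.imp fun _ h q => h q q.2) ⟨p, hp⟩
  constructor
  · exact fun h => closure_minimal (t := {p : X × Y | graphExtension G p.1 = p.2}) heq
      (isClosed_eq ((graphExtension G).continuous.comp continuous_fst) continuous_snd) h
  · rintro rfl
    refine hrange.induction_on x (G.isClosed_topologicalClosure.preimage
      (continuous_id.prodMk (graphExtension G).continuous)) fun p => subset_closure ?_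
    change (p.1.1, graphExtension G p.1.1) ∈ G
    rw [heq p.1 p.2]
    exact p.2

end GraphExtension

section Trace

/-- The hyperplane orthogonal to `ν`. -/
abbrev Hyp (ν : E d) : Submodule ℝ (E d) := (Submodule.span ℝ {ν})ᗮ

theorem inner_hyp {ν : E d} (h : Hyp ν) : ⟪ν, (h : E d)⟫ = 0 :=
  Submodule.mem_orthogonal_singleton_iff_inner_right.1 h.2

theorem inner_add_smul_self {ν : E d} (hν : ‖ν‖ = 1) (y : E d) (s : ℝ) :
    ⟪ν, y + s • ν⟫ = ⟪ν, y⟫ + s := by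
  rw [inner_add_right, real_inner_smul_right, real_inner_self_eq_norm_sq, hν, one_pow, mul_one]

theorem sub_inner_smul_mem_hyp {ν : E d} (hν : ‖ν‖ = 1) (y : E d) : y - ⟪ν, y⟫ • ν ∈ Hyp ν := by
  rw [Submodule.mem_orthogonal_singleton_iff_inner_right, sub_eq_add_neg, ← neg_smul,
    inner_add_smul_self hν, add_neg_cancel]

theorem finrank_hyp {ν : E d} (hν : ‖ν‖ = 1) : Module.finrank ℝ (Hyp ν) = d - 1 := by
  have hsum := Submodule.finrank_add_finrank_orthogonal (Submodule.span ℝ {ν})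
  rw [finrank_span_singleton (norm_ne_zero_iff.1 (hν ▸ one_ne_zero)),
    finrank_euclideanSpace_fin] at hsum
  exact Nat.eq_sub_of_add_eq' hsum

theorem isAddHaarMeasure_hyp {ν : E d} (hν : ‖ν‖ = 1) :
    (μHE[d - 1] : Measure (Hyp ν)).IsAddHaarMeasure := by
  rw [← finrank_hyp hν]
  infer_instance

/-- The coordinates `(h, τ) ↦ h + τ a ν` of `ℝ^d` adapted to a unit vector `ν`. -/
def slabEquiv {ν : E d} (hν : ‖ν‖ = 1) {a : ℝ} (ha : a ≠ 0) : (Hyp ν × ℝ) ≃L[ℝ] E d :=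
  LinearEquiv.toContinuousLinearEquiv
    { (Hyp ν).subtype.coprod (LinearMap.toSpanSingleton ℝ (E d) (a • ν)) with
      invFun := fun y => (⟨y - ⟪ν, y⟫ • ν, sub_inner_smul_mem_hyp hν y⟩, a⁻¹ * ⟪ν, y⟫)
      left_inv := fun p => by
        have hinner : ⟪ν, (p.1 : E d) + p.2 • a • ν⟫ = p.2 * a := by
          rw [smul_smul, inner_add_smul_self hν, inner_hyp, zero_add]
        refine Prod.ext (Subtype.ext ?_) ?_
        · change (p.1 : E d) + p.2 • a • ν - ⟪ν, (p.1 : E d) + p.2 • a • ν⟫ • ν = p.1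
          rw [hinner, smul_smul, add_sub_cancel_right]
        · change a⁻¹ * ⟪ν, (p.1 : E d) + p.2 • a • ν⟫ = p.2
          rw [hinner, mul_comm p.2, inv_mul_cancel_left₀ ha]
      right_inv := fun y => by
        simp [smul_smul, mul_right_comm _ _ a, ha] }

theorem exists_lintegral_slab_eq {ν : E d} (hν : ‖ν‖ = 1) {a : ℝ} (ha : a ≠ 0) :
    ∃ c : ℝ≥0, ∀ f : E d → ℝ≥0∞, Measurable f →
      ∫⁻ h : Hyp ν, (∫⁻ τ : ℝ, f ((h : E d) + τ • a • ν)) ∂μHE[d - 1] = c * ∫⁻ x, f x := by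
  have := isAddHaarMeasure_hyp hν
  let μ : Measure (Hyp ν × ℝ) := (μHE[d - 1] : Measure (Hyp ν)).prod volume
  have hm : Measurable (slabEquiv hν ha) := (slabEquiv hν ha).continuous.measurable
  have : (μ.map (slabEquiv hν ha)).IsAddHaarMeasure := (slabEquiv hν ha).isAddHaarMeasure_map μ
  refine ⟨(μ.map (slabEquiv hν ha)).addHaarScalarFactor volume, fun f hf => ?_⟩
  have hprod : ∫⁻ p, f (slabEquiv hν ha p) ∂μ =
      ∫⁻ h : Hyp ν, (∫⁻ τ : ℝ, f ((h : E d) + τ • a • ν)) ∂μHE[d - 1] :=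
    lintegral_prod _ (hf.comp hm).aemeasurable
  have hsmul := congrArg (fun μ' => ∫⁻ x, f x ∂μ')
    (Measure.isAddLeftInvariant_eq_smul (μ.map (slabEquiv hν ha)) volume)
  rw [← hprod, ← lintegral_map hf hm]
  simpa only [lintegral_smul_measure, ENNReal.smul_def, smul_eq_mul] using hsmul

theorem euclideanHausdorffMeasure_image_le {X Y : Type*} [EMetricSpace X] [EMetricSpace Y]
    [MeasurableSpace X] [BorelSpace X] [MeasurableSpace Y] [BorelSpace Y] {K : ℝ≥0} {f : X → Y}
    (hf : LipschitzWith K f) (n : ℕ) (s : Set X) :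
    μHE[n] (f '' s) ≤ (K : ℝ≥0∞) ^ n * μHE[n] s := by
  rw [Measure.euclideanHausdorffMeasure_def, Measure.euclideanHausdorffMeasure_def,
    Measure.smul_apply, Measure.smul_apply, mul_smul_comm]
  gcongr
  simpa using hf.hausdorffMeasure_image_le (d := n) n.cast_nonneg s

section Graph

variable {Ω : Set (E d)} {x ν : E d} {r : ℝ} {K : ℝ≥0} {ψ : E d → ℝ}

/-- The parametrization over the hyperplane orthogonal to `ν` of the graph of `ψ`. -/
def graphMap (ν : E d) (ψ : E d → ℝ) (h : Hyp ν) : E d := (h : E d) + ψ h • ν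

theorem lipschitzWith_graphMap (hν : ‖ν‖ = 1) (hψ : LipschitzWith K ψ) :
    LipschitzWith (1 + K) (graphMap ν ψ) := by
  have hsmul : LipschitzWith 1 fun c : ℝ => c • ν := .of_dist_le_mul fun c c' => by
    rw [dist_eq_norm, ← sub_smul, norm_smul, hν, mul_one, NNReal.coe_one, one_mul, dist_eq_norm]
  have hcoe : LipschitzWith 1 ((↑) : Hyp ν → E d) := .subtype_val _
  have h := hcoe.add (hsmul.comp (hψ.comp hcoe))
  rw [one_mul, mul_one] at h
  exact h

theorem inner_graphMap (hν : ‖ν‖ = 1) (h : Hyp ν) : ⟪ν, graphMap ν ψ h⟫ = ψ h := by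
  rw [graphMap, inner_add_smul_self hν, inner_hyp, zero_add]

theorem graphMap_sub (hν : ‖ν‖ = 1) (h : Hyp ν) :
    graphMap ν ψ h - ⟪ν, graphMap ν ψ h⟫ • ν = h := by
  rw [inner_graphMap hν, graphMap, add_sub_cancel_right]

theorem add_smul_sub_inner_smul (hν : ‖ν‖ = 1) (y : E d) (s : ℝ) :
    y + s • ν - ⟪ν, y + s • ν⟫ • ν = y - ⟪ν, y⟫ • ν := by
  rw [inner_add_smul_self hν]
  module

theorem mem_frontier_iff_of_graph (hΩ : IsOpen Ω) (hν : ‖ν‖ = 1) (hψ : LipschitzWith K ψ)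
    (h : ∀ y ∈ Metric.ball x r, (y ∈ Ω ↔ ψ (y - ⟪ν, y⟫ • ν) < ⟪ν, y⟫)) {y : E d}
    (hy : y ∈ Metric.ball x r) : y ∈ frontier Ω ↔ ψ (y - ⟪ν, y⟫ • ν) = ⟪ν, y⟫ := by
  have hc : Continuous fun z : E d => ψ (z - ⟪ν, z⟫ • ν) := by
    have := hψ.continuous
    fun_prop
  rw [hΩ.frontier_eq, Set.mem_sdiff, h y hy, not_lt]
  refine ⟨fun ⟨hcl, hle⟩ => le_antisymm ?_ hle, fun heq => ⟨?_, heq.ge⟩⟩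
  · exact closure_minimal (fun z hz => ((h z hz.1).1 hz.2).le)
      (isClosed_le hc (by fun_prop)) (Metric.isOpen_ball.inter_closure ⟨hy, hcl⟩)
  · have htend : Tendsto (fun s : ℝ => y + s • ν) (𝓝[>] 0) (𝓝 y) := by
      have hcont : Continuous fun s : ℝ => y + s • ν := by fun_prop
      simpa using (hcont.tendsto 0).mono_left nhdsWithin_le_nhds
    refine mem_closure_of_tendsto htend ?_
    filter_upwards [htend (Metric.isOpen_ball.mem_nhds hy), self_mem_nhdsWithin] with s hs hs0
    rw [h _ hs, add_smul_sub_inner_smul hν, inner_add_smul_self hν, heq]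
    exact lt_add_of_pos_right _ hs0

theorem exists_graphMap_eq (hν : ‖ν‖ = 1) {y : E d} (hy : ψ (y - ⟪ν, y⟫ • ν) = ⟪ν, y⟫) :
    ∃ h : Hyp ν, graphMap ν ψ h = y :=
  ⟨⟨_, sub_inner_smul_mem_hyp hν y⟩, by rw [graphMap, hy, sub_add_cancel]⟩

theorem graphMap_add_smul_mem (hν : ‖ν‖ = 1)
    (h : ∀ y ∈ Metric.ball x r, (y ∈ Ω ↔ ψ (y - ⟪ν, y⟫ • ν) < ⟪ν, y⟫)) {z : Hyp ν} {s : ℝ}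
    (hs : 0 < s) (hz : graphMap ν ψ z + s • ν ∈ Metric.ball x r) : graphMap ν ψ z + s • ν ∈ Ω := by
  rw [h _ hz, add_smul_sub_inner_smul hν, inner_add_smul_self hν, graphMap_sub hν,
    inner_graphMap hν]
  exact lt_add_of_pos_right _ hs

theorem restrict_frontier_le_map_graphMap (hΩ : IsOpen Ω) (hν : ‖ν‖ = 1) (hψ : LipschitzWith K ψ)
    (h : ∀ y ∈ Metric.ball x r, (y ∈ Ω ↔ ψ (y - ⟪ν, y⟫ • ν) < ⟪ν, y⟫)) {N : Set (E d)}
    (hN : N ⊆ Metric.ball x r) :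
    (μHE[d - 1] : Measure (E d)).restrict (N ∩ frontier Ω) ≤ ((1 + K : ℝ≥0) : ℝ≥0∞) ^ (d - 1) •
      ((μHE[d - 1]).restrict (graphMap ν ψ ⁻¹' N)).map (graphMap ν ψ) := by
  have hlip := lipschitzWith_graphMap hν hψ
  have hm : Measurable (graphMap ν ψ) := hlip.continuous.measurable
  refine Measure.le_iff.2 fun B hB => ?_
  rw [Measure.restrict_apply hB, Measure.smul_apply, Measure.map_apply hm hB,
    Measure.restrict_apply (hm hB), smul_eq_mul]
  refine (measure_mono ?_).trans (euclideanHausdorffMeasure_image_le hlip (d - 1) _)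
  rintro y ⟨hyB, hyN, hyf⟩
  obtain ⟨z, rfl⟩ :=
    exists_graphMap_eq hν ((mem_frontier_iff_of_graph hΩ hν hψ h (hN hyN)).1 hyf)
  exact ⟨z, ⟨hyB, hyN⟩, rfl⟩

theorem lintegral_graphMap_segment_le (hν : ‖ν‖ = 1) (hr : 0 < r)
    (h : ∀ y ∈ Metric.ball x r, (y ∈ Ω ↔ ψ (y - ⟪ν, y⟫ • ν) < ⟪ν, y⟫)) {z : Hyp ν}
    (hz : graphMap ν ψ z ∈ Metric.ball x (r / 2)) (f : E d → ℝ≥0∞) :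
    ∫⁻ s in Ioc (0 : ℝ) 1, f (graphMap ν ψ z + s • (r / 2) • ν) ≤
      ∫⁻ s : ℝ, Ω.indicator f ((z : E d) + s • (r / 2) • ν) := by
  have hmem : ∀ s ∈ Ioc (0 : ℝ) 1, graphMap ν ψ z + s • (r / 2) • ν ∈ Ω := by
    intro s hs
    have hs0 : 0 < s * (r / 2) := mul_pos hs.1 (half_pos hr)
    rw [smul_smul]
    refine graphMap_add_smul_mem hν h hs0 ?_
    rw [mem_ball_iff_norm] at hz ⊢
    calc ‖graphMap ν ψ z + (s * (r / 2)) • ν - x‖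
        ≤ ‖graphMap ν ψ z - x‖ + ‖(s * (r / 2)) • ν‖ := by
          rw [add_sub_right_comm]
          exact norm_add_le _ _
      _ < r := by
          rw [norm_smul, hν, Real.norm_of_nonneg hs0.le]
          nlinarith [hs.2]
  calc ∫⁻ s in Ioc (0 : ℝ) 1, f (graphMap ν ψ z + s • (r / 2) • ν)
      = ∫⁻ s in Ioc (0 : ℝ) 1, Ω.indicator f (graphMap ν ψ z + s • (r / 2) • ν) :=
        setLIntegral_congr_fun measurableSet_Ioc fun s hs => (indicator_of_mem (hmem s hs) f).symm
    _ ≤ ∫⁻ s : ℝ, Ω.indicator f (graphMap ν ψ z + s • (r / 2) • ν) :=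
        setLIntegral_le_lintegral _ _
    _ = ∫⁻ s : ℝ, Ω.indicator f ((z : E d) + (s + (r / 2)⁻¹ * ψ z) • (r / 2) • ν) := by
        refine lintegral_congr fun s => congrArg _ ?_
        rw [graphMap, add_smul, smul_smul ((r / 2)⁻¹ * ψ z), mul_right_comm,
          inv_mul_cancel₀ (half_pos hr).ne', one_mul]
        abel
    _ = ∫⁻ s : ℝ, Ω.indicator f ((z : E d) + s • (r / 2) • ν) :=
        lintegral_add_right_eq_self
          (fun s : ℝ => Ω.indicator f ((z : E d) + s • (r / 2) • ν)) _

theorem exists_lintegral_collar_le (hΩ : IsOpen Ω) (hν : ‖ν‖ = 1) (hr : 0 < r)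
    (hψ : LipschitzWith K ψ)
    (h : ∀ y ∈ Metric.ball x r, (y ∈ Ω ↔ ψ (y - ⟪ν, y⟫ • ν) < ⟪ν, y⟫)) :
    ∃ C : ℝ≥0∞, C ≠ ⊤ ∧ ∀ f : E d → ℝ≥0∞, Measurable f →
      ∫⁻ y in Metric.ball x (r / 2) ∩ frontier Ω, (∫⁻ s in Ioc (0 : ℝ) 1, f (y + s • (r / 2) • ν))
        ∂μHE[d - 1] ≤ C * ∫⁻ y in Ω, f y := by
  obtain ⟨c, hc⟩ := exists_lintegral_slab_eq hν (half_pos hr).ne'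
  refine ⟨((1 + K : ℝ≥0) : ℝ≥0∞) ^ (d - 1) * c, by finiteness, fun f hf => ?_⟩
  have hgm : Measurable (graphMap ν ψ) := (lipschitzWith_graphMap hν hψ).continuous.measurable
  have hfm : Measurable fun y : E d => ∫⁻ s in Ioc (0 : ℝ) 1, f (y + s • (r / 2) • ν) :=
    Measurable.lintegral_prod_right' (f := fun q : E d × ℝ => f (q.1 + q.2 • (r / 2) • ν))
      (hf.comp (Continuous.measurable (by fun_prop)))
  calc ∫⁻ y in Metric.ball x (r / 2) ∩ frontier Ω,
        (∫⁻ s in Ioc (0 : ℝ) 1, f (y + s • (r / 2) • ν)) ∂μHE[d - 1]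
      ≤ ((1 + K : ℝ≥0) : ℝ≥0∞) ^ (d - 1) * ∫⁻ z in graphMap ν ψ ⁻¹' Metric.ball x (r / 2),
          (∫⁻ s in Ioc (0 : ℝ) 1, f (graphMap ν ψ z + s • (r / 2) • ν)) ∂μHE[d - 1] := by
        rw [← lintegral_map hfm hgm, ← smul_eq_mul, ← lintegral_smul_measure]
        exact lintegral_mono' (restrict_frontier_le_map_graphMap hΩ hν hψ h
          (Metric.ball_subset_ball (half_le_self hr.le))) le_rfl
    _ ≤ ((1 + K : ℝ≥0) : ℝ≥0∞) ^ (d - 1) * (c * ∫⁻ y in Ω, f y) := by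
        gcongr
        rw [← lintegral_indicator hΩ.measurableSet, ← hc _ (hf.indicator hΩ.measurableSet)]
        exact (setLIntegral_mono' (hgm measurableSet_ball) fun z hz =>
          lintegral_graphMap_segment_le hν hr h hz f).trans (setLIntegral_le_lintegral _ _)
    _ = _ := (mul_assoc _ _ _).symm

theorem euclideanHausdorffMeasure_frontier_ne_zero (hΩ : IsOpen Ω) (hν : ‖ν‖ = 1)
    (hψ : LipschitzWith K ψ)
    (h : ∀ y ∈ Metric.ball x r, (y ∈ Ω ↔ ψ (y - ⟪ν, y⟫ • ν) < ⟪ν, y⟫)) (hr : 0 < r)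
    (hx : x ∈ frontier Ω) : μHE[d - 1] (frontier Ω) ≠ 0 := by
  have := isAddHaarMeasure_hyp hν
  obtain ⟨z, hz⟩ := exists_graphMap_eq hν
    ((mem_frontier_iff_of_graph hΩ hν hψ h (Metric.mem_ball_self hr)).1 hx)
  have hopen : IsOpen (graphMap ν ψ ⁻¹' Metric.ball x r) :=
    Metric.isOpen_ball.preimage (lipschitzWith_graphMap hν hψ).continuous
  have hpos := hopen.measure_pos (μHE[d - 1] : Measure (Hyp ν))
    ⟨z, by rw [mem_preimage, hz]; exact Metric.mem_ball_self hr⟩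
  let π : E d →L[ℝ] Hyp ν := (Hyp ν).orthogonalProjectionOnto
  have hπν : π ν = 0 := by
    rw [Submodule.orthogonalProjectionOnto_eq_zero_iff, Submodule.orthogonal_orthogonal]
    exact Submodule.mem_span_singleton_self ν
  have hsub : graphMap ν ψ ⁻¹' Metric.ball x r ⊆ π '' frontier Ω := fun y hy => by
    refine ⟨graphMap ν ψ y, ?_, ?_⟩
    · rw [mem_frontier_iff_of_graph hΩ hν hψ h hy, graphMap_sub hν, inner_graphMap hν]
    · rw [graphMap, map_add, map_smul, hπν, smul_zero, add_zero]
      exact Submodule.orthogonalProjectionOnto_mem_subspace_eq_self y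
  intro hzero
  have hle := (measure_mono hsub).trans (euclideanHausdorffMeasure_image_le π.lipschitz (d - 1) _)
  rw [hzero, mul_zero] at hle
  exact hpos.not_ge hle

end Graph

theorem enorm_sq_le_lintegral_segment {u : E d → ℝ} (hu : ContDiff ℝ 1 u) (y e : E d) :
    ‖u y‖ₑ ^ 2 ≤ 2 * (∫⁻ s in Ioc (0 : ℝ) 1, ‖u (y + s • e)‖ₑ ^ 2) +
      2 * ‖e‖ₑ ^ 2 * ∫⁻ s in Ioc (0 : ℝ) 1, ‖fderiv ℝ u (y + s • e)‖ₑ ^ 2 := by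
  have hline : Continuous fun s : ℝ => y + s • e := by fun_prop
  have hm : Measurable fun s : ℝ => ‖u (y + s • e)‖ₑ ^ 2 :=
    (hu.continuous.comp hline).enorm.measurable.pow_const 2
  calc ‖u y‖ₑ ^ 2 = ∫⁻ _ in Ioc (0 : ℝ) 1, ‖u y‖ₑ ^ 2 := by simp
    _ ≤ ∫⁻ s in Ioc (0 : ℝ) 1, (2 * ‖u (y + s • e)‖ₑ ^ 2 +
          2 * ‖e‖ₑ ^ 2 * ∫⁻ s in Ioc (0 : ℝ) 1, ‖fderiv ℝ u (y + s • e)‖ₑ ^ 2) := by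
        refine setLIntegral_mono' measurableSet_Ioc fun s hs => ?_
        have hsplit := enorm_sub_sq_le (u y) (u (y + s • e)) 0
        rw [sub_zero, sub_zero, enorm_sub_rev, add_comm] at hsplit
        refine hsplit.trans ?_
        rw [mul_assoc 2]
        gcongr
        exact enorm_sub_sq_le_lintegral hu y e (Ioc_subset_Icc_self hs)
    _ = _ := by
        rw [lintegral_add_left (hm.const_mul 2), lintegral_const_mul _ hm]
        simp

theorem exists_trace_le_ball {Ω : Set (E d)} (hΩ : IsOpen Ω) (hlip : HasLipschitzBoundary Ω)
    {x : E d} (hx : x ∈ frontier Ω) : ∃ r > 0, ∃ C : ℝ≥0∞, C ≠ ⊤ ∧ ∀ u : E d → ℝ, ContDiff ℝ 1 u →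
      ∫⁻ y in Metric.ball x r ∩ frontier Ω, ‖u y‖ₑ ^ 2 ∂μHE[d - 1] ≤
        C * ((∫⁻ x in Ω, ‖u x‖ₑ ^ 2) + energy Ω u) := by
  obtain ⟨r, hr, ν, hν, K, ψ, hψ, h⟩ := hlip x hx
  obtain ⟨C, hC, hcollar⟩ := exists_lintegral_collar_le hΩ hν hr hψ h
  set e := (r / 2) • ν
  refine ⟨r / 2, half_pos hr, 2 * C + 2 * ‖e‖ₑ ^ 2 * C, by finiteness, fun u hu => ?_⟩
  have hm : Measurable fun y => ∫⁻ s in Ioc (0 : ℝ) 1, ‖u (y + s • e)‖ₑ ^ 2 :=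
    ((hu.continuous.comp (by fun_prop : Continuous fun q : E d × ℝ => q.1 + q.2 • e)
      ).enorm.measurable.pow_const 2).lintegral_prod_right'
  calc ∫⁻ y in Metric.ball x (r / 2) ∩ frontier Ω, ‖u y‖ₑ ^ 2 ∂μHE[d - 1]
      ≤ ∫⁻ y in Metric.ball x (r / 2) ∩ frontier Ω,
          (2 * (∫⁻ s in Ioc (0 : ℝ) 1, ‖u (y + s • e)‖ₑ ^ 2) +
          2 * ‖e‖ₑ ^ 2 * ∫⁻ s in Ioc (0 : ℝ) 1, ‖fderiv ℝ u (y + s • e)‖ₑ ^ 2) ∂μHE[d - 1] :=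
        lintegral_mono fun y => enorm_sq_le_lintegral_segment hu y e
    _ ≤ 2 * (C * ∫⁻ x in Ω, ‖u x‖ₑ ^ 2) + 2 * ‖e‖ₑ ^ 2 * (C * energy Ω u) := by
        rw [lintegral_add_left (hm.const_mul 2), lintegral_const_mul' _ _ (by finiteness),
          lintegral_const_mul' _ _ (by finiteness)]
        gcongr
        · exact hcollar _ (hu.continuous.enorm.measurable.pow_const 2)
        · exact hcollar _ ((hu.continuous_fderiv one_ne_zero).enorm.measurable.pow_const 2)
    _ ≤ _ := by
        rw [add_mul, mul_assoc, mul_assoc, mul_assoc, mul_assoc]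
        gcongr
        · exact le_self_add
        · exact le_add_self

namespace IsBoundedLipschitzDomain

variable {Ω : Set (E d)}

theorem surface_univ_ne_zero (hΩ : IsBoundedLipschitzDomain Ω) (hd : d ≠ 0) :
    surface Ω univ ≠ 0 := by
  have : Nonempty (Fin d) := Fin.pos_iff_nonempty.1 (Nat.pos_of_ne_zero hd)
  obtain ⟨x, hx⟩ : (frontier Ω).Nonempty := nonempty_frontier_iff.2
    ⟨hΩ.isConnected.nonempty, fun h => NoncompactSpace.noncompact_univ (X := E d)
      (Metric.isCompact_of_isClosed_isBounded isClosed_univ (h ▸ hΩ.isBounded))⟩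
  obtain ⟨r, hr, ν, hν, K, ψ, hψ, h⟩ := hΩ.lipschitz x hx
  rw [surface, Measure.restrict_apply_univ]
  exact euclideanHausdorffMeasure_frontier_ne_zero hΩ.isOpen hν hψ h hr hx

theorem isCompact_frontier (hΩ : IsBoundedLipschitzDomain Ω) : IsCompact (frontier Ω) :=
  hΩ.isBounded.isCompact_closure.of_isClosed_subset isClosed_frontier frontier_subset_closure

theorem exists_trace_le (hΩ : IsBoundedLipschitzDomain Ω) :
    ∃ C : ℝ≥0∞, C ≠ ⊤ ∧ ∀ u : E d → ℝ, ContDiff ℝ 1 u →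
      ∫⁻ y, ‖u y‖ₑ ^ 2 ∂(surface Ω) ≤ C * ((∫⁻ x in Ω, ‖u x‖ₑ ^ 2) + energy Ω u) := by
  rw [surface]
  nth_rw 1 [← inter_self (frontier Ω)]
  refine hΩ.isCompact_frontier.induction_on (p := fun s => ∃ C : ℝ≥0∞, C ≠ ⊤ ∧
      ∀ u : E d → ℝ, ContDiff ℝ 1 u → ∫⁻ y in s ∩ frontier Ω, ‖u y‖ₑ ^ 2 ∂μHE[d - 1] ≤
        C * ((∫⁻ x in Ω, ‖u x‖ₑ ^ 2) + energy Ω u)) ⟨0, by simp, fun u _ => by simp⟩ ?_ ?_ ?_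
  · rintro s t hst ⟨C, hC, h⟩
    exact ⟨C, hC, fun u hu => (lintegral_mono_set (inter_subset_inter_left _ hst)).trans (h u hu)⟩
  · rintro s t ⟨C, hC, h⟩ ⟨C', hC', h'⟩
    refine ⟨C + C', by finiteness, fun u hu => ?_⟩
    rw [union_inter_distrib_right, add_mul]
    exact (lintegral_union_le _ _ _).trans (add_le_add (h u hu) (h' u hu))
  · intro x hx
    obtain ⟨r, hr, h⟩ := exists_trace_le_ball hΩ.isOpen hΩ.lipschitz hx
    exact ⟨_, mem_nhdsWithin_of_mem_nhds (Metric.ball_mem_nhds x hr), h⟩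

theorem isFiniteMeasure_surface (hΩ : IsBoundedLipschitzDomain Ω) :
    IsFiniteMeasure (surface Ω) := by
  obtain ⟨C, hC, h⟩ := hΩ.exists_trace_le
  have hone := h (fun _ => 1) contDiff_const
  have henergy : energy Ω (fun _ => 1) = 0 := by
    simp only [energy, fderiv_fun_const, Pi.zero_apply, ← ofReal_norm, norm_zero,
      ENNReal.ofReal_zero, zero_pow two_ne_zero, lintegral_zero]
  rw [henergy, add_zero] at hone
  simp only [enorm_one, one_pow, lintegral_one, Measure.restrict_apply_univ] at hone
  exact ⟨hone.trans_lt (ENNReal.mul_lt_top hC.lt_top hΩ.isBounded.measure_lt_top)⟩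

theorem memLp_surface (hΩ : IsBoundedLipschitzDomain Ω) {φ : E d → ℝ} (hφ : Continuous φ)
    (p : ℝ≥0∞) : MemLp φ p (surface Ω) := by
  have := hΩ.isFiniteMeasure_surface
  obtain ⟨C, hC⟩ := hΩ.isCompact_frontier.exists_bound_of_continuousOn hφ.continuousOn
  exact MemLp.of_bound hφ.aestronglyMeasurable C
    ((ae_restrict_mem isClosed_frontier.measurableSet).mono hC)

theorem norm_snd_le (hΩ : IsBoundedLipschitzDomain Ω) {C : ℝ≥0∞} (hC : C ≠ ⊤)
    (h : ∀ u : E d → ℝ, ContDiff ℝ 1 u →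
      ∫⁻ y, ‖u y‖ₑ ^ 2 ∂(surface Ω) ≤ C * ((∫⁻ x in Ω, ‖u x‖ₑ ^ 2) + energy Ω u))
    {φ : E d → ℝ} (hφ : ContDiff ℝ 1 φ) {w : H1 Ω} (hw : fn w =ᵐ[volume.restrict Ω] φ)
    {γ : Lp ℝ 2 (surface Ω)} (hγ : γ =ᵐ[surface Ω] φ) : ‖γ‖ ≤ √C.toReal * ‖w‖ := by
  refine norm_le_of_enorm_sq_le hC ?_
  rw [Lp.enorm_def, eLpNorm_congr_ae hγ, eLpNorm_two_sq, H1.enorm_sq, H1.enorm_fn_sq hw,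
    H1.enorm_grad_sq hΩ.isOpen hΩ.isBounded hφ hw]
  exact h φ hφ

theorem exists_norm_snd_le (hΩ : IsBoundedLipschitzDomain Ω) :
    ∃ C : ℝ, ∀ p ∈ smoothTraceGraph Ω, ‖p.2‖ ≤ C * ‖p.1‖ :=
  hΩ.exists_trace_le.elim fun _ h => ⟨_, fun _ hp => hp.elim fun _ hφ =>
    hΩ.norm_snd_le h.1 h.2 (hφ.1.of_le (by simp)) hφ.2.1 hφ.2.2⟩

theorem exists_mem_smoothTraceGraph (hΩ : IsBoundedLipschitzDomain Ω) {w : H1 Ω}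
    (hw : w ∈ H1.smoothFns Ω) : ∃ γ, (w, γ) ∈ smoothTraceGraph Ω := by
  obtain ⟨φ, hφ, hwφ⟩ := hw
  have hm := hΩ.memLp_surface hφ.continuous 2
  exact ⟨hm.toLp φ, φ, hφ, hwφ, hm.coeFn_toLp⟩

end IsBoundedLipschitzDomain

/-- The trace operator `H^1(Ω) → L²(∂Ω)`, meaningful if `Ω` is a bounded Lipschitz domain. -/
def trace (Ω : Set (E d)) : H1 Ω →L[ℝ] Lp ℝ 2 (surface Ω) :=
  graphExtension (smoothTraceGraph Ω)

theorem inner_toLp_one {α : Type*} [MeasurableSpace α] {μ : Measure α}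
    (h : MemLp (fun _ : α => (1 : ℝ)) 2 μ) (γ : Lp ℝ 2 μ) : ⟪h.toLp _, γ⟫ = ∫ y, γ y ∂μ := by
  rw [L2.inner_def]
  refine integral_congr_ae ?_
  filter_upwards [h.coeFn_toLp] with y hy
  rw [hy]
  simp

namespace IsBoundedLipschitzDomain

variable {Ω : Set (E d)}

theorem dense_fst_smoothTraceGraph (hΩ : IsBoundedLipschitzDomain Ω) :
    Dense (Prod.fst '' (smoothTraceGraph Ω : Set (H1 Ω × Lp ℝ 2 (surface Ω)))) :=
  hΩ.dense_smoothFns.mono fun _ hw =>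
    (hΩ.exists_mem_smoothTraceGraph hw).elim fun _ hγ => ⟨_, hγ, rfl⟩

theorem mem_traceGraph_iff (hΩ : IsBoundedLipschitzDomain Ω) {w : H1 Ω}
    {γ : Lp ℝ 2 (surface Ω)} : (w, γ) ∈ traceGraph Ω ↔ trace Ω w = γ :=
  mem_topologicalClosure_iff_graphExtension_eq hΩ.dense_fst_smoothTraceGraph hΩ.exists_norm_snd_le

theorem isTrace_iff (hΩ : IsBoundedLipschitzDomain Ω) {w : H1 Ω} {γ : Hhalf Ω} :
    IsTrace w γ ↔ trace Ω w = γ :=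
  hΩ.mem_traceGraph_iff

theorem exists_isTrace (hΩ : IsBoundedLipschitzDomain Ω) (w : H1 Ω) : ∃ γ : Hhalf Ω, IsTrace w γ :=
  have h : (w, trace Ω w) ∈ traceGraph Ω := hΩ.mem_traceGraph_iff.2 rfl
  ⟨⟨trace Ω w, (w, trace Ω w), h, rfl⟩, h⟩

theorem trace_ae_eq (hΩ : IsBoundedLipschitzDomain Ω) {w : H1 Ω} {φ : E d → ℝ}
    (hφ : ContDiff ℝ ∞ φ) (hw : fn w =ᵐ[volume.restrict Ω] φ) :
    trace Ω w =ᵐ[surface Ω] φ := by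
  have hm := hΩ.memLp_surface hφ.continuous 2
  have hmem : (w, hm.toLp φ) ∈ traceGraph Ω := subset_closure ⟨φ, hφ, hw, hm.coeFn_toLp⟩
  rw [hΩ.mem_traceGraph_iff.1 hmem]
  exact hm.coeFn_toLp

/-- The integral of the trace over the boundary, as a functional on `H^1(Ω)`. -/
def traceIntegral (hΩ : IsBoundedLipschitzDomain Ω) : H1 Ω →L[ℝ] ℝ :=
  innerSL ℝ ((hΩ.memLp_surface continuous_const 2).toLp fun _ => 1) ∘L trace Ω

theorem traceIntegral_apply (hΩ : IsBoundedLipschitzDomain Ω) (w : H1 Ω) :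
    hΩ.traceIntegral w = ∫ y, trace Ω w y ∂surface Ω :=
  inner_toLp_one _ _

theorem boundaryIntegral_eq_traceIntegral (hΩ : IsBoundedLipschitzDomain Ω) {w : H1 Ω}
    {γ : Hhalf Ω} (h : IsTrace w γ) : boundaryIntegral γ = hΩ.traceIntegral w := by
  rw [hΩ.traceIntegral_apply, hΩ.isTrace_iff.1 h, boundaryIntegral]

theorem traceIntegral_one_ne_zero (hΩ : IsBoundedLipschitzDomain Ω) (hd : d ≠ 0) :
    hΩ.traceIntegral (H1.one hΩ.isBounded) ≠ 0 := by
  have := hΩ.isFiniteMeasure_surface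
  have hone := hΩ.trace_ae_eq (φ := fun _ => 1) contDiff_const
    (H1.fn_ofContDiff hΩ.isBounded contDiff_const)
  rw [hΩ.traceIntegral_apply, H1.one, integral_congr_ae hone, integral_const, smul_eq_mul, mul_one]
  exact (measureReal_ne_zero_iff (measure_ne_top _ _)).2 (hΩ.surface_univ_ne_zero hd)

end IsBoundedLipschitzDomain

end Trace

section Pullback

theorem exists_contDiff_cutoff {K V : Set (E d)} (hK : IsCompact K) (hV : IsOpen V) (hKV : K ⊆ V) :
    ∃ χ : E d → ℝ, ContDiff ℝ ∞ χ ∧ HasCompactSupport χ ∧ EqOn χ 1 K ∧ ∀ x ∉ V, χ x = 0 := by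
  obtain ⟨L, hL, -, hKL, hLV⟩ := exists_compact_closed_between hK hV hKV
  obtain ⟨χ, hχK, hχL, -⟩ :=
    exists_contMDiffMap_one_nhds_of_subset_interior (n := ⊤) (modelWithCornersSelf ℝ (E d))
      hK.isClosed hKL
  exact ⟨χ, χ.contMDiff.contDiff, .intro hL hχL, fun x hx => hχK.self_of_nhdsSet x hx,
    fun x hx => hχL x fun h => hx (hLV h)⟩

namespace H1

variable {Ω : Set (E d)}

theorem continuous_of_fn_grad {X : Type*} [TopologicalSpace X] {f : X → H1 Ω}
    (h : Continuous fun x => fn (f x)) (h' : Continuous fun x => grad (f x)) : Continuous f :=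
  continuous_induced_rng.2 ((WithLp.prod_continuous_toLp 2 _ _).comp (h.prodMk h'))

theorem continuous_testSMul {χ : E d → ℝ} (hχ : ContDiff ℝ ∞ χ) (hc : HasCompactSupport χ) :
    Continuous (testSMul hχ hc : H1 Ω → H1 Ω) := by
  have hχm : MemLp χ ⊤ (volume.restrict Ω) :=
    (hχ.continuous.memLp_of_hasCompactSupport hc).restrict Ω
  have hgm : MemLp (gradient χ) ⊤ (volume.restrict Ω) := memLp_gradient_of_hasCompactSupport hχ hc ⊤
  have hA := ((ContinuousLinearMap.lsmul ℝ ℝ : ℝ →L[ℝ] ℝ →L[ℝ] ℝ).comp_memLp' hχm)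
  have hB := ((ContinuousLinearMap.lsmul ℝ ℝ : ℝ →L[ℝ] E d →L[ℝ] E d).comp_memLp' hχm)
  have hC := ((ContinuousLinearMap.lsmul ℝ ℝ : ℝ →L[ℝ] E d →L[ℝ] E d).flip.comp_memLp' hgm)
  refine continuous_of_fn_grad
    (((lpMul (hA.toLp _)).comp (fnL Ω)).continuous.congr fun w => Lp.ext ?_)
    (((lpMul (hB.toLp _)).comp (gradL Ω) + (lpMul (hC.toLp _)).comp (fnL Ω)).continuous.congr
      fun w => Lp.ext ?_)
  · filter_upwards [coeFn_lpMul (hA.toLp _) (fn w), hA.coeFn_toLp, fn_testSMul hχ hc w]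
      with x h1 h2 h3
    exact h1.trans ((congrArg (· (fn w x)) h2).trans h3.symm)
  · filter_upwards [Lp.coeFn_add (lpMul (hB.toLp _) (grad w)) (lpMul (hC.toLp _) (fn w)),
      coeFn_lpMul (hB.toLp _) (grad w), hB.coeFn_toLp, coeFn_lpMul (hC.toLp _) (fn w),
      hC.coeFn_toLp, grad_testSMul hχ hc w] with x h h1 h2 h3 h4 h5
    refine h.trans ?_
    rw [Pi.add_apply, h1, h2, h3, h4, h5]
    rfl

end H1

theorem IsBoundedLipschitzDomain.trace_testSMul {Ω : Set (E d)} (hΩ : IsBoundedLipschitzDomain Ω)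
    {χ : E d → ℝ} (hχ : ContDiff ℝ ∞ χ) (hc : HasCompactSupport χ) (h1 : EqOn χ 1 (frontier Ω))
    (w : H1 Ω) : trace Ω (H1.testSMul hχ hc w) = trace Ω w := by
  refine congrFun (Continuous.ext_on hΩ.dense_smoothFns
    ((trace Ω).continuous.comp (H1.continuous_testSMul hχ hc)) (trace Ω).continuous
    fun w hw => ?_) w
  refine hw.elim fun φ hφ => Lp.ext ?_
  have hχφ : fn (H1.testSMul hχ hc w) =ᵐ[volume.restrict Ω] fun x => χ x • φ x := by
    filter_upwards [H1.fn_testSMul hχ hc w, hφ.2] with x h h'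
    rw [h, h']
  filter_upwards [hΩ.trace_ae_eq (hχ.smul hφ.1) hχφ, hΩ.trace_ae_eq hφ.1 hφ.2,
    ae_restrict_mem isClosed_frontier.measurableSet] with x h h' hx
  exact h.trans (by rw [Pi.smul_apply', h1 hx, h', Pi.one_apply, one_smul])

/-- `T` is a bi-Lipschitz homeomorphism that maps `Ω` onto itself and is the identity near `∂Ω`. -/
structure FixesBoundary (Ω : Set (E d)) (T : E d ≃ₜ E d) : Prop where
  lipschitz : ∃ K, LipschitzWith K T
  lipschitz_symm : ∃ K, LipschitzWith K T.symm
  eventually_eq : ∀ᶠ x in 𝓝ˢ (frontier Ω), T x = x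
  mem_iff : ∀ x, T x ∈ Ω ↔ x ∈ Ω

theorem volume_image_le_of_lipschitzWith {K : ℝ≥0} {S : E d → E d} (hS : LipschitzWith K S)
    (A : Set (E d)) : volume (S '' A) ≤ (K : ℝ≥0∞) ^ d * volume A := by
  simpa only [EuclideanSpace.euclideanHausdorffMeasure_eq_volume]
    using euclideanHausdorffMeasure_image_le hS d A

namespace FixesBoundary

variable {Ω : Set (E d)} {T : E d ≃ₜ E d}

theorem symm (hT : FixesBoundary Ω T) : FixesBoundary Ω T.symm where
  lipschitz := hT.lipschitz_symm
  lipschitz_symm := hT.lipschitz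
  eventually_eq := hT.eventually_eq.mono fun x hx => by rw [T.symm_apply_eq, hx]
  mem_iff x := by rw [← hT.mem_iff, T.apply_symm_apply]

theorem exists_map_le (hT : FixesBoundary Ω T) :
    ∃ c : ℝ≥0, (volume.restrict Ω).map T ≤ c • volume.restrict Ω := by
  obtain ⟨K, hK⟩ := hT.lipschitz_symm
  refine ⟨K ^ d, Measure.le_iff.2 fun B hB => ?_⟩
  have h : T ⁻¹' B ∩ Ω = T.symm '' (B ∩ Ω) := by
    ext x
    simp [T.image_symm, hT.mem_iff]
  rw [Measure.map_apply T.measurable hB, Measure.restrict_apply (T.measurable hB),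
    Measure.smul_apply, Measure.restrict_apply hB, h, ENNReal.smul_def, ENNReal.coe_pow,
    smul_eq_mul]
  exact volume_image_le_of_lipschitzWith hK _

theorem quasiMeasurePreserving (hT : FixesBoundary Ω T) :
    Measure.QuasiMeasurePreserving T (volume.restrict Ω) (volume.restrict Ω) :=
  hT.exists_map_le.elim fun _ hc => ⟨T.measurable, Measure.absolutelyContinuous_of_le_smul hc⟩

/-- Composition with `T` on `L²(Ω)`. -/
def lpComp {F : Type*} [NormedAddCommGroup F] [NormedSpace ℝ F] (hT : FixesBoundary Ω T) :
    Lp F 2 (volume.restrict Ω) →L[ℝ] Lp F 2 (volume.restrict Ω) :=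
  EIT.lpComp T.measurable hT.exists_map_le.choose_spec

theorem memLp_adjoint_fderiv (hT : FixesBoundary Ω T) :
    MemLp (fun x => ContinuousLinearMap.adjoint (fderiv ℝ T x)) ⊤ (volume.restrict Ω) := by
  obtain ⟨K, hK⟩ := hT.lipschitz
  refine memLp_top_of_bound ((ContinuousLinearMap.adjoint (𝕜 := ℝ) (E := E d)
    (F := E d)).continuous.comp_aestronglyMeasurable (measurable_fderiv ℝ T).aestronglyMeasurable)
    K (ae_of_all _ fun x => ?_)
  rw [LinearIsometryEquiv.norm_map]
  exact norm_fderiv_le_of_lipschitz ℝ hK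

/-- The pullback `G ↦ DTᵀ (G ∘ T)` of gradient fields. -/
def gradPullback (hT : FixesBoundary Ω T) :
    Lp (E d) 2 (volume.restrict Ω) →L[ℝ] Lp (E d) 2 (volume.restrict Ω) :=
  lpMul hT.memLp_adjoint_fderiv.toLp ∘L hT.lpComp

theorem coeFn_lpComp {F : Type*} [NormedAddCommGroup F] [NormedSpace ℝ F]
    (hT : FixesBoundary Ω T) (f : Lp F 2 (volume.restrict Ω)) :
    hT.lpComp f =ᵐ[volume.restrict Ω] f ∘ T :=
  EIT.coeFn_lpComp _ _ f

theorem coeFn_gradPullback (hT : FixesBoundary Ω T) (G : Lp (E d) 2 (volume.restrict Ω)) :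
    hT.gradPullback G =ᵐ[volume.restrict Ω]
      fun x => ContinuousLinearMap.adjoint (fderiv ℝ T x) (G (T x)) := by
  filter_upwards [coeFn_lpMul hT.memLp_adjoint_fderiv.toLp (hT.lpComp G),
    hT.memLp_adjoint_fderiv.coeFn_toLp, hT.coeFn_lpComp G] with x h1 h2 h3
  exact h1.trans (by rw [h2, h3, Function.comp_apply])

theorem hasWeakFDeriv_comp_of_contDiff (hT : FixesBoundary Ω T) {φ : E d → ℝ} (hφ : ContDiff ℝ 1 φ)
    (hc : HasCompactSupport φ) : HasWeakFDeriv Ω (φ ∘ T)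
      fun x => innerSL ℝ (ContinuousLinearMap.adjoint (fderiv ℝ T x) (gradient φ (T x))) := by
  obtain ⟨K, hK⟩ := hT.lipschitz
  obtain ⟨C, hC⟩ := hφ.lipschitzWith_of_hasCompactSupport hc one_ne_zero
  refine (hasWeakFDeriv_of_lipschitzWith_real (hC.comp hK) Ω).congr EventuallyEq.rfl
    (ae_restrict_of_ae ?_)
  filter_upwards [hK.ae_differentiableAt (μ := volume)] with x hx
  rw [fderiv_comp x (hφ.differentiable one_ne_zero _) hx]
  ext v
  simp [ContinuousLinearMap.adjoint_inner_left, inner_gradient_left]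

theorem hasWeakFDeriv_pullback_of_mem_smoothFns (hΩ : IsBoundedLipschitzDomain Ω)
    (hT : FixesBoundary Ω T) {w : H1 Ω} (hw : w ∈ H1.smoothFns Ω) :
    HasWeakFDeriv Ω (hT.lpComp (fn w)) fun x => innerSL ℝ (hT.gradPullback (grad w) x) := by
  refine hw.elim fun φ₀ hφ₀ => ?_
  obtain ⟨χ, hχ, hc, h1, -⟩ :=
    exists_contDiff_cutoff hΩ.isBounded.isCompact_closure isOpen_univ (subset_univ _)
  have hφ : ContDiff ℝ 1 fun x => χ x * φ₀ x := (hχ.mul hφ₀.1).of_le (by simp)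
  have hfn : fn w =ᵐ[volume.restrict Ω] fun x => χ x * φ₀ x := by
    filter_upwards [hφ₀.2, ae_restrict_mem hΩ.isOpen.measurableSet] with x h h'
    rw [h, h1 (subset_closure h'), Pi.one_apply, one_mul]
  have hgrad : grad w =ᵐ[volume.restrict Ω] gradient fun x => χ x * φ₀ x :=
    (H1.ext_fn hΩ.isOpen (hfn.trans (H1.fn_ofContDiff hΩ.isBounded hφ).symm) :
      w = H1.ofContDiff hΩ.isBounded hφ) ▸ H1.grad_ofContDiff hΩ.isBounded hφ
  refine (hT.hasWeakFDeriv_comp_of_contDiff hφ hc.mul_right).congr ?_ ?_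
  · filter_upwards [hT.quasiMeasurePreserving.ae hfn, hT.coeFn_lpComp (fn w)] with x h h'
    rw [h', Function.comp_apply, Function.comp_apply, h]
  · filter_upwards [hT.quasiMeasurePreserving.ae hgrad, hT.coeFn_gradPullback (grad w)]
      with x h h'
    rw [h', h]

theorem hasWeakFDeriv_pullback (hΩ : IsBoundedLipschitzDomain Ω) (hT : FixesBoundary Ω T)
    (w : H1 Ω) :
    HasWeakFDeriv Ω (hT.lpComp (fn w)) fun x => innerSL ℝ (hT.gradPullback (grad w) x) := by
  have hcont : Continuous fun w : H1 Ω =>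
      WithLp.toLp 2 (hT.lpComp (fn w), hT.gradPullback (grad w)) :=
    (WithLp.prod_continuous_toLp 2 _ _).comp
      ((hT.lpComp ∘L H1.fnL Ω).continuous.prodMk (hT.gradPullback ∘L H1.gradL Ω).continuous)
  exact ((H1.isClosed Ω).preimage hcont).closure_subset_iff.2
    (fun w hw => hT.hasWeakFDeriv_pullback_of_mem_smoothFns hΩ hw) (hΩ.dense_smoothFns w)

/-- The composition `w ∘ T`, as an element of `H^1(Ω)`. -/
def pullback (hΩ : IsBoundedLipschitzDomain Ω) (hT : FixesBoundary Ω T) (w : H1 Ω) : H1 Ω :=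
  H1.mk (Lp.memLp _) (Lp.memLp _) (hT.hasWeakFDeriv_pullback hΩ w)

theorem fn_pullback (hΩ : IsBoundedLipschitzDomain Ω) (hT : FixesBoundary Ω T) (w : H1 Ω) :
    fn (hT.pullback hΩ w) =ᵐ[volume.restrict Ω] fn w ∘ T :=
  (H1.fn_mk _ _ (hT.hasWeakFDeriv_pullback hΩ w)).trans (hT.coeFn_lpComp _)

theorem grad_pullback (hΩ : IsBoundedLipschitzDomain Ω) (hT : FixesBoundary Ω T) (w : H1 Ω) :
    grad (hT.pullback hΩ w) =ᵐ[volume.restrict Ω]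
      fun x => ContinuousLinearMap.adjoint (fderiv ℝ T x) (grad w (T x)) :=
  (H1.grad_mk _ _ (hT.hasWeakFDeriv_pullback hΩ w)).trans (hT.coeFn_gradPullback _)

theorem pullback_pullback_symm (hΩ : IsBoundedLipschitzDomain Ω) (hT : FixesBoundary Ω T)
    (w : H1 Ω) : hT.pullback hΩ (hT.symm.pullback hΩ w) = w := by
  refine H1.ext_fn hΩ.isOpen ((hT.fn_pullback hΩ _).trans ?_)
  filter_upwards [hT.quasiMeasurePreserving.ae (hT.symm.fn_pullback hΩ w)] with x hx
  rw [Function.comp_apply, hx, Function.comp_apply, T.symm_apply_apply]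

theorem exists_cutoff (hΩ : IsBoundedLipschitzDomain Ω) (hT : FixesBoundary Ω T) :
    ∃ χ : E d → ℝ, ContDiff ℝ ∞ χ ∧ HasCompactSupport χ ∧ EqOn χ 1 (frontier Ω) ∧
      ∀ x, T x = x ∨ χ x = 0 := by
  obtain ⟨V, hV, hFV, hTV⟩ := mem_nhdsSet_iff_exists.1 hT.eventually_eq
  obtain ⟨χ, hχ, hc, h1, h0⟩ := exists_contDiff_cutoff hΩ.isCompact_frontier hV hFV
  exact ⟨χ, hχ, hc, h1, fun x => (em (x ∈ V)).imp (fun h => hTV h) (h0 x)⟩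

theorem testSMul_pullback (hΩ : IsBoundedLipschitzDomain Ω) (hT : FixesBoundary Ω T)
    {χ : E d → ℝ} (hχ : ContDiff ℝ ∞ χ) (hc : HasCompactSupport χ)
    (h0 : ∀ x, T x = x ∨ χ x = 0) (w : H1 Ω) :
    H1.testSMul hχ hc (hT.pullback hΩ w) = H1.testSMul hχ hc w := by
  refine H1.ext_fn hΩ.isOpen ?_
  filter_upwards [H1.fn_testSMul hχ hc (hT.pullback hΩ w), H1.fn_testSMul hχ hc w,
    hT.fn_pullback hΩ w] with x h h' hw
  rw [h, h', hw, Function.comp_apply]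
  rcases h0 x with hx | hx
  · rw [hx]
  · rw [hx, zero_smul, zero_smul]

theorem trace_pullback (hΩ : IsBoundedLipschitzDomain Ω) (hT : FixesBoundary Ω T) (w : H1 Ω) :
    trace Ω (hT.pullback hΩ w) = trace Ω w :=
  (hT.exists_cutoff hΩ).elim fun _ ⟨hχ, hc, h1, h0⟩ => by
    rw [← hΩ.trace_testSMul hχ hc h1, hT.testSMul_pullback hΩ hχ hc h0,
      hΩ.trace_testSMul hχ hc h1]

end FixesBoundary

end Pullback

section Deformation

theorem FixesBoundary.setIntegral_comp {Ω : Set (E d)} {T : E d ≃ₜ E d} (hT : FixesBoundary Ω T)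
    (hΩ : IsOpen Ω) (g : E d → ℝ) :
    ∫ x in Ω, |(fderiv ℝ T x).det| * g (T x) = ∫ x in Ω, g x := by
  obtain ⟨K, hK⟩ := hT.lipschitz
  set D := {x | DifferentiableAt ℝ T x}
  have hD : MeasurableSet D := measurableSet_of_differentiableAt ℝ T
  have hD0 : volume Dᶜ = 0 := hK.ae_differentiableAt (μ := volume)
  have hTD : volume (T '' Dᶜ) = 0 :=
    le_antisymm ((volume_image_le_of_lipschitzWith hK Dᶜ).trans (by rw [hD0, mul_zero])) zero_le
  have hTΩ : T '' Ω = Ω := by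
    ext x
    rw [T.image_eq_preimage_symm, mem_preimage, hT.symm.mem_iff]
  have hΩD : (Ω ∩ D : Set (E d)) =ᵐ[volume] Ω := by
    simpa only [inter_univ] using (ae_eq_refl Ω).inter (ae_eq_univ.2 hD0)
  have himage : (T '' (Ω ∩ D) : Set (E d)) =ᵐ[volume] Ω := by
    rw [image_inter T.injective, hTΩ]
    rw [T.image_compl] at hTD
    simpa only [inter_univ] using (ae_eq_refl Ω).inter (ae_eq_univ.2 hTD)
  have h := integral_image_eq_integral_abs_det_fderiv_smul volume (hΩ.measurableSet.inter hD)
    (fun x hx => (show DifferentiableAt ℝ T x from hx.2).hasFDerivAt.hasFDerivWithinAt)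
    T.injective.injOn g
  rw [setIntegral_congr_set himage, setIntegral_congr_set hΩD] at h
  exact h.symm

variable {U : E d → E d} {K : ℝ≥0} {t : ℝ}

theorem antilipschitzWith_Phi (hU : LipschitzWith K U) (ht : ‖t‖₊ * K < 1) :
    AntilipschitzWith (1⁻¹ - ‖t‖₊ * K)⁻¹ (Phi U t) :=
  AntilipschitzWith.id.add_lipschitzWith ((lipschitzWith_smul t).comp hU) (by rwa [inv_one])

theorem exists_homeomorph_Phi (hU : LipschitzWith K U) (ht : ‖t‖₊ * K < 1) :
    ∃ T : E d ≃ₜ E d, ⇑T = Phi U t := by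
  have h : ApproximatesLinearOn (Phi U t)
      ((ContinuousLinearEquiv.refl ℝ (E d) : E d ≃L[ℝ] E d) : E d →L[ℝ] E d) univ (‖t‖₊ * K) :=
    ApproximatesLinearOn.approximatesLinearOn_iff_lipschitzOnWith.2 <| by
      convert! ((lipschitzWith_smul t).comp hU).lipschitzOnWith (s := univ) using 1
      exact funext fun x => add_sub_cancel_left x _
  refine ⟨h.toHomeomorph (Phi U t) ?_, rfl⟩
  rcases subsingleton_or_nontrivial (E d) with hE | hE
  · exact .inl hE
  right
  have hnorm : ‖((ContinuousLinearEquiv.refl ℝ (E d)).symm : E d →L[ℝ] E d)‖₊ = 1 :=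
    NNReal.coe_injective ContinuousLinearMap.norm_id
  rwa [hnorm, inv_one]

theorem inter_frontier_nonempty {X : Type*} [TopologicalSpace X] {S A : Set X}
    (hS : IsPreconnected S) (h : (S ∩ A).Nonempty) (h' : (S ∩ Aᶜ).Nonempty) :
    (S ∩ frontier A).Nonempty := by
  by_contra hne
  have hcover : ∀ x ∈ S, x ∈ interior A ∨ x ∈ interior Aᶜ := fun x hx => by
    by_contra! hcon
    rw [interior_compl, notMem_compl_iff] at hcon
    exact hne ⟨x, hx, hcon.2, hcon.1⟩
  obtain ⟨x, hxS, hxA⟩ := h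
  obtain ⟨y, hyS, hyA⟩ := h'
  obtain ⟨z, -, hz, hz'⟩ := hS (interior A) (interior Aᶜ) isOpen_interior isOpen_interior hcover
    ⟨x, hxS, (hcover x hxS).resolve_right fun h => interior_subset h hxA⟩
    ⟨y, hyS, (hcover y hyS).resolve_left fun h => hyA (interior_subset h)⟩
  exact interior_subset hz' (interior_subset hz)

theorem Phi_mem_iff {Ω : Set (E d)} (hU : LipschitzWith K U) (ht : ‖t‖₊ * K < 1)
    (hU0 : ∀ x ∈ frontier Ω, U x = 0) (x : E d) : Phi U t x ∈ Ω ↔ x ∈ Ω := by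
  suffices hx : x ∉ frontier Ω → (Phi U t x ∈ Ω ↔ x ∈ Ω) by
    by_cases h : x ∈ frontier Ω
    · rw [Phi, hU0 x h, smul_zero, add_zero]
    · exact hx h
  intro hx
  -- `Φ_s` is injective and fixes `∂Ω`, so the path `s ↦ Φ_s(x)` does not meet `∂Ω`.
  have hpath : ¬ (segment ℝ x (Phi U t x) ∩ frontier Ω).Nonempty := by
    rintro ⟨y, hy, hyΩ⟩
    rw [segment_eq_image', Phi, add_sub_cancel_left] at hy
    obtain ⟨s, hs, rfl⟩ := hy
    have hst : ‖s * t‖₊ * K < 1 := by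
      refine lt_of_le_of_lt ?_ ht
      gcongr
      rw [nnnorm_mul]
      refine mul_le_of_le_one_left zero_le (NNReal.coe_le_coe.1 ?_)
      rw [coe_nnnorm, Real.norm_of_nonneg hs.1]
      exact hs.2
    refine hx ((antilipschitzWith_Phi hU hst).injective (?_ : _ = Phi U (s * t) x) ▸ hyΩ)
    simp only [Phi, hU0 _ hyΩ, smul_zero, add_zero, mul_smul]
  have hpre := (convex_segment x (Phi U t x)).isPreconnected
  by_contra hne
  by_cases hxΩ : x ∈ Ω
  · exact hpath (inter_frontier_nonempty hpre ⟨x, left_mem_segment .., hxΩ⟩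
      ⟨_, right_mem_segment .., fun h => hne (iff_of_true h hxΩ)⟩)
  · exact hpath (inter_frontier_nonempty hpre
      ⟨_, right_mem_segment .., by tauto⟩ ⟨x, left_mem_segment .., hxΩ⟩)

theorem fixesBoundary_of_eq_Phi {Ω : Set (E d)} (hU : LipschitzWith K U) (ht : ‖t‖₊ * K < 1)
    (hU0 : ∀ᶠ x in 𝓝ˢ (frontier Ω), U x = 0) {T : E d ≃ₜ E d} (hT : ⇑T = Phi U t) :
    FixesBoundary Ω T where
  lipschitz := hT ▸ ⟨_, LipschitzWith.id.add ((lipschitzWith_smul t).comp hU)⟩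
  lipschitz_symm := ⟨_, (hT ▸ antilipschitzWith_Phi hU ht).to_rightInverse T.apply_symm_apply⟩
  eventually_eq := hU0.mono fun x hx => by rw [hT, Phi, hx, smul_zero, add_zero]
  mem_iff x := hT ▸ Phi_mem_iff hU ht (fun y hy => hU0.self_of_nhdsSet y hy) x

theorem IsW1Infty.eventually_exists_homeomorph {Ω : Set (E d)} {DU : E d → E d →L[ℝ] E d}
    (hU : IsW1Infty U DU) (hU0 : ∀ᶠ x in 𝓝ˢ (frontier Ω), U x = 0) :
    ∀ᶠ t : ℝ in 𝓝 0, ∃ T : E d ≃ₜ E d, ⇑T = Phi U t ∧ FixesBoundary Ω T := by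
  obtain ⟨K, hK⟩ := hU.exists_lipschitzWith
  have hcont : Tendsto (fun t : ℝ => ‖t‖₊ * K) (𝓝 0) (𝓝 0) := by
    simpa using ((continuous_nnnorm (E := ℝ)).tendsto 0).mul_const K
  filter_upwards [hcont.eventually (gt_mem_nhds one_pos)] with t ht
  exact (exists_homeomorph_Phi hK ht).imp fun T hT => ⟨hT, fixesBoundary_of_eq_Phi hK ht hU0 hT⟩

theorem IsW1Infty.ae_fderiv_eq {DU : E d → E d →L[ℝ] E d} (hU : IsW1Infty U DU)
    {T : E d ≃ₜ E d} (hT : ⇑T = Phi U t) : ∀ᵐ x, fderiv ℝ T x = 1 + t • DU x := by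
  filter_upwards [hU.ae_hasFDerivAt] with x hx
  exact hT ▸ ((hasFDerivAt_id x).add (hx.const_smul t)).fderiv

theorem transported_Phi (h : Function.Injective (Phi U t)) (σ : E d → ℝ) (x : E d) :
    transported U σ t (Phi U t x) = σ x :=
  congrArg σ (Function.leftInverse_invFun h x)

end Deformation

section StarAlgebra

theorem isUnit_one_add {R : Type*} [NormedRing R] [CompleteSpace R] {M : R} (hM : ‖M‖ < 1) :
    IsUnit (1 + M) := by
  simpa only [sub_neg_eq_add] using isUnit_one_sub_of_norm_lt_one (x := -M) (by rwa [norm_neg])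

theorem hasFDerivAt_inverse_one_add {R : Type*} [NormedRing R] [NormedAlgebra ℝ R]
    [CompleteSpace R] :
    HasFDerivAt (fun M : R => Ring.inverse (1 + M)) (-ContinuousLinearMap.id ℝ R) 0 := by
  have h := hasFDerivAt_ringInverse (𝕜 := ℝ) (1 : Rˣ)
  rw [Units.val_one, ← add_zero (1 : R)] at h
  convert! h.comp 0 ((hasFDerivAt_id (0 : R)).const_add 1) using 1
  ext M
  simp

variable {R : Type*} [NormedRing R] [StarRing R]

theorem mul_inverse_mul_star_inverse_mul_star {A : R} (hA : IsUnit A) :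
    A * (Ring.inverse A * star (Ring.inverse A)) * star A = 1 := by
  rw [← mul_assoc, Ring.mul_inverse_cancel _ hA, one_mul, ← star_mul, Ring.mul_inverse_cancel _ hA,
    star_one]

variable [CompleteSpace R] [NormedStarGroup R]

theorem hasFDerivAt_inverse_mul_star_inverse [NormedAlgebra ℝ R] [StarModule ℝ R] :
    HasFDerivAt (fun M : R => Ring.inverse (1 + M) * star (Ring.inverse (1 + M)))
      (-(ContinuousLinearMap.id ℝ R + ((starL' ℝ : R ≃L[ℝ] R) : R →L[ℝ] R))) 0 := by
  have hinv := hasFDerivAt_inverse_one_add (R := R)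
  convert! hinv.mul' ((starL' ℝ : R ≃L[ℝ] R).hasFDerivAt.comp 0 hinv) using 1
  ext M
  simp

theorem continuousAt_inverse_mul_star_inverse {M : R} (hM : IsUnit (1 + M)) :
    ContinuousAt (fun M : R => Ring.inverse (1 + M) * star (Ring.inverse (1 + M))) M := by
  have hinv : ContinuousAt (fun M : R => Ring.inverse (1 + M)) M :=
    ContinuousAt.comp (g := Ring.inverse) (NormedRing.inverse_continuousAt hM.unit)
      (continuous_const_add (1 : R)).continuousAt
  exact hinv.mul hinv.star

end StarAlgebra

section PulledMatrix

theorem differentiable_det : Differentiable ℝ fun M : E d →L[ℝ] E d => M.det := by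
  let b := (EuclideanSpace.basisFun (Fin d) ℝ).toBasis
  let entry : Fin d → Fin d → (E d →L[ℝ] E d) →L[ℝ] ℝ := fun i j =>
    LinearMap.toContinuousLinearMap
      (Matrix.entryLinearMap ℝ ℝ i j ∘ₗ (LinearMap.toMatrix b b).toLinearMap ∘ₗ
        ContinuousLinearMap.coeLM ℝ)
  have h : (fun M : E d →L[ℝ] E d => M.det) =
      fun M => ∑ τ : Equiv.Perm (Fin d), (Equiv.Perm.sign τ : ℤ) • ∏ i, entry (τ i) i M := by
    ext M
    rw [ContinuousLinearMap.det, ← LinearMap.det_toMatrix b, Matrix.det_apply]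
    rfl
  rw [h]
  exact Differentiable.fun_sum fun τ _ => Differentiable.fun_const_smul
    ((contDiff_prod (n := 1) fun i _ => (entry (τ i) i).contDiff).differentiable one_ne_zero) _

theorem hasDerivAt_det_one_add_smul (M : E d →L[ℝ] E d) :
    HasDerivAt (fun s : ℝ => (1 + s • M).det) (LinearMap.trace ℝ (E d) (M : E d →ₗ[ℝ] E d)) 0 := by
  let b := (EuclideanSpace.basisFun (Fin d) ℝ).toBasis
  let A := LinearMap.toMatrix b b (M : E d →ₗ[ℝ] E d)
  let p := (1 + (Polynomial.X : Polynomial ℝ) • A.map ⇑Polynomial.C).det.divX.divX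
  have h : (fun s : ℝ => (1 + s • M).det) = fun s => 1 + A.trace * s + p.eval s * s ^ 2 := by
    ext s
    rw [← Matrix.det_one_add_smul, ContinuousLinearMap.det, ← LinearMap.det_toMatrix b,
      ContinuousLinearMap.toLinearMap_add, ContinuousLinearMap.toLinearMap_smul, map_add, map_smul,
      ContinuousLinearMap.toLinearMap_one, LinearMap.toMatrix_one]
  rw [h, LinearMap.trace_eq_matrix_trace ℝ b]
  convert! (((hasDerivAt_id (0 : ℝ)).const_mul A.trace).const_add 1).add
    ((p.hasDerivAt 0).mul (hasDerivAt_pow 2 (0 : ℝ))) using 1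
  simp [A]

/-- The trace of an endomorphism, as a continuous linear functional. -/
def traceL (d : ℕ) : (E d →L[ℝ] E d) →L[ℝ] ℝ :=
  LinearMap.toContinuousLinearMap (LinearMap.trace ℝ (E d) ∘ₗ ContinuousLinearMap.coeLM ℝ)

theorem hasFDerivAt_det_one_add :
    HasFDerivAt (fun M : E d →L[ℝ] E d => (1 + M).det) (traceL d) 0 := by
  have hdet : HasFDerivAt (fun M : E d →L[ℝ] E d => (1 + M).det) _ 0 :=
    ((differentiable_det.comp ((differentiable_const 1).add differentiable_id)) 0).hasFDerivAt
  convert! hdet using 1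
  ext M
  have hline : HasDerivAt (fun s : ℝ => s • M) M 0 := by
    simpa only [id_eq, one_smul] using (hasDerivAt_id (0 : ℝ)).smul_const M
  rw [← zero_smul ℝ M] at hdet
  have h := hdet.comp_hasDerivAt (0 : ℝ) hline
  rw [zero_smul] at h
  exact (hasDerivAt_det_one_add_smul M).unique h

/-- The coefficient matrix of the Dirichlet form pulled back by a map with Jacobian `1 + M`. -/
def pulledMatrix (M : E d →L[ℝ] E d) : E d →L[ℝ] E d :=
  |(1 + M).det| • (Ring.inverse (1 + M) * star (Ring.inverse (1 + M)))

theorem det_one : (1 : E d →L[ℝ] E d).det = 1 :=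
  LinearMap.det_id

theorem pulledMatrix_zero : pulledMatrix (0 : E d →L[ℝ] E d) = 1 := by
  simp [pulledMatrix, det_one]

/-- The linear map `M ↦ tr(M) I - (M + Mᵀ)`, so that `𝒜 = pulledMatrixDeriv ∘ DU`. -/
def pulledMatrixDeriv (d : ℕ) : (E d →L[ℝ] E d) →L[ℝ] (E d →L[ℝ] E d) :=
  (traceL d).smulRight (1 : E d →L[ℝ] E d) - (ContinuousLinearMap.id ℝ (E d →L[ℝ] E d)
    + ((starL' ℝ : (E d →L[ℝ] E d) ≃L[ℝ] (E d →L[ℝ] E d)) :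
        (E d →L[ℝ] E d) →L[ℝ] (E d →L[ℝ] E d)))

theorem calA_eq (DU : E d → E d →L[ℝ] E d) : calA DU = fun x => pulledMatrixDeriv d (DU x) :=
  rfl

theorem hasFDerivAt_abs_det_one_add :
    HasFDerivAt (fun M : E d →L[ℝ] E d => |(1 + M).det|) (traceL d) 0 := by
  have h0 : (0 : ℝ) < (1 + (0 : E d →L[ℝ] E d)).det := by
    rw [add_zero, det_one]
    exact one_pos
  refine hasFDerivAt_det_one_add.congr_of_eventuallyEq ?_
  filter_upwards [hasFDerivAt_det_one_add.continuousAt.eventually (lt_mem_nhds h0)] with M hM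
  exact abs_of_pos hM

theorem hasFDerivAt_pulledMatrix :
    HasFDerivAt (pulledMatrix (d := d)) (pulledMatrixDeriv d) 0 := by
  convert! hasFDerivAt_abs_det_one_add.smul hasFDerivAt_inverse_mul_star_inverse using 1
  · ext1 M
    simp only [pulledMatrixDeriv, sub_apply, ContinuousLinearMap.smulRight_apply, add_apply,
      ContinuousLinearMap.id_apply, ContinuousLinearEquiv.coe_coe, starL'_apply, add_zero, det_one,
      abs_one, neg_add_rev, smul_add, smul_neg, one_smul, Ring.inverse_one, star_one, mul_one,
      neg_apply]
    abel
  · infer_instance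

theorem continuousAt_pulledMatrix {M : E d →L[ℝ] E d} (hM : ‖M‖ < 1) :
    ContinuousAt pulledMatrix M :=
  ((ContinuousLinearMap.continuous_det.comp (continuous_const_add 1)).continuousAt.abs).smul
    (continuousAt_inverse_mul_star_inverse (isUnit_one_add hM))

theorem inner_pulledMatrix {M : E d →L[ℝ] E d} (hM : ‖M‖ < 1) (p q : E d) :
    ⟪pulledMatrix M (ContinuousLinearMap.adjoint (1 + M) p),
      ContinuousLinearMap.adjoint (1 + M) q⟫ = |(1 + M).det| * ⟪p, q⟫ := by
  have hcancel := congrArg (fun A : E d →L[ℝ] E d => A p)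
    (mul_inverse_mul_star_inverse_mul_star (isUnit_one_add hM))
  rw [ContinuousLinearMap.adjoint_inner_right, ← real_inner_smul_left]
  congr 1
  exact (map_smul (1 + M) _ _).trans (congrArg _ hcancel)

end PulledMatrix

section Superposition

theorem norm_lp_top_le {α Y : Type*} [MeasurableSpace α] {μ : Measure α}
    [NormedAddCommGroup Y] {f : Lp Y ∞ μ} {C : ℝ} (hC : 0 ≤ C) (h : ∀ᵐ x ∂μ, ‖f x‖ ≤ C) :
    ‖f‖ ≤ C := by
  rw [Lp.norm_def, eLpNorm_exponent_top]
  exact ENNReal.toReal_le_of_le_ofReal hC (eLpNormEssSup_le_of_ae_bound h)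

variable {α X Y : Type*} [MeasurableSpace α] {μ : Measure α} [NormedAddCommGroup X]
  [NormedSpace ℝ X] [NormedAddCommGroup Y] {M : α → X}

theorem eventually_ae_smul_mem (hM : MemLp M ∞ μ) {s : Set X} (hs : s ∈ 𝓝 0) :
    ∀ᶠ t : ℝ in 𝓝 0, ∀ᵐ x ∂μ, t • M x ∈ s := by
  obtain ⟨r, hr, hrs⟩ := Metric.mem_nhds_iff.1 hs
  have h : Tendsto (fun t : ℝ => ‖t‖ * lpNorm M ∞ μ) (𝓝 0) (𝓝 0) := by
    simpa using ((continuous_norm (E := ℝ)).tendsto 0).mul_const (lpNorm M ∞ μ)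
  filter_upwards [h.eventually (gt_mem_nhds hr)] with t ht
  filter_upwards [ae_le_lpNorm_exponent_top hM] with x hx
  refine hrs (mem_ball_zero_iff.2 (lt_of_le_of_lt ?_ ht))
  rw [norm_smul]
  gcongr

theorem aestronglyMeasurable_comp_of_continuousOn {X Y : Type*} [TopologicalSpace X]
    [TopologicalSpace.PseudoMetrizableSpace X] [TopologicalSpace Y]
    [TopologicalSpace.PseudoMetrizableSpace Y] [SecondCountableTopology Y] [Zero Y] {M : α → X}
    {F : X → Y} {s : Set X} (hF : ContinuousOn F s) (hs : IsOpen s) (hM : AEStronglyMeasurable M μ)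
    (h : ∀ᵐ x ∂μ, M x ∈ s) : AEStronglyMeasurable (fun x => F (M x)) μ := by
  borelize X Y
  classical
  have hmeas : Measurable (s.piecewise F 0) :=
    hF.measurable_piecewise continuousOn_const hs.measurableSet
  refine (hmeas.comp_aemeasurable hM.aemeasurable).aestronglyMeasurable.congr ?_
  filter_upwards [h] with x hx
  exact piecewise_eq_of_mem _ _ _ hx

theorem eventually_memLp_top_comp_smul [SecondCountableTopology Y] {F : X → Y}
    (hF : ∀ᶠ x in 𝓝 0, ContinuousAt F x)
    (hM : MemLp M ∞ μ) : ∀ᶠ t : ℝ in 𝓝 0, MemLp (fun x => F (t • M x)) ∞ μ := by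
  have hbound : ∀ᶠ x in 𝓝 0, ‖F x‖ < ‖F 0‖ + 1 :=
    hF.self_of_nhds.norm.eventually (gt_mem_nhds (lt_add_one _))
  obtain ⟨s, hs, hso, h0⟩ := eventually_nhds_iff.1 (hF.and hbound)
  filter_upwards [eventually_ae_smul_mem hM (hso.mem_nhds h0)] with t ht
  refine memLp_top_of_bound (aestronglyMeasurable_comp_of_continuousOn
    (fun x hx => (hs x hx).1.continuousWithinAt) hso (hM.1.const_smul t) ht) (‖F 0‖ + 1) ?_
  filter_upwards [ht] with x hx
  exact (hs _ hx).2.le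

theorem hasDerivAt_superposition [NormedSpace ℝ Y] {F : X → Y} {D : X →L[ℝ] Y}
    (hF : HasFDerivAt F D 0) (hM : MemLp M ∞ μ) {A : ℝ → Lp Y ∞ μ}
    (hA : ∀ᶠ t in 𝓝 0, A t =ᵐ[μ] fun x => F (t • M x)) :
    HasDerivAt A ((D.comp_memLp' hM).toLp) 0 := by
  rw [hasDerivAt_iff_isLittleO, Asymptotics.isLittleO_iff]
  intro ε hε
  set C := lpNorm M ∞ μ
  have hC : 0 ≤ C := lpNorm_nonneg
  have hlin : ∀ᶠ y in 𝓝 0, ‖F y - F 0 - D y‖ ≤ ε / (C + 1) * ‖y‖ := by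
    simpa only [sub_zero] using hF.isLittleO.bound (show 0 < ε / (C + 1) by positivity)
  filter_upwards [eventually_ae_smul_mem hM hlin, hA] with t ht hAt
  refine norm_lp_top_le (by positivity) ?_
  filter_upwards [ht, hAt, hA.self_of_nhds, (D.comp_memLp' hM).coeFn_toLp,
    ae_le_lpNorm_exponent_top hM, Lp.coeFn_sub (A t - A 0) ((t - 0) • (D.comp_memLp' hM).toLp),
    Lp.coeFn_sub (A t) (A 0), Lp.coeFn_smul (t - 0) (D.comp_memLp' hM).toLp]
    with x hx h1 h2 h3 hMx h4 h5 h6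
  rw [h4, Pi.sub_apply, h5, Pi.sub_apply, h6, Pi.smul_apply, h1, h2, h3, sub_zero, zero_smul]
  calc ‖F (t • M x) - F 0 - t • D (M x)‖ ≤ ε / (C + 1) * ‖t • M x‖ := by
        rw [← map_smul]
        exact hx
    _ ≤ ε / (C + 1) * (‖t‖ * (C + 1)) := by
        rw [norm_smul]
        gcongr
        linarith
    _ = ε * ‖t‖ := by field_simp

end Superposition

section WeakOperator

variable {V : Type*} [NormedAddCommGroup V] [NormedSpace ℝ V]

theorem inverse_apply_apply {T : V →L[ℝ] V} (hT : IsUnit T) (w : V) : Ring.inverse T (T w) = w :=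
  congrArg (fun B : V →L[ℝ] V => B w) (Ring.inverse_mul_cancel _ hT)

theorem apply_inverse_apply {T : V →L[ℝ] V} (hT : IsUnit T) (w : V) : T (Ring.inverse T w) = w :=
  congrArg (fun B : V →L[ℝ] V => B w) (Ring.mul_inverse_cancel _ hT)

variable [CompleteSpace V]

theorem hasDerivAt_inverse_apply {T : ℝ → V →L[ℝ] V} {T' : V →L[ℝ] V} (hT : HasDerivAt T T' 0)
    (h0 : IsUnit (T 0)) (b : V) :
    HasDerivAt (fun t => Ring.inverse (T t) b)
      (-Ring.inverse (T 0) (T' (Ring.inverse (T 0) b))) 0 := by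
  obtain ⟨e, he⟩ := h0
  have h := (he ▸ hasFDerivAt_ringInverse (𝕜 := ℝ) e).comp_hasDerivAt (0 : ℝ) hT
  convert! h.clm_apply (hasDerivAt_const (0 : ℝ) b) using 1
  simp [← he]

theorem tendsto_differenceQuotient_of_apply_eq {T : ℝ → V →L[ℝ] V} {T' : V →L[ℝ] V}
    (hT : HasDerivAt T T' 0) (h0 : IsUnit (T 0)) {u : V} {v : ℝ → V}
    (hv : ∀ᶠ t in 𝓝[≠] 0, T t (v t) = T 0 u) :
    Tendsto (fun t => t⁻¹ • (v t - u)) (𝓝[≠] 0) (𝓝 (-Ring.inverse (T 0) (T' u))) := by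
  have hderiv := (hasDerivAt_inverse_apply hT h0 (T 0 u)).tendsto_slope_zero
  simp only [zero_add, inverse_apply_apply h0] at hderiv
  have hunit : ∀ᶠ t in 𝓝 0, IsUnit (T t) := hT.continuousAt.eventually (Units.isOpen.mem_nhds h0)
  refine hderiv.congr' ?_
  filter_upwards [hv, hunit.filter_mono nhdsWithin_le_nhds] with t ht htu
  rw [← ht, inverse_apply_apply htu]

end WeakOperator

section Abstract

variable {V L : Type*} [NormedAddCommGroup V] [InnerProductSpace ℝ V] [CompleteSpace V]
  [NormedAddCommGroup L] [InnerProductSpace ℝ L] [CompleteSpace L]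

/-- The operator of the bilinear form `⟪A (D v), D w⟫ + m v * m w`. The rank one term removes the
kernel of the Neumann problem. -/
def formOperator (D : V →L[ℝ] L) (m : V →L[ℝ] ℝ) (A : L →L[ℝ] L) : V →L[ℝ] V :=
  (ContinuousLinearMap.adjoint D).comp (A.comp D) + (ContinuousLinearMap.adjoint m).comp m

variable {D : V →L[ℝ] L} {m : V →L[ℝ] ℝ}

theorem inner_formOperator (A : L →L[ℝ] L) (v w : V) :
    ⟪formOperator D m A v, w⟫ = ⟪A (D v), D w⟫ + m v * m w := by
  simp [formOperator, inner_add_left, ContinuousLinearMap.adjoint_inner_left, mul_comm]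

theorem hasDerivAt_formOperator {A : ℝ → L →L[ℝ] L} {A' : L →L[ℝ] L} (hA : HasDerivAt A A' 0) :
    HasDerivAt (fun t => formOperator D m (A t))
      ((ContinuousLinearMap.adjoint D).comp (A'.comp D)) 0 := by
  have h := (hasDerivAt_const (0 : ℝ) (ContinuousLinearMap.adjoint D)).clm_comp
    (hA.clm_comp (hasDerivAt_const (0 : ℝ) D))
  convert! h.add_const ((ContinuousLinearMap.adjoint m).comp m) using 1
  simp

theorem isUnit_formOperator {A : L →L[ℝ] L} {lam : ℝ} (hlam : 0 < lam)
    (hA : ∀ G, lam * ‖G‖ ^ 2 ≤ ⟪A G, G⟫) {C : ℝ} (hC : ∀ w, ‖w‖ ≤ C * (‖D w‖ + |m w|)) :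
    IsUnit (formOperator D m A) := by
  let c : ℝ≥0 := ⟨min lam 1 / (2 * C ^ 2 + 1), by positivity⟩
  have hc : 0 < c := show 0 < min lam 1 / (2 * C ^ 2 + 1) by positivity
  refine ContinuousLinearMap.isUnit_of_forall_le_norm_inner_map _ hc fun v => ?_
  have hv : ‖v‖ ^ 2 ≤ (2 * C ^ 2 + 1) * (‖D v‖ ^ 2 + m v ^ 2) := by
    calc ‖v‖ ^ 2 ≤ (C * (‖D v‖ + |m v|)) ^ 2 := by gcongr; exact hC v
      _ = C ^ 2 * (‖D v‖ + |m v|) ^ 2 := mul_pow ..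
      _ ≤ C ^ 2 * (2 * (‖D v‖ ^ 2 + |m v| ^ 2)) := by gcongr; exact add_sq_le
      _ ≤ (2 * C ^ 2 + 1) * (‖D v‖ ^ 2 + m v ^ 2) := by
        rw [sq_abs]
        nlinarith [sq_nonneg ‖D v‖, sq_nonneg (m v)]
  calc ‖v‖ ^ 2 * c ≤ (2 * C ^ 2 + 1) * (‖D v‖ ^ 2 + m v ^ 2)
        * (min lam 1 / (2 * C ^ 2 + 1)) := by gcongr; exact le_rfl
    _ = min lam 1 * ‖D v‖ ^ 2 + min lam 1 * m v ^ 2 := by field_simp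
    _ ≤ lam * ‖D v‖ ^ 2 + 1 * m v ^ 2 := by
      gcongr
      · exact min_le_left ..
      · exact min_le_right ..
    _ ≤ ⟪formOperator D m A v, v⟫ := by
      rw [inner_formOperator, one_mul, ← sq]
      gcongr
      exact hA _
    _ ≤ ‖⟪formOperator D m A v, v⟫‖ := Real.le_norm_self _

/-- Testing the differentiated problem with an element `e` of the kernel of `D` shows that the
derivative has vanishing normalization. -/
theorem exists_derivative_of_weak_eq {A : ℝ → L →L[ℝ] L} {A' : L →L[ℝ] L}
    (hA : HasDerivAt A A' 0) {lam : ℝ} (hlam : 0 < lam) (hcoer : ∀ G, lam * ‖G‖ ^ 2 ≤ ⟪A 0 G, G⟫)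
    {C : ℝ} (hC : ∀ w, ‖w‖ ≤ C * (‖D w‖ + |m w|)) {e : V} (hDe : D e = 0) (hme : m e ≠ 0) (u : V) :
    ∃ udot : V, (∀ w, ⟪A 0 (D udot), D w⟫ = -⟪A' (D u), D w⟫) ∧ m udot = 0 ∧
      ∀ v : ℝ → V, (∀ᶠ t in 𝓝[≠] 0, (∀ w, ⟪A t (D (v t)), D w⟫ = ⟪A 0 (D u), D w⟫) ∧
        m (v t) = m u) → Tendsto (fun t => t⁻¹ • (v t - u)) (𝓝[≠] 0) (𝓝 udot) := by
  have hunit := isUnit_formOperator hlam hcoer hC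
  set udot := -Ring.inverse (formOperator D m (A 0)) (ContinuousLinearMap.adjoint D (A' (D u)))
  have hudot : ∀ w, ⟪A 0 (D udot), D w⟫ + m udot * m w = -⟪A' (D u), D w⟫ := fun w => by
    rw [← inner_formOperator, map_neg, apply_inverse_apply hunit, inner_neg_left,
      ContinuousLinearMap.adjoint_inner_left]
  have hm : m udot = 0 := by
    have h := hudot e
    rw [hDe, inner_zero_right, inner_zero_right, zero_add, neg_zero] at h
    exact (mul_eq_zero.1 h).resolve_right hme
  refine ⟨udot, fun w => ?_, hm, fun v hv =>
    tendsto_differenceQuotient_of_apply_eq (hasDerivAt_formOperator hA) hunit (hv.mono ?_)⟩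
  · rw [← hudot w, hm, zero_mul, add_zero]
  · rintro t ⟨hweak, hmean⟩
    refine ext_inner_right ℝ fun w => ?_
    rw [inner_formOperator, inner_formOperator, hweak, hmean]

end Abstract

theorem hasDerivAt_clm_comp_apply {W X Y Z : Type*} [NormedAddCommGroup W] [NormedSpace ℝ W]
    [NormedAddCommGroup X] [NormedSpace ℝ X] [NormedAddCommGroup Y] [NormedSpace ℝ Y]
    [NormedAddCommGroup Z] [NormedSpace ℝ Z] (B : Y →L[ℝ] Z) (L : W →L[ℝ] X →L[ℝ] Y)
    {a : ℝ → W} {a' : W} {t : ℝ} (ha : HasDerivAt a a' t) :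
    HasDerivAt (fun s => B.comp (L (a s))) (B.comp (L a')) t :=
  (((ContinuousLinearMap.compL ℝ X Y Z) B).comp L).hasFDerivAt.comp_hasDerivAt t ha

section MaterialDerivative

variable {α F : Type*} [MeasurableSpace α] {μ : Measure α} [NormedAddCommGroup F]
  [InnerProductSpace ℝ F] {σ : α → ℝ}

/-- Multiplication by a bounded scalar function, as an operator on `L²`. -/
def lpSMul (hσ : MemLp σ ∞ μ) : Lp F 2 μ →L[ℝ] Lp F 2 μ :=
  (ContinuousLinearMap.lsmul ℝ ℝ : ℝ →L[ℝ] F →L[ℝ] F).holderL μ ∞ 2 2 hσ.toLp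

theorem coeFn_lpSMul (hσ : MemLp σ ∞ μ) (f : Lp F 2 μ) : lpSMul hσ f =ᵐ[μ] fun x => σ x • f x := by
  filter_upwards [ContinuousLinearMap.coeFn_holder (r := 2)
    (ContinuousLinearMap.lsmul ℝ ℝ : ℝ →L[ℝ] F →L[ℝ] F) hσ.toLp f, hσ.coeFn_toLp] with x h1 h2
  exact h1.trans (by rw [h2]; rfl)

theorem inner_lpSMul (hσ : MemLp σ ∞ μ) {f g : Lp F 2 μ} {f' : α → F} (hf : f =ᵐ[μ] f') :
    ⟪lpSMul hσ f, g⟫ = ∫ x, σ x * ⟪f' x, g x⟫ ∂μ := by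
  rw [L2.inner_def]
  refine integral_congr_ae ?_
  filter_upwards [coeFn_lpSMul hσ f, hf] with x h1 h2
  rw [h1, h2, real_inner_smul_left]

theorem mul_sq_norm_le_inner_lpSMul (hσ : MemLp σ ∞ μ) {lam : ℝ} (hlam : ∀ᵐ x ∂μ, lam ≤ σ x)
    (f : Lp F 2 μ) : lam * ‖f‖ ^ 2 ≤ ⟪lpSMul hσ f, f⟫ := by
  rw [← real_inner_self_eq_norm_sq, L2.inner_def, L2.inner_def, ← integral_const_mul]
  refine integral_mono_ae ((L2.integrable_inner f f).const_mul lam) (L2.integrable_inner _ f) ?_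
  filter_upwards [coeFn_lpSMul hσ f, hlam] with x h1 h2
  rw [h1, real_inner_smul_left]
  exact mul_le_mul_of_nonneg_right h2 real_inner_self_nonneg

variable {Ω : Set (E d)} {U : E d → E d} {DU : E d → E d →L[ℝ] E d}

theorem IsNeumannSolution.setIntegral_pulledMatrix {σ : E d → ℝ} (hΩ : IsBoundedLipschitzDomain Ω)
    (hU : IsW1Infty U DU) {t : ℝ} (ht : ∀ᵐ x, ‖t • DU x‖ < 1) {T : E d ≃ₜ E d} (hT : ⇑T = Phi U t)
    (hTΩ : FixesBoundary Ω T) {g : Hhalf Ω →ₗ[ℝ] ℝ} {f : Hhalf Ω} {ut : H1 Ω}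
    (hut : IsNeumannSolution (transported U σ t) g f ut) {w : H1 Ω} {γ : Hhalf Ω}
    (hγ : IsTrace w γ) :
    ∫ x in Ω, σ x * ⟪pulledMatrix (t • DU x) (grad (hTΩ.pullback hΩ ut) x), grad w x⟫ = g γ := by
  set w' := hTΩ.symm.pullback hΩ w
  have hγ' : IsTrace w' γ :=
    hΩ.isTrace_iff.2 ((hTΩ.symm.trace_pullback hΩ w).trans (hΩ.isTrace_iff.1 hγ))
  rw [← hut.weak_eq w' γ hγ', ← hTΩ.setIntegral_comp hΩ.isOpen
    fun x => transported U σ t x * ⟪grad ut x, grad w' x⟫]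
  refine integral_congr_ae ?_
  have hw := hTΩ.grad_pullback hΩ w'
  rw [hTΩ.pullback_pullback_symm hΩ w] at hw
  filter_upwards [hTΩ.grad_pullback hΩ ut, hw, ae_restrict_of_ae (hU.ae_fderiv_eq hT),
    ae_restrict_of_ae ht] with x h1 h2 h3 h4
  rw [h1, h2, h3, inner_pulledMatrix h4, hT, transported_Phi (hT ▸ T.injective)]
  ring

theorem IsNeumannSolution.traceIntegral_eq {s : E d → ℝ} (hΩ : IsBoundedLipschitzDomain Ω)
    {g : Hhalf Ω →ₗ[ℝ] ℝ} {f : Hhalf Ω} {u : H1 Ω} (hu : IsNeumannSolution s g f u) :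
    hΩ.traceIntegral u = boundaryIntegral f :=
  hu.normalization.elim fun _ h => (hΩ.boundaryIntegral_eq_traceIntegral h.1).symm.trans h.2

theorem FixesBoundary.traceIntegral_pullback {T : E d ≃ₜ E d} (hΩ : IsBoundedLipschitzDomain Ω)
    (hT : FixesBoundary Ω T) (w : H1 Ω) :
    hΩ.traceIntegral (hT.pullback hΩ w) = hΩ.traceIntegral w := by
  rw [hΩ.traceIntegral_apply, hΩ.traceIntegral_apply, hT.trace_pullback]

theorem IsW1Infty.exists_hasDerivAt_pulledMatrix (hU : IsW1Infty U DU) (Ω : Set (E d)) :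
    ∃ (a : ℝ → Lp (E d →L[ℝ] E d) ∞ (volume.restrict Ω))
      (a' : Lp (E d →L[ℝ] E d) ∞ (volume.restrict Ω)),
      (∀ᶠ t in 𝓝 0, a t =ᵐ[volume.restrict Ω] fun x => pulledMatrix (t • DU x)) ∧
      a' =ᵐ[volume.restrict Ω] calA DU ∧ HasDerivAt a a' 0 := by
  have hDU : MemLp DU ∞ (volume.restrict Ω) := hU.memLp_deriv.restrict Ω
  have hcont : ∀ᶠ M in 𝓝 0, ContinuousAt (pulledMatrix (d := d)) M := by
    filter_upwards [Metric.ball_mem_nhds 0 one_pos] with M hM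
    exact continuousAt_pulledMatrix (mem_ball_zero_iff.1 hM)
  obtain ⟨a, ha⟩ := ((eventually_memLp_top_comp_smul hcont hDU).mono
    fun t ht => (⟨ht.toLp, ht.coeFn_toLp⟩ :
      ∃ a : Lp (E d →L[ℝ] E d) ∞ (volume.restrict Ω), a =ᵐ[volume.restrict Ω] _)).choice
  exact ⟨a, _, ha, by rw [calA_eq]; exact MemLp.coeFn_toLp _,
    hasDerivAt_superposition hasFDerivAt_pulledMatrix hDU ha⟩

theorem IsW1Infty.eventually_norm_smul_lt_one (hU : IsW1Infty U DU) :
    ∀ᶠ t : ℝ in 𝓝 0, ∀ᵐ x, ‖t • DU x‖ < 1 := by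
  simpa only [mem_ball_zero_iff] using
    eventually_ae_smul_mem hU.memLp_deriv (Metric.ball_mem_nhds 0 one_pos)

theorem lpMul_pulledMatrix_zero {a : Lp (E d →L[ℝ] E d) ∞ (volume.restrict Ω)}
    (ha : a =ᵐ[volume.restrict Ω] fun x => pulledMatrix ((0 : ℝ) • DU x))
    (G : Lp (E d) 2 (volume.restrict Ω)) : lpMul a G = G := by
  refine Lp.ext ?_
  filter_upwards [coeFn_lpMul a G, ha] with x h1 h2
  rw [h1, h2, zero_smul ℝ (DU x), pulledMatrix_zero, one_apply_eq_self]

theorem exists_materialDerivative {σ : E d → ℝ} (hd : d ≠ 0) (hΩ : IsBoundedLipschitzDomain Ω)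
    (hσ : MemLp σ ∞ (volume.restrict Ω)) {lam : ℝ} (hlam : 0 < lam)
    (hσlam : ∀ᵐ x ∂(volume.restrict Ω), lam ≤ σ x)
    {a : ℝ → Lp (E d →L[ℝ] E d) ∞ (volume.restrict Ω)}
    {a' : Lp (E d →L[ℝ] E d) ∞ (volume.restrict Ω)} (ha : HasDerivAt a a' 0)
    (ha0 : ∀ G, lpMul (a 0) G = G) (u : H1 Ω) :
    ∃ udot : H1 Ω,
      (∀ w : H1 Ω, ⟪lpSMul hσ (grad udot), grad w⟫ = -⟪lpSMul hσ (lpMul a' (grad u)), grad w⟫) ∧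
      hΩ.traceIntegral udot = 0 ∧ ∀ v : ℝ → H1 Ω, (∀ᶠ t in 𝓝[≠] 0,
        (∀ w : H1 Ω, ⟪lpSMul hσ (lpMul (a t) (grad (v t))), grad w⟫ =
          ⟪lpSMul hσ (grad u), grad w⟫) ∧ hΩ.traceIntegral (v t) = hΩ.traceIntegral u) →
        Tendsto (fun t => t⁻¹ • (v t - u)) (𝓝[≠] 0) (𝓝 udot) := by
  have hm := hΩ.traceIntegral_one_ne_zero hd
  have hA : HasDerivAt (fun t => (lpSMul hσ).comp (lpMul (a t))) ((lpSMul hσ).comp (lpMul a')) 0 :=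
    hasDerivAt_clm_comp_apply (lpSMul hσ) lpMul ha
  have h0 : (lpSMul hσ).comp (lpMul (a 0)) = lpSMul (F := E d) hσ :=
    ContinuousLinearMap.ext fun G => congrArg (lpSMul hσ) (ha0 G)
  refine (hΩ.exists_norm_le hm).elim fun C hC => ?_
  have h := exists_derivative_of_weak_eq (D := H1.gradL Ω) hA hlam
    (fun G => by simpa only [h0] using mul_sq_norm_le_inner_lpSMul hσ hσlam G) hC
    (H1.grad_one hΩ.isBounded) hm u
  simp only [h0] at h
  exact h

theorem exists_eventually_eq_pullback (hΩ : IsBoundedLipschitzDomain Ω) (hU : IsW1Infty U DU)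
    (hU0 : ∀ᶠ x in 𝓝ˢ (frontier Ω), U x = 0) (ut : ℝ → H1 Ω) :
    ∃ v : ℝ → H1 Ω, ∀ᶠ t in 𝓝[≠] 0, ∃ (T : E d ≃ₜ E d) (hT : FixesBoundary Ω T),
      ⇑T = Phi U t ∧ v t = hT.pullback hΩ (ut t) :=
  (((hU.eventually_exists_homeomorph hU0).filter_mono nhdsWithin_le_nhds).mono
    fun t ht => ht.elim fun T hT => (⟨hT.2.pullback hΩ (ut t), T, hT.2, hT.1, rfl⟩ :
      ∃ (v : H1 Ω) (T : E d ≃ₜ E d) (hT : FixesBoundary Ω T),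
        ⇑T = Phi U t ∧ v = hT.pullback hΩ (ut t))).choice

theorem eventually_inner_eq_and_traceIntegral_eq {σ : E d → ℝ} (hΩ : IsBoundedLipschitzDomain Ω)
    (hU : IsW1Infty U DU) (hσ : MemLp σ ∞ (volume.restrict Ω))
    {a : ℝ → Lp (E d →L[ℝ] E d) ∞ (volume.restrict Ω)}
    (ha : ∀ᶠ t in 𝓝 0, a t =ᵐ[volume.restrict Ω] fun x => pulledMatrix (t • DU x))
    {g : Hhalf Ω →ₗ[ℝ] ℝ} {f : Hhalf Ω} {u : H1 Ω} (hu : IsNeumannSolution σ g f u)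
    {ut v : ℝ → H1 Ω}
    (hut : ∀ᶠ t in 𝓝[≠] (0 : ℝ), IsNeumannSolution (transported U σ t) g f (ut t))
    (hv : ∀ᶠ t in 𝓝[≠] (0 : ℝ), ∃ (T : E d ≃ₜ E d) (hT : FixesBoundary Ω T),
      ⇑T = Phi U t ∧ v t = hT.pullback hΩ (ut t)) :
    ∀ᶠ t in 𝓝[≠] (0 : ℝ), (∀ w : H1 Ω, ⟪lpSMul hσ (lpMul (a t) (grad (v t))), grad w⟫ =
      ⟪lpSMul hσ (grad u), grad w⟫) ∧ hΩ.traceIntegral (v t) = hΩ.traceIntegral u := by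
  filter_upwards [hut, hv, nhdsWithin_le_nhds ha,
    nhdsWithin_le_nhds hU.eventually_norm_smul_lt_one] with t hut hv hat hDU
  obtain ⟨T, hTΩ, hT, hvt⟩ := hv
  refine ⟨fun w => (hΩ.exists_isTrace w).elim fun γ hγ => ?_, ?_⟩
  · have hfield : lpMul (a t) (grad (v t)) =ᵐ[volume.restrict Ω]
        fun x => pulledMatrix (t • DU x) (grad (v t) x) := by
      filter_upwards [coeFn_lpMul (a t) (grad (v t)), hat] with x h1 h2
      rw [h1, h2]
    rw [inner_lpSMul hσ hfield, inner_lpSMul hσ (EventuallyEq.refl _ _), hu.weak_eq w γ hγ, hvt]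
    exact hut.setIntegral_pulledMatrix hΩ hU hDU hT hTΩ hγ
  · rw [hvt, hTΩ.traceIntegral_pullback hΩ, hut.traceIntegral_eq hΩ, hu.traceIntegral_eq hΩ]

end MaterialDerivative

end EIT

end

theorem lemma2p1_general {d : ℕ} (hd : d ≠ 0) (Ω : Set (E d)) (hΩ : IsBoundedLipschitzDomain Ω)
    (σ : E d → ℝ) (hσ : MemLp σ ⊤ (volume.restrict Ω))
    (lam : ℝ) (hlam : 0 < lam) (hσlam : ∀ᵐ x ∂(volume.restrict Ω), lam ≤ σ x)
    (U : E d → E d) (DU : E d → E d →L[ℝ] E d) (hU : IsW1Infty U DU)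
    (hU0 : ∀ᶠ x in 𝓝ˢ (frontier Ω), U x = 0) (g : Hhalf Ω →ₗ[ℝ] ℝ) (f : Hhalf Ω)
    (u : H1 Ω) (hu : IsNeumannSolution σ g f u) :
    ∃ udot : H1 Ω,
      (∀ w : H1 Ω, ∫ x in Ω, σ x * ⟪grad udot x, grad w x⟫
        = - ∫ x in Ω, σ x * ⟪calA DU x (grad u x), grad w x⟫) ∧
      (∃ γ : Hhalf Ω, IsTrace udot γ ∧ boundaryIntegral γ = 0) ∧
      ∀ ut : ℝ → H1 Ω,
        (∀ᶠ t in 𝓝[≠] (0 : ℝ), IsNeumannSolution (transported U σ t) g f (ut t)) →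
        HasMaterialDerivative U u ut udot := by
  obtain ⟨a, a', ha, ha', hderiv⟩ := hU.exists_hasDerivAt_pulledMatrix Ω
  have hcalA : lpMul a' (grad u) =ᵐ[volume.restrict Ω] fun x => calA DU x (grad u x) := by
    filter_upwards [coeFn_lpMul a' (grad u), ha'] with x h1 h2
    rw [h1, h2]
  have ha0 := lpMul_pulledMatrix_zero ha.self_of_nhds
  obtain ⟨udot, hweak, hmean, hlim⟩ := exists_materialDerivative hd hΩ hσ hlam hσlam hderiv ha0 u
  refine ⟨udot, fun w => ?_, (hΩ.exists_isTrace udot).imp fun γ hγ =>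
    ⟨hγ, (hΩ.boundaryIntegral_eq_traceIntegral hγ).trans hmean⟩, fun ut hut => ?_⟩
  · rw [← inner_lpSMul hσ (EventuallyEq.refl _ _), ← inner_lpSMul hσ hcalA]
    exact hweak w
  · obtain ⟨v, hv⟩ := exists_eventually_eq_pullback hΩ hU hU0 ut
    refine ⟨v, ?_, hlim v (eventually_inner_eq_and_traceIntegral_eq hΩ hU hσ ha hu hut hv)⟩
    filter_upwards [hv] with t ⟨T, hT, hTU, hvt⟩
    rw [hvt, ← hTU]
    exact hT.fn_pullback hΩ (ut t)

theorem lemma2p1 {d : ℕ} (hd : d = 2 ∨ d = 3) (Ω : Set (E d)) (hΩ : IsBoundedLipschitzDomain Ω)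
    (σ : E d → ℝ) (hσ : MemLp σ ∞ (volume.restrict Ω))
    (lam : ℝ) (hlam : 0 < lam) (hσlam : ∀ᵐ x ∂(volume.restrict Ω), lam ≤ σ x)
    (U : E d → E d) (DU : E d → E d →L[ℝ] E d) (hU : IsW1Infty U DU)
    (hU0 : ∀ᶠ x in 𝓝ˢ (frontier Ω), U x = 0)
    (g : Hhalf Ω →ₗ[ℝ] ℝ) (hg : IsNeumannDatum g) (f : Hhalf Ω)
    (u : H1 Ω) (hu : IsNeumannSolution σ g f u) :
    ∃ udot : H1 Ω,
      (∀ w : H1 Ω, ∫ x in Ω, σ x * ⟪grad udot x, grad w x⟫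
        = - ∫ x in Ω, σ x * ⟪calA DU x (grad u x), grad w x⟫) ∧
      (∃ γ : Hhalf Ω, IsTrace udot γ ∧ boundaryIntegral γ = 0) ∧
      ∀ ut : ℝ → H1 Ω,
        (∀ᶠ t in 𝓝[≠] (0 : ℝ), IsNeumannSolution (transported U σ t) g f (ut t)) →
        HasMaterialDerivative U u ut udot :=
  lemma2p1_general (by lia) Ω hΩ σ hσ lam hlam hσlam U DU hU hU0 g f u hu
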